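/- **Setting.** Spacetime is $\mathbf R^n$ with coordinates $x^\mu$. There are finitely many bosonic fields $\phi^i$. A *local function* is a smooth real function of $x^\mu$, the $\phi^i$ and finitely many of their derivatives $\partial_I\phi^i$ ($I$ a multi-index, all jet coordinates being independent). Let $\mathcal L_0$ be a local function (the Lagrangian), with Euler–Lagrange derivatives $\mathcal L_i=\sum_I(-1)^{|I|}\partial_I\bigl(\partial\mathcal L_0/\partial(\partial_I\phi^i)\bigr)$, let $\delta_\varepsilon\phi^i=\sum_I R^{iI}_\alpha\partial_I\varepsilon^\alpha$ ($\alpha$ in a finite set) be its gauge transformations, so that the Noether identities $\sum_{i,I}(-1)^{|I|}\partial_I(R^{iI}_\alpha\mathcal L_i)=0$ hold, and let $Z^{\alpha I}_\Delta$ ($\Delta$ in a finite set) be first order reducibility functions; $R$, $Z$ and the $M$ below are local functions, finitely many for each $\alpha$, $\Delta$. (The set of $\Delta$'s, or both sets, may be empty.) *Local forms* are polynomials in the odd variables $dx^\mu,\ \partial_IC^\alpha,\ \partial_I\phi^*_i,\ \partial_IC^*_\Delta$ and the even variables $\partial_IC^\Delta,\ \partial_IC^*_\alpha$ (graded commutative)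 with local functions as coefficients. The form degree counts the $dx^\mu$; the antighost number is $1,2,3$ for $\phi^*_i,C^*_\alpha,C^*_\Delta$ and their derivatives and $0$ for the other variables. With $\partial_\mu$ the total derivative ($\partial_\mu dx^\nu=0$), $d a=\sum_\mu(\partial_\mu a)\,dx^\mu$. The Koszul–Tate differential $\delta$ is the graded derivation acting from the right that commutes with $\partial_\mu$, annihilates local functions, ghosts $C^\alpha,C^\Delta$ and $dx^\mu$, and satisfies $$\delta\phi^*_i=-\mathcal L_i,\qquad \delta C^*_\alpha=\sum_{i,I}(-1)^{|I|}\partial_I(\phi^*_iR^{iI}_\alpha),$$ $$\delta C^*_\Delta=-\sum_{\alpha,I}(-1)^{|I|}\partial_I(C^*_\alpha Z^{\alpha I}_\Delta)+\tfrac12\sum \partial_I\phi^*_i\,\partial_J\phi^*_j\,M^{iI,jJ}_\Delta ,$$ where $M$ is such that $\delta^2C^*_\Delta=0$. **Regularity.** The equations $\partial_I\mathcal L_i=0$, the Noether identities $\delta\,\partial_I C^*_\alpha$ and the reducibility relations $\delta\,\partial_I C^*_\Delta$ are exhausted by increasing sequences of finite sets $E_m,G_m,P_m$ such that the identities in $G_m$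 involve only equations in $E_m$, the relations in $P_m$ involve only identities in $G_m$ and equations in $E_m$, and, at every point of jet space where all equations in $E_m$ hold, there are subsets $E'\subset E_m$, $G'\subset G_m$ for which: the differentials of the left-hand sides of the equations in $E'$ are linearly independent (so these functions may be taken as part of a coordinate system); the square matrix of the coefficients of the equations in $E_m\setminus E'$ in the identities in $G'$ is invertible; and the square matrix of the coefficients of the identities in $G_m\setminus G'$ in the relations in $P_m$ is invertible. Moreover the equations of motion are not contradictory: any finitely many of the equations $\partial_I\mathcal L_i=0$ have a common solution in jet space. **Groups.** For $p,k\in\mathbf Z$ let $\Omega^p_k$ be the real vector space of local forms of form degree $p$ and antighost number $k$ (zero if $p<0$ or $k<0$), and $$H^p_k(\delta|d)=\frac{\{a\in\Omega^p_k:\ \delta a+db=0\ \text{for some } b\in\Omega^{p-1}_{k-1}\}}{\{\delta m+dc:\ m\in\Omega^p_{k+1},\ c\in\Omega^{p-1}_k\}} .$$ **Theorem.** (i) If $1\le p\le n$ and $k>1$, there is a linear isomorphism $$H^p_k(\delta|d)\;\simeq\;H^{p-1}_{k-1}(\delta|d)$$ given by descent: whenever $a\in\Omega^p_k$ and $b\in\Omega^{p-1}_{k-1}$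 satisfy $\delta a+db=0$, $b$ represents a class in $H^{p-1}_{k-1}(\delta|d)$ and $[a]\mapsto[b]$. (ii) $H^p_k(\delta|d)=0$ whenever $k>p$. -/

import Mathlib

open scoped TensorProduct ContDiff

noncomputable section

namespace LocalForms

/-! ## Jet space and local functions -/

/-- Derivative multi-indices on `ℝⁿ`. -/
abbrev MI (n : ℕ) : Type := Fin n → ℕ

/-- The multi-index `I + e_μ`. -/
def MI.succ {n : ℕ} (I : MI n) (μ : Fin n) : MI n := I + Pi.single μ 1

/-- The order `|I|` of a multi-index. -/
def MI.order {n : ℕ} (I : MI n) : ℕ := ∑ μ, I μ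

/-- Coordinates of the infinite jet space: `Sum.inl μ` is `x^μ` and `Sum.inr (i, I)` is `∂_I φ^i`. -/
abbrev Coord (n : ℕ) (ι : Type*) : Type _ := Fin n ⊕ (ι × MI n)

/-- The algebra of functions that depend smoothly on finitely many jet coordinates. -/
def locSubalgebra (n : ℕ) (ι : Type*) : Subalgebra ℝ ((Coord n ι → ℝ) → ℝ) where
  carrier := {f | ∃ (S : Finset (Coord n ι)) (g : (S → ℝ) → ℝ),
    ContDiff ℝ ∞ g ∧ ∀ u, f u = g (fun s => u s)}
  mul_mem' := by
    classical
    rintro f₁ f₂ ⟨S₁, g₁, h₁, e₁⟩ ⟨S₂, g₂, h₂, e₂⟩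
    refine ⟨S₁ ∪ S₂, fun v =>
      g₁ (fun s => v ⟨s.1, Finset.mem_union_left _ s.2⟩) *
      g₂ (fun s => v ⟨s.1, Finset.mem_union_right _ s.2⟩), ?_, ?_⟩
    · exact (h₁.comp (by fun_prop)).mul (h₂.comp (by fun_prop))
    · intro u; simp [e₁, e₂]
  add_mem' := by
    classical
    rintro f₁ f₂ ⟨S₁, g₁, h₁, e₁⟩ ⟨S₂, g₂, h₂, e₂⟩
    refine ⟨S₁ ∪ S₂, fun v =>
      g₁ (fun s => v ⟨s.1, Finset.mem_union_left _ s.2⟩) +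
      g₂ (fun s => v ⟨s.1, Finset.mem_union_right _ s.2⟩), ?_, ?_⟩
    · exact (h₁.comp (by fun_prop)).add (h₂.comp (by fun_prop))
    · intro u; simp [e₁, e₂]
  algebraMap_mem' := by
    intro r
    exact ⟨∅, fun _ => r, contDiff_const, fun u => rfl⟩

/-- Local functions: smooth functions of finitely many jet coordinates, i.e. smooth functions on
some finite dimensional jet space. -/
def LocFun (n : ℕ) (ι : Type*) : Type _ := ↥(locSubalgebra n ι)

instance (n : ℕ) (ι : Type*) : CommRing (LocFun n ι) :=
  inferInstanceAs (CommRing ↥(locSubalgebra n ι))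

instance (n : ℕ) (ι : Type*) : Algebra ℝ (LocFun n ι) :=
  inferInstanceAs (Algebra ℝ ↥(locSubalgebra n ι))

/-- The value of a local function at a point of jet space. -/
def evalFun {n : ℕ} {ι : Type*} (u : Coord n ι → ℝ) : LocFun n ι →ₐ[ℝ] ℝ :=
  ((Pi.evalAlgHom ℝ (fun _ : Coord n ι → ℝ => ℝ) u).comp (locSubalgebra n ι).val :
    ↥(locSubalgebra n ι) →ₐ[ℝ] ℝ)

/-- A jet coordinate as a local function. -/
def coord {n : ℕ} {ι : Type*} (c : Coord n ι) : LocFun n ι :=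
  ⟨fun u => u c, {c}, fun v => v ⟨c, Finset.mem_singleton_self c⟩, by fun_prop, fun _ => rfl⟩

theorem hasDerivAt_update {n : ℕ} {ι : Type*} [DecidableEq (Coord n ι)] {f : (Coord n ι → ℝ) → ℝ}
    {S : Finset (Coord n ι)} {g : (S → ℝ) → ℝ} (hg : ContDiff ℝ ∞ g)
    (hf : ∀ u, f u = g (fun s => u s)) (c : Coord n ι) (u : Coord n ι → ℝ) :
    HasDerivAt (fun t => f (Function.update u c t))
      (fderiv ℝ g (fun s => u s) (fun s => if s.1 = c then 1 else 0)) (u c) := by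
  have hpath : HasDerivAt (fun t : ℝ => (fun s : S => Function.update u c t s.1))
      (fun s : S => if s.1 = c then (1 : ℝ) else 0) (u c) := by
    rw [hasDerivAt_pi]
    intro s
    by_cases h : s.1 = c
    · simp only [h, Function.update_self, if_true]
      exact hasDerivAt_id _
    · simp only [Function.update_of_ne h, h, if_false]
      exact hasDerivAt_const _ _
  have hval : (fun s : S => Function.update u c (u c) s.1) = fun s : S => u s.1 := by
    simp
  have hd : HasFDerivAt g (fderiv ℝ g (fun s => u s))
      (fun s : S => Function.update u c (u c) s.1) := by
    rw [hval]
    exact (hg.differentiable (by simp) _).hasFDerivAt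
  have := hd.comp_hasDerivAt (u c) hpath
  simpa only [hf, Function.comp_def] using this

/-- The partial derivative `∂/∂c` of local functions along a jet coordinate `c`. -/
def pder {n : ℕ} {ι : Type*} (c : Coord n ι) : LocFun n ι →ₗ[ℝ] LocFun n ι where
  toFun f := ⟨fun u => deriv (fun t => f.1 (@Function.update _ _ (Classical.decEq _) u c t)) (u c), by
    let := Classical.decEq (Coord n ι)
    obtain ⟨S, g, hg, hf⟩ := f.2
    refine ⟨S, fun v => fderiv ℝ g v (fun s => if s.1 = c then 1 else 0), ?_, ?_⟩
    · exact (hg.fderiv_right (by simp)).clm_apply contDiff_const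
    · intro u
      exact (hasDerivAt_update hg hf c u).deriv⟩
  map_add' f₁ f₂ := by
    let := Classical.decEq (Coord n ι)
    obtain ⟨S₁, g₁, hg₁, hf₁⟩ := f₁.2
    obtain ⟨S₂, g₂, hg₂, hf₂⟩ := f₂.2
    refine Subtype.ext (funext fun u => ?_)
    exact deriv_add (hasDerivAt_update hg₁ hf₁ c u).differentiableAt
      (hasDerivAt_update hg₂ hf₂ c u).differentiableAt
  map_smul' r f := by
    let := Classical.decEq (Coord n ι)
    obtain ⟨S, g, hg, hf⟩ := f.2
    refine Subtype.ext (funext fun u => ?_)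
    exact deriv_const_mul r (hasDerivAt_update hg hf c u).differentiableAt

theorem pder_finite {n : ℕ} {ι : Type*} (f : LocFun n ι) :
    {c : Coord n ι | pder c f ≠ 0}.Finite := by
  let := Classical.decEq (Coord n ι)
  obtain ⟨S, g, hg, hf⟩ := f.2
  refine S.finite_toSet.subset fun c hc => ?_
  by_contra hcS
  refine hc ?_
  refine Subtype.ext (funext fun u => ?_)
  have h0 : (fun s : S => if s.1 = c then (1 : ℝ) else 0) = 0 := by
    funext s
    have : s.1 ≠ c := fun h => hcS (h ▸ s.2)
    simp [this]
  have h1 := (hasDerivAt_update hg hf c u).deriv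
  rw [h0] at h1
  exact h1.trans (fderiv ℝ g (fun s => u s)).map_zero

/-- The pointwise finite sum of a family of linear maps. -/
def sumMap {G A B : Type*} [AddCommGroup A] [Module ℝ A] [AddCommGroup B] [Module ℝ B]
    (T : G → A →ₗ[ℝ] B) (hT : ∀ a, {g | T g a ≠ 0}.Finite) : A →ₗ[ℝ] B where
  toFun a := ∑ᶠ g, T g a
  map_add' a b := by
    simp only [map_add]
    exact finsum_add_distrib (hT a) (hT b)
  map_smul' r a := by
    simp only [map_smul, RingHom.id_apply]
    exact (smul_finsum' r (hT a)).symm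

/-- The components of the total derivative along `x^μ`: `x^ν ↦ δ^ν_μ`, `∂_I φ^i ↦ ∂_μ ∂_I φ^i`. -/
def coordShift {n : ℕ} {ι : Type*} (μ : Fin n) : Coord n ι → LocFun n ι
  | Sum.inl ν => if ν = μ then 1 else 0
  | Sum.inr (i, I) => coord (Sum.inr (i, I.succ μ))

/-- The total derivative `∂_μ` of local functions,
`∂_μ f = ∂f/∂x^μ + ∑_{i,I} (∂f/∂(∂_I φ^i)) ∂_μ ∂_I φ^i`. -/
def locD {n : ℕ} {ι : Type*} (μ : Fin n) : Module.End ℝ (LocFun n ι) :=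
  sumMap (fun c => (LinearMap.mulRight ℝ (coordShift μ c)).comp (pder c)) (fun f =>
    (pder_finite f).subset fun c hc h0 => hc (by simp [h0]))

/-- The iterated total derivative `∂_I`, for a family of operators `∂_μ`. -/
def iterD {n : ℕ} {A : Type*} [AddCommGroup A] [Module ℝ A]
    (D : Fin n → Module.End ℝ A) (I : MI n) : Module.End ℝ A :=
  ((List.finRange n).map fun μ => D μ ^ I μ).prod

/-! ## Ghosts, antifields and local forms -/

/-- The odd generators: `dx^μ` and the derivatives of the ghosts `C^α`, of the antifields `φ*_i`
and of the antifields `C*_Δ` (here `α : γ`, `i : ι`, `Δ : κ`). -/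
inductive OddGen (n : ℕ) (ι γ κ : Type*)
  | dx (μ : Fin n)
  | ghost (α : γ) (I : MI n)
  | afField (i : ι) (I : MI n)
  | afRed (Δ : κ) (I : MI n)

/-- The even generators: the derivatives of the ghosts of ghosts `C^Δ` and of the antifields
`C*_α`. -/
inductive EvenGen (n : ℕ) (γ κ : Type*)
  | ghost (Δ : κ) (I : MI n)
  | afGauge (α : γ) (I : MI n)

abbrev Gen (n : ℕ) (ι γ κ : Type*) : Type _ := OddGen n ι γ κ ⊕ EvenGen n γ κ

/-- Exterior algebra on the odd generators. -/
abbrev OddAlg (n : ℕ) (ι γ κ : Type*) : Type _ := ExteriorAlgebra ℝ (OddGen n ι γ κ →₀ ℝ)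

/-- Polynomials in the even generators, exterior polynomials in the odd ones. -/
def GenAlg (n : ℕ) (ι γ κ : Type*) : Type _ :=
  MvPolynomial (EvenGen n γ κ) ℝ ⊗[ℝ] OddAlg n ι γ κ

instance (n : ℕ) (ι γ κ : Type*) : Ring (GenAlg n ι γ κ) :=
  inferInstanceAs (Ring (MvPolynomial (EvenGen n γ κ) ℝ ⊗[ℝ] OddAlg n ι γ κ))

instance (n : ℕ) (ι γ κ : Type*) : Algebra ℝ (GenAlg n ι γ κ) :=
  inferInstanceAs (Algebra ℝ (MvPolynomial (EvenGen n γ κ) ℝ ⊗[ℝ] OddAlg n ι γ κ))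

/-- The algebra of local forms: polynomials in the even generators, exterior polynomials in the
odd generators, with local functions as coefficients. -/
def Form (n : ℕ) (ι γ κ : Type*) : Type _ := LocFun n ι ⊗[ℝ] GenAlg n ι γ κ

instance (n : ℕ) (ι γ κ : Type*) : Ring (Form n ι γ κ) :=
  inferInstanceAs (Ring (LocFun n ι ⊗[ℝ] GenAlg n ι γ κ))

instance (n : ℕ) (ι γ κ : Type*) : Algebra ℝ (Form n ι γ κ) :=
  inferInstanceAs (Algebra ℝ (LocFun n ι ⊗[ℝ] GenAlg n ι γ κ))

section Algebra

variable {n : ℕ} {ι γ κ : Type*}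

/-- A local form with one coefficient. -/
def tens (f : LocFun n ι) (b : GenAlg n ι γ κ) : Form n ι γ κ :=
  TensorProduct.tmul ℝ f b

/-- A monomial with separated even and odd generators. -/
def genTens (q : MvPolynomial (EvenGen n γ κ) ℝ) (w : OddAlg n ι γ κ) : GenAlg n ι γ κ :=
  TensorProduct.tmul ℝ q w

/-- A local function as a local `0`-form. -/
def ofFun (f : LocFun n ι) : Form n ι γ κ := tens f 1

/-- A generator as a local form. -/
def gen : Gen n ι γ κ → Form n ι γ κ
  | Sum.inl o => tens 1 (genTens 1 (ExteriorAlgebra.ι ℝ (Finsupp.single o 1)))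
  | Sum.inr e => tens 1 (genTens (MvPolynomial.X e) 1)

/-- The right derivative of exterior polynomials along an odd generator. -/
def oddRder (o : OddGen n ι γ κ) : OddAlg n ι γ κ →ₗ[ℝ] OddAlg n ι γ κ :=
  CliffordAlgebra.contractRight.flip (Finsupp.lapply o)

/-- The right partial derivative `∂ᴿ/∂g` of polynomials in the generators. -/
def genRder : Gen n ι γ κ → Module.End ℝ (GenAlg n ι γ κ)
  | Sum.inl o => LinearMap.lTensor (MvPolynomial (EvenGen n γ κ) ℝ) (oddRder o)
  | Sum.inr e => LinearMap.rTensor (OddAlg n ι γ κ) (MvPolynomial.pderiv e).toLinearMap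

/-- The right partial derivative `∂ᴿ/∂g` of local forms along a generator `g`. -/
def rder (g : Gen n ι γ κ) : Module.End ℝ (Form n ι γ κ) :=
  LinearMap.lTensor (LocFun n ι) (genRder g)

theorem oddRder_finite (a : OddAlg n ι γ κ) : {o | oddRder o a ≠ 0}.Finite := by
  classical
  induction a using CliffordAlgebra.right_induction with
  | algebraMap r =>
    convert Set.finite_empty using 1
    ext o
    simp [oddRder]
  | add x y hx hy =>
    refine (hx.union hy).subset fun o ho => ?_
    by_contra h
    simp only [Set.mem_union, Set.mem_ofPred_eq, not_or, not_not] at h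
    exact ho (by rw [map_add, h.1, h.2, add_zero])
  | mul_ι m x hx =>
    refine (hx.union m.support.finite_toSet).subset fun o ho => ?_
    by_contra h
    simp only [Set.mem_union, Set.mem_ofPred_eq, not_or, not_not, Finset.mem_coe,
      Finsupp.mem_support_iff] at h
    refine ho ?_
    have h1 : CliffordAlgebra.contractRight x (Finsupp.lapply o : (_ →₀ ℝ) →ₗ[ℝ] ℝ) = 0 := h.1
    simp [oddRder, CliffordAlgebra.contractRight_mul_ι, h1, h.2]

theorem genRder_finite (a : GenAlg n ι γ κ) : {g | genRder g a ≠ 0}.Finite := by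
  classical
  induction a using TensorProduct.induction_on with
  | zero => exact Set.finite_empty.subset fun g hg => (hg (genRder g).map_zero).elim
  | add x y hx hy =>
    refine (hx.union hy).subset fun o ho => ?_
    by_contra h
    simp only [Set.mem_union, Set.mem_ofPred_eq, not_or, not_not] at h
    exact ho (((genRder o).map_add x y).trans (by rw [h.1, h.2, add_zero]))
  | tmul q w =>
    refine (((oddRder_finite w).image Sum.inl).union
      (q.vars.finite_toSet.image Sum.inr)).subset fun g hg => ?_
    rcases g with o | e
    · refine Or.inl ⟨o, fun h => hg ?_, rfl⟩
      refine (LinearMap.lTensor_tmul _ _ _ _).trans ?_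
      rw [h]
      exact TensorProduct.tmul_zero _ _
    · refine Or.inr ⟨e, ?_, rfl⟩
      by_contra h
      refine hg ?_
      refine (LinearMap.rTensor_tmul _ _ _ _).trans ?_
      have : (MvPolynomial.pderiv e).toLinearMap q = 0 :=
        MvPolynomial.pderiv_eq_zero_of_notMem_vars h
      rw [this]
      exact TensorProduct.zero_tmul _ _

theorem rder_finite (a : Form n ι γ κ) : {g | rder g a ≠ 0}.Finite := by
  classical
  induction a using TensorProduct.induction_on with
  | zero => exact Set.finite_empty.subset fun g hg => (hg (rder g).map_zero).elim
  | add x y hx hy =>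
    refine (hx.union hy).subset fun o ho => ?_
    by_contra h
    simp only [Set.mem_union, Set.mem_ofPred_eq, not_or, not_not] at h
    exact ho (((rder o).map_add x y).trans (by rw [h.1, h.2, add_zero]))
  | tmul f b =>
    refine (genRder_finite b).subset fun g hg h => hg ?_
    refine (LinearMap.lTensor_tmul _ _ _ _).trans ?_
    rw [h]
    exact TensorProduct.tmul_zero _ _

/-- The right (anti)derivation `a ↦ ∑_g (∂ᴿa/∂g) X_g` which is linear over the local functions and
maps each generator `g` to `X_g`. -/
def vecField (X : Gen n ι γ κ → Form n ι γ κ) : Form n ι γ κ →ₗ[ℝ] Form n ι γ κ :=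
  sumMap (fun g => (LinearMap.mulRight ℝ (X g)).comp (rder g)) (fun a =>
    (rder_finite a).subset fun g hg h0 => hg (by simp [h0]))

/-- The derivative `∂_μ` of the generators (`∂_μ dx^ν = 0`). -/
def genShift (μ : Fin n) : Gen n ι γ κ → Form n ι γ κ
  | Sum.inl (OddGen.dx _) => 0
  | Sum.inl (OddGen.ghost α I) => gen (Sum.inl (OddGen.ghost α (I.succ μ)))
  | Sum.inl (OddGen.afField i I) => gen (Sum.inl (OddGen.afField i (I.succ μ)))
  | Sum.inl (OddGen.afRed Δ I) => gen (Sum.inl (OddGen.afRed Δ (I.succ μ)))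
  | Sum.inr (EvenGen.ghost Δ I) => gen (Sum.inr (EvenGen.ghost Δ (I.succ μ)))
  | Sum.inr (EvenGen.afGauge α I) => gen (Sum.inr (EvenGen.afGauge α (I.succ μ)))

/-- The total derivative `∂_μ` acting on the coefficients of local forms only. -/
def coeffD (μ : Fin n) : Module.End ℝ (Form n ι γ κ) :=
  LinearMap.rTensor (GenAlg n ι γ κ) (locD μ)

/-- The total derivative `∂_μ` of local forms. -/
def totD (μ : Fin n) : Module.End ℝ (Form n ι γ κ) := coeffD μ + vecField (genShift μ)

/-- The exterior derivative in spacetime, `d a = ∑_μ (∂_μ a) dx^μ`. -/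
def extD : Form n ι γ κ →ₗ[ℝ] Form n ι γ κ :=
  ∑ μ : Fin n, (LinearMap.mulRight ℝ (gen (Sum.inl (OddGen.dx μ)))).comp (totD μ)

/-- Form degree of the generators. -/
def formDeg : Gen n ι γ κ → ℤ
  | Sum.inl (OddGen.dx _) => 1
  | _ => 0

/-- Antighost number of the generators. -/
def antigh : Gen n ι γ κ → ℤ
  | Sum.inl (OddGen.afField _ _) => 1
  | Sum.inr (EvenGen.afGauge _ _) => 2
  | Sum.inl (OddGen.afRed _ _) => 3
  | _ => 0

/-- The local forms of form degree `p` and antighost number `k` (zero if `p < 0` or `k < 0`),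
with arbitrary polynomial dependence on the ghosts. -/
def forms (n : ℕ) (ι γ κ : Type*) (p k : ℤ) : Submodule ℝ (Form n ι γ κ) :=
  Submodule.span ℝ {a | ∃ (f : LocFun n ι) (l : List (Gen n ι γ κ)),
    (l.map formDeg).sum = p ∧ (l.map antigh).sum = k ∧ a = ofFun f * (l.map gen).prod}

/-- The value at a point `u` of jet space of the part of a local form that involves no
generator. -/
def evalAt (u : Coord n ι → ℝ) : Form n ι γ κ →ₐ[ℝ] ℝ :=
  (Algebra.TensorProduct.lift
    (evalFun u)
    (Algebra.TensorProduct.lift (MvPolynomial.aeval fun _ => (0 : ℝ))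
      (ExteriorAlgebra.algebraMapInv (R := ℝ) (M := OddGen n ι γ κ →₀ ℝ))
      (fun _ _ => Commute.all _ _) : GenAlg n ι γ κ →ₐ[ℝ] ℝ)
    (fun _ _ => Commute.all _ _) : LocFun n ι ⊗[ℝ] GenAlg n ι γ κ →ₐ[ℝ] ℝ)

end Algebra

/-! ## Gauge theories and the Koszul-Tate differential -/

/-- The Euler-Lagrange derivative `δL/δφ^i = ∑_I (-1)^{|I|} ∂_I (∂L/∂(∂_I φ^i))`. -/
def eulerLagrange {n : ℕ} {ι : Type*} (L : LocFun n ι) (i : ι) : LocFun n ι :=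
  ∑ᶠ I : MI n, (-1 : ℝ) ^ I.order • iterD locD I (pder (Sum.inr (i, I)) L)

/-- The data of a Lagrangian theory with bosonic fields `φ^i` (`i : ι`), gauge parameters indexed
by `γ` and first order reducibility functions indexed by `κ`. -/
structure GaugeData (n : ℕ) (ι γ κ : Type*) where
  /-- the Lagrangian -/
  L : LocFun n ι
  /-- the gauge transformations `δ_ε φ^i = ∑_I R^{iI}_α ∂_I ε^α` -/
  R : γ → (ι × MI n) →₀ LocFun n ι
  /-- the reducibility functions `Z^{αI}_Δ` -/
  Z : κ → (γ × MI n) →₀ LocFun n ι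
  /-- the coefficients of `∂_I φ*_i ∂_J φ*_j` in `δ C*_Δ` (up to a factor 1/2) -/
  M : κ → ((ι × MI n) × (ι × MI n)) →₀ LocFun n ι

namespace GaugeData

variable {n : ℕ} {ι γ κ : Type*} (T : GaugeData n ι γ κ)

/-- The equation of motion `∂_I (δL/δφ^i)`, for `e = (i, I)`. -/
def eqn (e : ι × MI n) : LocFun n ι := iterD locD e.2 (eulerLagrange T.L e.1)

/-- The antifield `∂_I φ*_i`, for `e = (i, I)`. -/
def af (e : ι × MI n) : Form n ι γ κ := gen (Sum.inl (OddGen.afField e.1 e.2))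

/-- The antifield `∂_I C*_α`, for `g = (α, I)`. -/
def afG (g : γ × MI n) : Form n ι γ κ := gen (Sum.inr (EvenGen.afGauge g.1 g.2))

/-- `δ C*_α = ∑_{i,I} (-1)^{|I|} ∂_I (φ*_i R^{iI}_α)`. -/
def deltaGauge (α : γ) : Form n ι γ κ :=
  (T.R α).sum fun e r => (-1 : ℝ) ^ e.2.order • iterD totD e.2 (af (e.1, 0) * ofFun r)

/-- `δ C*_Δ = - ∑_{α,I} (-1)^{|I|} ∂_I (C*_α Z^{αI}_Δ) + ½ ∑ ∂_I φ*_i ∂_J φ*_j M^{iI,jJ}_Δ`. -/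
def deltaRed (Δ : κ) : Form n ι γ κ :=
  -((T.Z Δ).sum fun g z => (-1 : ℝ) ^ g.2.order • iterD totD g.2 (afG (g.1, 0) * ofFun z)) +
    (1 / 2 : ℝ) • (T.M Δ).sum fun ef m => af ef.1 * af ef.2 * ofFun m

/-- The values of the Koszul-Tate differential on the generators. -/
def deltaGen : Gen n ι γ κ → Form n ι γ κ
  | Sum.inl (OddGen.afField i I) => -ofFun (T.eqn (i, I))
  | Sum.inr (EvenGen.afGauge α I) => iterD totD I (T.deltaGauge α)
  | Sum.inl (OddGen.afRed Δ I) => iterD totD I (T.deltaRed Δ)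
  | _ => 0

/-- The Koszul-Tate differential: it annihilates the fields, the ghosts and `dx^μ`, commutes with
`∂_μ` and obeys the graded Leibniz rule from the right. -/
def delta : Form n ι γ κ →ₗ[ℝ] Form n ι γ κ := vecField T.deltaGen

/-- The coefficient at `u` of the equation `e` in the (differentiated) Noether identity `g`. -/
def noetherCoeff (g : γ × MI n) (e : ι × MI n) (u : Coord n ι → ℝ) : ℝ :=
  evalAt u (rder (Sum.inl (OddGen.afField e.1 e.2))
    (T.deltaGen (Sum.inr (EvenGen.afGauge g.1 g.2))))

/-- The coefficient at `u` of the Noether identity `g` in the (differentiated) reducibility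
relation `r`. -/
def redCoeff (r : κ × MI n) (g : γ × MI n) (u : Coord n ι → ℝ) : ℝ :=
  evalAt u (rder (Sum.inr (EvenGen.afGauge g.1 g.2))
    (T.deltaGen (Sum.inl (OddGen.afRed r.1 r.2))))

/-- A finite set `E` of equations of motion, `G` of Noether identities and `P` of reducibility
relations (derivatives included) is closed if the identities in `G` only involve equations in `E`
and the relations in `P` only involve identities in `G` and equations in `E`. -/
structure ClosedLevel (E : Finset (ι × MI n)) (G : Finset (γ × MI n)) (P : Finset (κ × MI n)) :
    Prop where
  noether : ∀ g ∈ G, ∀ e, e ∉ E → rder (Sum.inl (OddGen.afField e.1 e.2))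
    (T.deltaGen (Sum.inr (EvenGen.afGauge g.1 g.2))) = 0
  red : ∀ r ∈ P, ∀ g, g ∉ G → rder (Sum.inr (EvenGen.afGauge g.1 g.2))
    (T.deltaGen (Sum.inl (OddGen.afRed r.1 r.2))) = 0
  red_af : ∀ r ∈ P, ∀ e, e ∉ E → rder (Sum.inl (OddGen.afField e.1 e.2))
    (T.deltaGen (Sum.inl (OddGen.afRed r.1 r.2))) = 0

/-- The regularity conditions at a point `u` of the stationary surface. The equations in `E` split
into independent ones (`I`), which may be taken as part of a coordinate system of the jet space
near `u`, and dependent ones; the identities in `G` split into independent ones (`J`) and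
dependent ones. The independent identities can be solved (uniquely) for the dependent equations,
and the relations in `P`, which are all independent, can be solved for the dependent
identities. -/
def RegularAt (E : Finset (ι × MI n)) (G : Finset (γ × MI n)) (P : Finset (κ × MI n))
    (u : Coord n ι → ℝ) : Prop :=
  ∃ I ⊆ E, ∃ J ⊆ G,
    LinearIndependent ℝ (fun (a : I) (c : Coord n ι) => evalFun u (pder c (T.eqn a.1))) ∧
    LinearIndependent ℝ
      (fun (g : J) (e : {e // e ∈ E ∧ e ∉ I}) => T.noetherCoeff g.1 e.1 u) ∧
    Submodule.span ℝ
      (Set.range fun (g : J) (e : {e // e ∈ E ∧ e ∉ I}) => T.noetherCoeff g.1 e.1 u) = ⊤ ∧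
    LinearIndependent ℝ
      (fun (r : P) (g : {g // g ∈ G ∧ g ∉ J}) => T.redCoeff r.1 g.1 u) ∧
    Submodule.span ℝ
      (Set.range fun (r : P) (g : {g // g ∈ G ∧ g ∉ J}) => T.redCoeff r.1 g.1 u) = ⊤

/-- The regularity conditions: the equations of motion, the Noether identities and the
reducibility relations are exhausted by finite levels `k = 0, 1, 2, …` (for instance, those that
live on the `k`-th jet space), and at every level the regularity conditions hold at each point of
the surface defined by the equations of motion of that level. -/
def Regular : Prop :=
  ∃ (E : ℕ → Finset (ι × MI n)) (G : ℕ → Finset (γ × MI n)) (P : ℕ → Finset (κ × MI n)),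
    Monotone E ∧ Monotone G ∧ Monotone P ∧
    (∀ e, ∃ k, e ∈ E k) ∧ (∀ g, ∃ k, g ∈ G k) ∧ (∀ r, ∃ k, r ∈ P k) ∧
    ∀ k, T.ClosedLevel (E k) (G k) (P k) ∧
      ∀ u : Coord n ι → ℝ, (∀ e ∈ E k, evalFun u (T.eqn e) = 0) → T.RegularAt (E k) (G k) (P k) u

end GaugeData

/-- A regular gauge theory, at most reducible of order one. -/
structure GaugeTheory (n : ℕ) (ι γ κ : Type*) extends GaugeData n ι γ κ where
  /-- the Noether identities, i.e. the gauge invariance of the Lagrangian up to a divergence -/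
  noether : ∀ α, ((R α).sum fun e r =>
    (-1 : ℝ) ^ e.2.order • iterD locD e.2 (eulerLagrange L e.1 * r)) = 0
  /-- `δ (δ C*_Δ) = 0`: the gauge transformations contracted with `Z_Δ` vanish up to the
  combination of the equations of motion with coefficients `M_Δ` -/
  reducibility : ∀ Δ, toGaugeData.delta (toGaugeData.deltaRed Δ) = 0
  regular : toGaugeData.Regular
  /-- the equations of motion are not contradictory: the surface that finitely many of them
  (derivatives included) define in jet space is not empty -/
  consistent : ∀ E : Finset (ι × MI n), ∃ u : Coord n ι → ℝ, ∀ e ∈ E,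
    evalFun u (toGaugeData.eqn e) = 0

namespace GaugeTheory

variable {n : ℕ} {ι γ κ : Type*} (T : GaugeTheory n ι γ κ)

/-- The `δ`-cycles modulo `d`: forms `a` of degree `(p, k)` with `δ a + d b = 0` for some `b` of
degree `(p - 1, k - 1)`. -/
def cycles (p k : ℤ) : Submodule ℝ (Form n ι γ κ) where
  carrier := {a | a ∈ forms n ι γ κ p k ∧
    ∃ b ∈ forms n ι γ κ (p - 1) (k - 1), T.delta a + extD b = 0}
  add_mem' := by
    rintro a a' ⟨ha, b, hb, h⟩ ⟨ha', b', hb', h'⟩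
    refine ⟨add_mem ha ha', b + b', add_mem hb hb', ?_⟩
    rw [map_add, map_add, add_add_add_comm, h, h', add_zero]
  zero_mem' := ⟨zero_mem _, 0, zero_mem _, by simp⟩
  smul_mem' := by
    rintro r a ⟨ha, b, hb, h⟩
    refine ⟨Submodule.smul_mem _ r ha, r • b, Submodule.smul_mem _ r hb, ?_⟩
    rw [map_smul, map_smul, ← smul_add, h, smul_zero]

/-- The `δ`-boundaries modulo `d`: forms `δ m + d c` with `m` of degree `(p, k + 1)` and `c` of
degree `(p - 1, k)`. -/
def boundaries (p k : ℤ) : Submodule ℝ (Form n ι γ κ) :=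
  (forms n ι γ κ p (k + 1)).map T.delta ⊔ (forms n ι γ κ (p - 1) k).map extD

/-- The group `H^p_k(δ|d)`. -/
abbrev H (p k : ℤ) : Type _ := T.cycles p k ⧸ (T.boundaries p k).submoduleOf (T.cycles p k)

/-- The class in `H^p_k(δ|d)` of a cycle. -/
def cls {p k : ℤ} (a : Form n ι γ κ) (ha : a ∈ T.cycles p k) : T.H p k :=
  Submodule.Quotient.mk ⟨a, ha⟩

end GaugeTheory

end LocalForms

end

/-!
Two complexes are exact: the Koszul-Tate complex in positive antighost number, and the complex of
`d` in form degree below `n`, apart from the constants. The theorem is the resulting descent. If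
`δ a + d b = 0`, then `d (δ b) = -δ (d b) = δ (δ a) = 0`, so that `δ b = -d c` and `b` is again a
cycle; exactness of `d` shows that `[b]` only depends on `[a]`, and exactness of `δ` that
`[a] ↦ [b]` is bijective. The one place where `d` fails to be exact is `p = 1`, `k = 2`: there `δ b`
could be a constant, but it vanishes at the common zeros of finitely many equations of motion, so
the constant is zero. Iterating the descent from `k > p` ends in form degree zero, where a cycle
modulo `d` is a cycle of `δ`, hence a boundary.

*Exactness of `d`* (`poincare_of_pos`, `poincare_zero`, `poincare_const`). On forms that involve
generators other than `dx`, the derivations `T^μ` lowering the order of derivatives,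
`∂_I Φ ↦ I_μ ∂_{I-μ} Φ`, give a homotopy `∑ T^μ ∂ᴿ/∂(dx^μ)`. Its anticommutator with `d` is
`∑ ∂_μ T^μ + (n - p) N`, where `N` counts these generators; as `T` acts nilpotently, the first term
is triangular with nonnegative eigenvalues (`raiseLower_sub_mem`). For forms in the fields and `dx`
alone, the vertical derivative, with the antifields `∂_I φ*_i` as vertical differentials, is covered
by the previous case and can be undone by integration over the fibres; what remains is the Poincaré
lemma in `x`.

*Exactness of `δ`* (`GaugeTheory.exists_eq_delta`). A form lives at some level `E`, `G`, `P` of the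
regularity conditions, and the equation `a = δ b` is linear over the local functions. It suffices to
solve it near every point of jet space, because the coefficients of solutions with a fixed finite
set of monomials form an affine space at each point and can be glued by a partition of unity
(`exists_eq_of_local`). At a point where an equation `e` does not vanish, `-a φ*_e` is a solution up
to an invertible factor. On the stationary surface, an odd vector field `s` that solves the
identities for the dependent antifields (with adjugates for inverses) makes `δ s + s δ` equal to the
counting of the antifields other than those of the independent equations, up to terms of higher
filtration, so that all of these can be eliminated (`exists_reduction`). The rest is the Koszul
complex of the independent equations, which are coordinates near the point; there it is exact
(`exists_koszul_eq`).
-/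

open scoped TensorProduct ContDiff

noncomputable section

namespace LocalForms

/-! ### The algebra of local forms -/

section FormAlgebra

variable {n : ℕ} {ι γ κ : Type*}

theorem tens_mul_tens (f f' : LocFun n ι) (b b' : GenAlg n ι γ κ) :
    tens f b * tens f' b' = tens (f * f') (b * b') :=
  Algebra.TensorProduct.tmul_mul_tmul f f' b b'

theorem genTens_mul_genTens (q q' : MvPolynomial (EvenGen n γ κ) ℝ) (w w' : OddAlg n ι γ κ) :
    genTens q w * genTens q' w' = genTens (q * q') (w * w') :=
  Algebra.TensorProduct.tmul_mul_tmul q q' w w'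

theorem tens_add_left (f f' : LocFun n ι) (b : GenAlg n ι γ κ) :
    tens (f + f') b = tens f b + tens f' b := TensorProduct.add_tmul _ _ _

theorem tens_add_right (f : LocFun n ι) (b b' : GenAlg n ι γ κ) :
    tens f (b + b') = tens f b + tens f b' := TensorProduct.tmul_add _ _ _

theorem tens_smul_right (r : ℝ) (f : LocFun n ι) (b : GenAlg n ι γ κ) :
    tens f (r • b) = tens (r • f) b := (TensorProduct.smul_tmul _ _ _).symm

theorem smul_tens (r : ℝ) (f : LocFun n ι) (b : GenAlg n ι γ κ) :
    r • tens f b = tens (r • f) b := rfl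

theorem tens_zero_right (f : LocFun n ι) : tens f (0 : GenAlg n ι γ κ) = 0 :=
  TensorProduct.tmul_zero _ _

theorem genTens_add_left (q q' : MvPolynomial (EvenGen n γ κ) ℝ) (w : OddAlg n ι γ κ) :
    genTens (q + q') w = genTens q w + genTens q' w := TensorProduct.add_tmul _ _ _

theorem genTens_add_right (q : MvPolynomial (EvenGen n γ κ) ℝ) (w w' : OddAlg n ι γ κ) :
    genTens q (w + w') = genTens q w + genTens q w' := TensorProduct.tmul_add _ _ _

theorem genTens_zero_right (q : MvPolynomial (EvenGen n γ κ) ℝ) :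
    genTens q (0 : OddAlg n ι γ κ) = 0 := TensorProduct.tmul_zero _ _

theorem genTens_smul_right (r : ℝ) (q : MvPolynomial (EvenGen n γ κ) ℝ) (w : OddAlg n ι γ κ) :
    genTens q (r • w) = r • genTens q w := TensorProduct.tmul_smul _ _ _

theorem genTens_smul_left (r : ℝ) (q : MvPolynomial (EvenGen n γ κ) ℝ) (w : OddAlg n ι γ κ) :
    genTens (r • q) w = r • genTens q w := (TensorProduct.smul_tmul' _ _ _).symm

theorem genTens_one_one : genTens (1 : MvPolynomial (EvenGen n γ κ) ℝ) (1 : OddAlg n ι γ κ) = 1 :=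
  rfl

/-- A generator as an element of the algebra without local functions. -/
def bareGen : Gen n ι γ κ → GenAlg n ι γ κ
  | Sum.inl o => genTens 1 (ExteriorAlgebra.ι ℝ (Finsupp.single o 1))
  | Sum.inr e => genTens (MvPolynomial.X e) 1

theorem gen_eq_tens (g : Gen n ι γ κ) : gen g = tens 1 (bareGen g) := by
  cases g <;> rfl

theorem tens_mul_gen (f : LocFun n ι) (b : GenAlg n ι γ κ) (g : Gen n ι γ κ) :
    tens f b * gen g = tens f (b * bareGen g) := by
  rw [gen_eq_tens, tens_mul_tens, mul_one]

/-- `ofFun` as an algebra homomorphism. -/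
def ofFunHom (n : ℕ) (ι γ κ : Type*) : LocFun n ι →ₐ[ℝ] Form n ι γ κ :=
  (Algebra.TensorProduct.includeLeft : LocFun n ι →ₐ[ℝ] LocFun n ι ⊗[ℝ] GenAlg n ι γ κ)

theorem ofFun_mul (f f' : LocFun n ι) :
    (ofFun (f * f') : Form n ι γ κ) = ofFun f * ofFun f' := map_mul (ofFunHom n ι γ κ) f f'

theorem ofFun_add (f f' : LocFun n ι) :
    (ofFun (f + f') : Form n ι γ κ) = ofFun f + ofFun f' := map_add (ofFunHom n ι γ κ) f f'

theorem ofFun_sub (f f' : LocFun n ι) :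
    (ofFun (f - f') : Form n ι γ κ) = ofFun f - ofFun f' := map_sub (ofFunHom n ι γ κ) f f'

theorem ofFun_neg (f : LocFun n ι) :
    (ofFun (-f) : Form n ι γ κ) = -ofFun f := map_neg (ofFunHom n ι γ κ) f

theorem ofFun_zero : (ofFun 0 : Form n ι γ κ) = 0 := map_zero (ofFunHom n ι γ κ)

theorem ofFun_one : (ofFun 1 : Form n ι γ κ) = 1 := map_one (ofFunHom n ι γ κ)

theorem ofFun_smul (r : ℝ) (f : LocFun n ι) :
    (ofFun (r • f) : Form n ι γ κ) = r • ofFun f := map_smul (ofFunHom n ι γ κ) r f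

theorem ofFun_sum {σ : Type*} (s : Finset σ) (f : σ → LocFun n ι) :
    (ofFun (∑ i ∈ s, f i) : Form n ι γ κ) = ∑ i ∈ s, ofFun (f i) :=
  map_sum (ofFunHom n ι γ κ) f s

theorem ofFun_mul_tens (f f' : LocFun n ι) (b : GenAlg n ι γ κ) :
    ofFun f * tens f' b = tens (f * f') b := by
  rw [ofFun, tens_mul_tens, one_mul]

/-- Local forms are obtained from local functions by sums and right multiplication by
generators. -/
theorem form_induction {C : Form n ι γ κ → Prop} (hfun : ∀ f, C (ofFun f))
    (hadd : ∀ a b, C a → C b → C (a + b)) (hmul : ∀ a g, C a → C (a * gen g))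
    (a : Form n ι γ κ) : C a := by
  have h0 : C 0 := ofFun_zero (γ := γ) (κ := κ) ▸ hfun 0
  have h1 : ∀ (q : MvPolynomial (EvenGen n γ κ) ℝ) (f : LocFun n ι), C (tens f (genTens q 1)) := by
    intro q
    induction q using MvPolynomial.induction_on with
    | C r =>
      intro f
      rw [← mul_one (MvPolynomial.C r), ← MvPolynomial.smul_eq_C_mul, genTens_smul_left,
        genTens_one_one, tens_smul_right]
      exact hfun _
    | add p q hp hq =>
      intro f
      rw [genTens_add_left, tens_add_right]
      exact hadd _ _ (hp f) (hq f)
    | mul_X p e hp =>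
      intro f
      have := hmul _ (Sum.inr e) (hp f)
      rwa [tens_mul_gen, bareGen, genTens_mul_genTens, mul_one] at this
  have h2 : ∀ (w : OddAlg n ι γ κ) (q : MvPolynomial (EvenGen n γ κ) ℝ) (f : LocFun n ι),
      C (tens f (genTens q w)) := by
    intro w
    induction w using CliffordAlgebra.right_induction with
    | algebraMap r =>
      intro q f
      rw [Algebra.algebraMap_eq_smul_one, genTens_smul_right, tens_smul_right]
      exact h1 _ _
    | add x y hx hy =>
      intro q f
      rw [genTens_add_right, tens_add_right]
      exact hadd _ _ (hx q f) (hy q f)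
    | mul_ι m x hx =>
      intro q
      induction m using Finsupp.induction_linear with
      | zero =>
        intro f
        rw [map_zero, mul_zero, genTens_zero_right, tens_zero_right]
        exact h0
      | add u v hu hv =>
        intro f
        rw [map_add, mul_add, genTens_add_right, tens_add_right]
        exact hadd _ _ (hu f) (hv f)
      | single o r =>
        intro f
        have := hmul _ (Sum.inl o) (hx q (r • f))
        rw [tens_mul_gen, bareGen, genTens_mul_genTens, mul_one, ← tens_smul_right,
          ← genTens_smul_right, ← mul_smul_comm, ExteriorAlgebra.ι, ← map_smul,
          Finsupp.smul_single, smul_eq_mul, mul_one] at this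
        exact this
  have h3 : ∀ (b : GenAlg n ι γ κ) (f : LocFun n ι), C (tens f b) := by
    intro b
    induction b using TensorProduct.induction_on with
    | zero => intro f; exact (tens_zero_right f).symm ▸ h0
    | add x y hx hy =>
      intro f
      exact (tens_add_right f x y) ▸ hadd _ _ (hx f) (hy f)
    | tmul q w => intro f; exact h2 w q f
  induction a using TensorProduct.induction_on with
  | zero => exact h0
  | add x y hx hy => exact hadd _ _ hx hy
  | tmul f b => exact h3 b f

theorem tens_induction {C : Form n ι γ κ → Prop} (h0 : C 0) (ht : ∀ f b, C (tens f b))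
    (hadd : ∀ a b, C a → C b → C (a + b)) (a : Form n ι γ κ) : C a := by
  induction a using TensorProduct.induction_on with
  | zero => exact h0
  | add x y hx hy => exact hadd _ _ hx hy
  | tmul f b => exact ht f b

/-- Two linear maps on local forms agree if they agree on products of functions and elements of the
generator algebra. -/
theorem form_hom_ext {A : Type*} [AddCommGroup A] [Module ℝ A] {S T : Form n ι γ κ →ₗ[ℝ] A}
    (h : ∀ f b, S (tens f b) = T (tens f b)) (a : Form n ι γ κ) : S a = T a := by
  induction a using tens_induction with
  | h0 => rw [map_zero, map_zero]
  | ht f b => exact h f b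
  | hadd a b ha hb => rw [map_add, map_add, ha, hb]

theorem ofFun_mul_comm (f : LocFun n ι) (a : Form n ι γ κ) : ofFun f * a = a * ofFun f := by
  induction a using tens_induction with
  | h0 => rw [mul_zero, zero_mul]
  | ht f' b => rw [ofFun, tens_mul_tens, tens_mul_tens, mul_one, one_mul, mul_comm]
  | hadd a b ha hb => rw [mul_add, add_mul, ha, hb]

/-! ### Signs, right derivatives and operators on the coefficients -/

/-- The sign `-1` of an odd generator and `1` of an even one. -/
def psign : Gen n ι γ κ → ℝ
  | Sum.inl _ => -1
  | Sum.inr _ => 1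

/-- The sign picked up when two generators are exchanged. -/
def gsign : Gen n ι γ κ → Gen n ι γ κ → ℝ
  | Sum.inl _, Sum.inl _ => -1
  | _, _ => 1

/-- The parity involution of the algebra of generators. -/
def genPar : GenAlg n ι γ κ →ₐ[ℝ] GenAlg n ι γ κ :=
  (Algebra.TensorProduct.map (AlgHom.id ℝ (MvPolynomial (EvenGen n γ κ) ℝ))
    (CliffordAlgebra.involute (Q := (0 : QuadraticForm ℝ (OddGen n ι γ κ →₀ ℝ)))) :
    MvPolynomial (EvenGen n γ κ) ℝ ⊗[ℝ] OddAlg n ι γ κ →ₐ[ℝ]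
      MvPolynomial (EvenGen n γ κ) ℝ ⊗[ℝ] OddAlg n ι γ κ)

theorem genPar_genTens (q : MvPolynomial (EvenGen n γ κ) ℝ) (w : OddAlg n ι γ κ) :
    genPar (genTens q w) = genTens q (CliffordAlgebra.involute w) :=
  Algebra.TensorProduct.map_tmul _ _ _ _

/-- The parity involution of local forms: the algebra automorphism that changes the sign of the odd
generators. -/
def par : Form n ι γ κ →ₐ[ℝ] Form n ι γ κ :=
  (Algebra.TensorProduct.map (AlgHom.id ℝ (LocFun n ι)) genPar :
    LocFun n ι ⊗[ℝ] GenAlg n ι γ κ →ₐ[ℝ] LocFun n ι ⊗[ℝ] GenAlg n ι γ κ)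

theorem par_tens (f : LocFun n ι) (b : GenAlg n ι γ κ) : par (tens f b) = tens f (genPar b) :=
  Algebra.TensorProduct.map_tmul _ _ _ _

theorem par_ofFun (f : LocFun n ι) : par (ofFun f : Form n ι γ κ) = ofFun f := by
  rw [ofFun, par_tens, map_one]

theorem par_gen (g : Gen n ι γ κ) : par (gen g) = psign g • gen g := by
  rw [gen_eq_tens, par_tens, smul_tens, ← tens_smul_right]
  congr 1
  rcases g with o | e
  · rw [bareGen, genPar_genTens, ExteriorAlgebra.ι, CliffordAlgebra.involute_ι, ← neg_one_smul ℝ]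
    exact genTens_smul_right _ _ _
  · rw [bareGen, genPar_genTens, map_one, psign, one_smul]

theorem par_par (a : Form n ι γ κ) : par (par a) = a := by
  induction a using form_induction with
  | hfun f => rw [par_ofFun, par_ofFun]
  | hadd a b ha hb => rw [map_add, map_add, ha, hb]
  | hmul a g ha =>
    rw [map_mul, map_mul, ha, par_gen, map_smul, par_gen, smul_smul]
    rcases g with o | e <;> simp [psign]

theorem gen_mul_gen (g g' : Gen n ι γ κ) : gen g * gen g' = gsign g g' • (gen g' * gen g) := by
  rw [gen_eq_tens, gen_eq_tens, tens_mul_tens, tens_mul_tens, smul_tens, ← tens_smul_right]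
  congr 1
  rcases g with o | e <;> rcases g' with o' | e' <;>
    simp only [bareGen, genTens_mul_genTens, gsign, one_smul, one_mul, mul_one]
  · rw [← genTens_smul_right, neg_one_smul]
    congr 1
    rw [eq_neg_iff_add_eq_zero]
    exact ExteriorAlgebra.ι_add_mul_swap _ _
  · rw [mul_comm]

theorem inr_mul (e : EvenGen n γ κ) (a : Form n ι γ κ) :
    gen (Sum.inr e) * a = a * gen (Sum.inr e) := by
  induction a using form_induction with
  | hfun f => rw [ofFun_mul_comm]
  | hadd a b ha hb => rw [mul_add, add_mul, ha, hb]
  | hmul a g ha => rw [← mul_assoc, ha, mul_assoc, gen_mul_gen, mul_assoc, gsign, one_smul]; simp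

theorem inl_mul (o : OddGen n ι γ κ) (a : Form n ι γ κ) :
    gen (Sum.inl o) * a = par a * gen (Sum.inl o) := by
  induction a using form_induction with
  | hfun f => rw [par_ofFun, ofFun_mul_comm]
  | hadd a b ha hb => rw [mul_add, map_add, add_mul, ha, hb]
  | hmul a g ha =>
    rw [← mul_assoc, ha, mul_assoc, gen_mul_gen, map_mul, par_gen, mul_assoc]
    rcases g with o | e <;> simp [psign, gsign]

theorem rder_tens (g : Gen n ι γ κ) (f : LocFun n ι) (b : GenAlg n ι γ κ) :
    rder g (tens f b) = tens f (genRder g b) := LinearMap.lTensor_tmul _ _ _ _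

theorem oddRder_mul_ι (o o' : OddGen n ι γ κ) (w : OddAlg n ι γ κ) :
    oddRder o (w * ExteriorAlgebra.ι ℝ (Finsupp.single o' 1)) =
      (Finsupp.single o' (1 : ℝ) o) • w - oddRder o w * ExteriorAlgebra.ι ℝ (Finsupp.single o' 1) :=
  CliffordAlgebra.contractRight_mul_ι (Q := (0 : QuadraticForm ℝ (OddGen n ι γ κ →₀ ℝ)))
    (d := Finsupp.lapply o) _ _

open Classical in
theorem genRder_mul_bareGen (g g' : Gen n ι γ κ) (b : GenAlg n ι γ κ) :
    genRder g (b * bareGen g') =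
      (if g = g' then b else 0) + gsign g g' • (genRder g b * bareGen g') := by
  induction b using TensorProduct.induction_on with
  | zero =>
    change genRder g ((0 : GenAlg n ι γ κ) * _) = ite _ (0 : GenAlg n ι γ κ) 0 +
      gsign g g' • (genRder g (0 : GenAlg n ι γ κ) * _)
    simp
  | add x y hx hy =>
    change GenAlg n ι γ κ at x y
    change genRder g ((x + y) * _) = ite _ (x + y) 0 + gsign g g' • (genRder g (x + y) * _)
    rw [add_mul, map_add, hx, hy, map_add, add_mul, smul_add]
    split_ifs <;> abel
  | tmul q w =>
    change genRder g (genTens q w * _) = ite _ (genTens q w) 0 +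
      gsign g g' • (genRder g (genTens q w) * _)
    have hl : ∀ (o : OddGen n ι γ κ) q w, genRder (Sum.inl o) (genTens q w) =
        (genTens q (oddRder o w) : GenAlg n ι γ κ) := fun o q w => LinearMap.lTensor_tmul _ _ _ _
    have hr : ∀ (e : EvenGen n γ κ) q w, genRder (Sum.inr e) (genTens q w) =
        (genTens (MvPolynomial.pderiv e q) w : GenAlg n ι γ κ) :=
      fun o q w => LinearMap.rTensor_tmul _ _ _ _
    rcases g with o | e <;> rcases g' with o' | e' <;>
      simp only [bareGen, genTens_mul_genTens, hl, hr, gsign, one_smul, mul_one,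
        reduceCtorEq, if_false, zero_add, Sum.inl.injEq, Sum.inr.injEq]
    · rw [oddRder_mul_ι, sub_eq_add_neg, genTens_add_right, ← neg_one_smul ℝ, genTens_smul_right,
        genTens_smul_right, Finsupp.single_apply]
      by_cases h : o = o'
      · simp [h]
      · simp [h, Ne.symm h]
    · rw [Derivation.leibniz, MvPolynomial.pderiv_X, genTens_add_left, smul_eq_mul, smul_eq_mul]
      by_cases h : e = e'
      · subst h; simp [mul_comm]
      · have : genTens 0 w = (0 : GenAlg n ι γ κ) := TensorProduct.zero_tmul _ _
        simp [h, this, mul_comm, Ne.symm h]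

open Classical in
theorem rder_mul_gen (g g' : Gen n ι γ κ) (a : Form n ι γ κ) :
    rder g (a * gen g') = (if g = g' then a else 0) + gsign g g' • (rder g a * gen g') := by
  induction a using tens_induction with
  | h0 => simp
  | ht f b =>
    rw [tens_mul_gen, rder_tens, rder_tens, genRder_mul_bareGen, tens_add_right, tens_mul_gen,
      smul_tens, tens_smul_right]
    split_ifs
    · rfl
    · rw [tens_zero_right]
  | hadd a b ha hb =>
    rw [add_mul, map_add, ha, hb, map_add, add_mul, smul_add]
    split_ifs <;> abel

theorem rder_ofFun_mul (g : Gen n ι γ κ) (f : LocFun n ι) (a : Form n ι γ κ) :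
    rder g (ofFun f * a) = ofFun f * rder g a := by
  induction a using tens_induction with
  | h0 => simp
  | ht f b => rw [ofFun_mul_tens, rder_tens, rder_tens, ofFun_mul_tens]
  | hadd a b ha hb => rw [mul_add, map_add, map_add, ha, hb, mul_add]

theorem rder_ofFun (g : Gen n ι γ κ) (f : LocFun n ι) : rder g (ofFun f : Form n ι γ κ) = 0 := by
  rw [ofFun, rder_tens]
  suffices h : genRder g (1 : GenAlg n ι γ κ) = 0 by rw [h, tens_zero_right]
  rw [← genTens_one_one]
  rcases g with o | e
  · refine (LinearMap.lTensor_tmul _ _ _ _).trans ?_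
    rw [oddRder, LinearMap.flip_apply, CliffordAlgebra.contractRight_one]
    exact genTens_zero_right _
  · refine (LinearMap.rTensor_tmul _ _ _ _).trans ?_
    rw [show (MvPolynomial.pderiv e).toLinearMap (1 : MvPolynomial (EvenGen n γ κ) ℝ) = 0 from
      Derivation.map_one_eq_zero _]
    exact TensorProduct.zero_tmul _ _

/-- An operator on local functions acting on the coefficients of local forms. -/
def coeffOp (q : Module.End ℝ (LocFun n ι)) : Module.End ℝ (Form n ι γ κ) :=
  LinearMap.rTensor (GenAlg n ι γ κ) q

theorem coeffOp_tens (q : Module.End ℝ (LocFun n ι)) (f : LocFun n ι) (b : GenAlg n ι γ κ) :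
    coeffOp q (tens f b) = tens (q f) b := LinearMap.rTensor_tmul _ _ _ _

theorem coeffOp_ofFun (q : Module.End ℝ (LocFun n ι)) (f : LocFun n ι) :
    coeffOp q (ofFun f : Form n ι γ κ) = ofFun (q f) := coeffOp_tens q f 1

theorem coeffOp_mul_gen (q : Module.End ℝ (LocFun n ι)) (a : Form n ι γ κ) (g : Gen n ι γ κ) :
    coeffOp q (a * gen g) = coeffOp q a * gen g := by
  induction a using tens_induction with
  | h0 => simp
  | ht f b => rw [tens_mul_gen, coeffOp_tens, coeffOp_tens, tens_mul_gen]
  | hadd a b ha hb => rw [add_mul, map_add, map_add, ha, hb, add_mul]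

theorem coeffOp_rder (q : Module.End ℝ (LocFun n ι)) (g : Gen n ι γ κ) (a : Form n ι γ κ) :
    coeffOp q (rder g a) = rder g (coeffOp q a) :=
  form_hom_ext (S := coeffOp q ∘ₗ rder g) (T := rder g ∘ₗ coeffOp q) (fun f b => by
    simp only [LinearMap.comp_apply, rder_tens, coeffOp_tens]) a

theorem coeffOp_par (q : Module.End ℝ (LocFun n ι)) (a : Form n ι γ κ) :
    coeffOp q (par a) = par (coeffOp q a) := by
  induction a using form_induction with
  | hfun f => rw [par_ofFun, coeffOp_ofFun, par_ofFun]
  | hadd a b ha hb => simp only [map_add, ha, hb]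
  | hmul a g ha => rw [map_mul, par_gen, mul_smul_comm, map_smul, coeffOp_mul_gen, coeffOp_mul_gen,
      map_mul, par_gen, mul_smul_comm, ha]

theorem coeffD_eq (μ : Fin n) : (coeffD μ : Module.End ℝ (Form n ι γ κ)) = coeffOp (locD μ) := rfl

/-- Right derivatives along odd generators anticommute, the others commute. -/
theorem rder_rder (g g' : Gen n ι γ κ) (a : Form n ι γ κ) :
    rder g (rder g' a) = gsign g g' • rder g' (rder g a) := by
  classical
  induction a using form_induction with
  | hfun f => simp only [rder_ofFun, map_zero, smul_zero]
  | hadd a b ha hb => simp only [map_add, ha, hb, smul_add]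
  | hmul a k ha =>
    have hs : ∀ g g' : Gen n ι γ κ, gsign g g' = gsign g' g := by
      rintro (g | g) (g' | g') <;> rfl
    have hss : ∀ g g' : Gen n ι γ κ, gsign g g' * gsign g g' = 1 := by
      rintro (g | g) (g' | g') <;> simp [gsign]
    have key : ∀ g g' : Gen n ι γ κ, rder g (rder g' (a * gen k)) =
        (if g' = k then rder g a else 0) + ((if g = k then gsign g' k • rder g' a else 0) +
          (gsign g' k * gsign g k) • (rder g (rder g' a) * gen k)) := by
      intro g g'
      rw [rder_mul_gen, map_add, map_smul, rder_mul_gen, smul_add, smul_smul, smul_ite, smul_zero]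
      congr 1
      split_ifs <;> simp
    rw [key, key, ha]
    rcases eq_or_ne g k with rfl | h
    · rcases eq_or_ne g' g with rfl | h'
      · simp only [if_true, smul_add, smul_smul, smul_mul_assoc, hss, one_smul]
        rcases g' with o | e <;> simp [gsign]
      · simp only [if_true, if_neg h', smul_add, smul_smul, smul_mul_assoc, zero_add,
          hs g' g]
        congr 2
        ring
    · rcases eq_or_ne g' k with rfl | h'
      · simp only [if_true, if_neg h, smul_add, smul_smul, smul_mul_assoc, zero_add,
          hss, one_smul]
        congr 2
        ring
      · simp only [if_neg h, if_neg h', smul_smul, smul_mul_assoc, zero_add]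
        congr 1
        ring

/-- The constant term of polynomials in the generators. -/
def genConst : GenAlg n ι γ κ →ₐ[ℝ] ℝ :=
  (Algebra.TensorProduct.lift (MvPolynomial.aeval fun _ => (0 : ℝ))
    (ExteriorAlgebra.algebraMapInv (R := ℝ) (M := OddGen n ι γ κ →₀ ℝ))
    (fun _ _ => Commute.all _ _) : MvPolynomial (EvenGen n γ κ) ℝ ⊗[ℝ] OddAlg n ι γ κ →ₐ[ℝ] ℝ)

theorem evalAt_tens (u : Coord n ι → ℝ) (f : LocFun n ι) (b : GenAlg n ι γ κ) :
    evalAt u (tens f b) = evalFun u f * genConst b :=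
  Algebra.TensorProduct.lift_tmul _ _ _ _ _

theorem evalAt_ofFun (u : Coord n ι → ℝ) (f : LocFun n ι) :
    evalAt u (ofFun f : Form n ι γ κ) = evalFun u f := by
  rw [ofFun, evalAt_tens, map_one, mul_one]

theorem evalAt_gen (u : Coord n ι → ℝ) (g : Gen n ι γ κ) : evalAt u (gen g) = 0 := by
  rw [gen_eq_tens, evalAt_tens, map_one, one_mul]
  rcases g with o | e
  · refine (Algebra.TensorProduct.lift_tmul _ _ _ _ _).trans ?_
    rw [map_one, one_mul, ExteriorAlgebra.algebraMapInv, ExteriorAlgebra.lift_ι_apply]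
    rfl
  · refine (Algebra.TensorProduct.lift_tmul _ _ _ _ _).trans ?_
    rw [MvPolynomial.aeval_X, zero_mul]

end FormAlgebra

/-! ### Calculus of local functions -/

section Calculus

variable {n : ℕ} {ι : Type*}

theorem locFun_ext {f g : LocFun n ι} (h : ∀ u, evalFun u f = evalFun u g) : f = g :=
  Subtype.ext (funext h)

/-- A local function that depends smoothly on the coordinates in `S` only. -/
def DependsOn (f : LocFun n ι) (S : Finset (Coord n ι)) : Prop :=
  ∃ g : (S → ℝ) → ℝ, ContDiff ℝ ∞ g ∧ ∀ u, evalFun u f = g (fun s => u s)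

theorem exists_dependsOn (f : LocFun n ι) : ∃ S, DependsOn f S := f.2

theorem DependsOn.mono {f : LocFun n ι} {S T : Finset (Coord n ι)} (h : DependsOn f S)
    (hST : S ⊆ T) : DependsOn f T := by
  obtain ⟨g, hg, hf⟩ := h
  exact ⟨fun v => g fun s => v ⟨s.1, hST s.2⟩, hg.comp (by fun_prop), hf⟩

theorem exists_dependsOn_family {σ : Type*} (A : Finset σ) (f : σ → LocFun n ι) :
    ∃ S, ∀ a ∈ A, DependsOn (f a) S := by
  classical
  choose S hS using fun a => exists_dependsOn (f a)
  exact ⟨A.biUnion S, fun a ha => (hS a).mono (Finset.subset_biUnion_of_mem S ha)⟩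

/-- The local function given by a smooth function of finitely many coordinates. -/
def ofSmooth (S : Finset (Coord n ι)) (g : (S → ℝ) → ℝ) (hg : ContDiff ℝ ∞ g) : LocFun n ι :=
  ⟨fun u => g fun s => u s, S, g, hg, fun _ => rfl⟩

theorem evalFun_ofSmooth (S : Finset (Coord n ι)) (g : (S → ℝ) → ℝ) (hg : ContDiff ℝ ∞ g)
    (u : Coord n ι → ℝ) : evalFun u (ofSmooth S g hg) = g fun s => u s := rfl

theorem evalFun_coord (u : Coord n ι → ℝ) (c : Coord n ι) : evalFun u (coord c) = u c := rfl

open Classical in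
theorem evalFun_pder (f : LocFun n ι) {S : Finset (Coord n ι)} {g : (S → ℝ) → ℝ}
    (hg : ContDiff ℝ ∞ g) (hf : ∀ u, evalFun u f = g fun s => u s) (c : Coord n ι)
    (u : Coord n ι → ℝ) :
    evalFun u (pder c f) = fderiv ℝ g (fun s => u s) (fun s => if s.1 = c then 1 else 0) :=
  by
  let := Classical.decEq (Coord n ι)
  refine (hasDerivAt_update hg hf c u).deriv.trans ?_
  congr! 3

theorem fderiv_eq_sum (f : LocFun n ι) {S : Finset (Coord n ι)} {g : (S → ℝ) → ℝ}
    (hg : ContDiff ℝ ∞ g) (hf : ∀ u, evalFun u f = g fun s => u s)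
    (u : Coord n ι → ℝ) (w : S → ℝ) :
    fderiv ℝ g (fun s => u s) w = ∑ s : S, w s * evalFun u (pder s.1 f) := by
  classical
  have hw : w = ∑ s : S, w s • fun s' : S => if s'.1 = s.1 then (1 : ℝ) else 0 := by
    funext s'
    simp [Finset.sum_apply, Subtype.ext_iff.symm]
  conv_lhs => rw [hw]
  simp only [map_sum, map_smul, evalFun_pder f hg hf, smul_eq_mul]

theorem pder_eq_zero_of_dependsOn {f : LocFun n ι} {S : Finset (Coord n ι)} (h : DependsOn f S)
    {c : Coord n ι} (hc : c ∉ S) : pder c f = 0 := by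
  classical
  obtain ⟨g, hg, hf⟩ := h
  refine locFun_ext fun u => ?_
  rw [evalFun_pder f hg hf, map_zero]
  have h0 : (fun s : S => if s.1 = c then (1 : ℝ) else 0) = 0 := by
    funext s
    have : s.1 ≠ c := fun h => hc (h ▸ s.2)
    simp [this]
  rw [h0, map_zero]

/-- The chain rule along a curve in jet space. -/
theorem hasDerivAt_curve {f : LocFun n ι} {S : Finset (Coord n ι)} (hS : DependsOn f S)
    {p : ℝ → Coord n ι → ℝ} {p' : Coord n ι → ℝ} {t : ℝ}
    (hp : ∀ c, HasDerivAt (fun t => p t c) (p' c) t) :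
    HasDerivAt (fun t => evalFun (p t) f) (∑ c ∈ S, p' c * evalFun (p t) (pder c f)) t := by
  obtain ⟨g, hg, hf⟩ := hS
  have h1 : HasDerivAt (fun t => fun s : S => p t s) (fun s : S => p' s) t :=
    hasDerivAt_pi.2 fun s => hp s
  have h2 := ((hg.differentiable (by simp)) (fun s : S => p t s)).hasFDerivAt.comp_hasDerivAt t h1
  rw [fderiv_eq_sum f hg hf, Finset.sum_coe_sort S (fun c => p' c * evalFun (p t) (pder c f))] at h2
  simpa only [hf, Function.comp_def] using h2

theorem hasDerivAt_evalFun_update [DecidableEq (Coord n ι)] (f : LocFun n ι) (c : Coord n ι)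
    (u : Coord n ι → ℝ) :
    HasDerivAt (fun t => evalFun (Function.update u c t) f) (evalFun u (pder c f)) (u c) := by
  obtain ⟨S, g, hg, hf⟩ := f.2
  have h := hasDerivAt_update hg hf c u
  rw [show evalFun u (pder c f) = _ by
    rw [evalFun_pder f hg hf]]
  refine HasDerivAt.congr_deriv h ?_
  congr! 3

theorem evalFun_pder_of_hasDerivAt [DecidableEq (Coord n ι)] {f : LocFun n ι} {c : Coord n ι}
    {u : Coord n ι → ℝ} {r : ℝ}
    (h : HasDerivAt (fun t => evalFun (Function.update u c t) f) r (u c)) :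
    evalFun u (pder c f) = r :=
  (hasDerivAt_evalFun_update f c u).unique h

theorem pder_mul (c : Coord n ι) (f g : LocFun n ι) :
    pder c (f * g) = pder c f * g + f * pder c g := by
  classical
  refine locFun_ext fun u => evalFun_pder_of_hasDerivAt ?_
  have := (hasDerivAt_evalFun_update f c u).mul (hasDerivAt_evalFun_update g c u)
  simp only [Function.update_eq_self] at this
  rw [map_add, map_mul, map_mul]
  exact this.congr_of_eventuallyEq (Filter.Eventually.of_forall fun t => map_mul _ f g)

theorem pder_one (c : Coord n ι) : pder c (1 : LocFun n ι) = 0 := by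
  have h := pder_mul c (1 : LocFun n ι) 1
  simpa using h

open Classical in
theorem pder_coord (c c' : Coord n ι) : pder c (coord c') = if c = c' then 1 else 0 := by
  refine locFun_ext fun u => evalFun_pder_of_hasDerivAt ?_
  simp only [evalFun_coord]
  by_cases h : c = c'
  · subst h
    simpa using hasDerivAt_id' (u c)
  · simpa [h, Function.update_of_ne (Ne.symm h)] using hasDerivAt_const (u c) (u c')

theorem pder_comm (c c' : Coord n ι) (f : LocFun n ι) :
    pder c (pder c' f) = pder c' (pder c f) := by
  classical
  obtain ⟨S, g, hg, hf⟩ := exists_dependsOn f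
  have hg' : ∀ w, ContDiff ℝ ∞ fun v => fderiv ℝ g v w := fun w =>
    (hg.fderiv_right (by simp)).clm_apply contDiff_const
  refine locFun_ext fun u => ?_
  rw [evalFun_pder (pder c' f) (hg' _) (evalFun_pder f hg hf c'),
    evalFun_pder (pder c f) (hg' _) (evalFun_pder f hg hf c)]
  have hd : DifferentiableAt ℝ (fderiv ℝ g) (fun s : S => u s) :=
    (hg.fderiv_right (m := 1) (by norm_cast)).differentiable (by simp) _
  have hsymm := hg.contDiffAt (x := fun s : S => u s) |>.isSymmSndFDerivAt (by simp; norm_cast)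
  rw [fderiv_clm_apply hd (differentiableAt_const _),
    fderiv_clm_apply hd (differentiableAt_const _)]
  simpa using hsymm _ _

theorem locD_apply (μ : Fin n) (f : LocFun n ι) :
    locD μ f = ∑ᶠ c, pder c f * coordShift μ c := rfl

theorem locD_eq_sum (μ : Fin n) {f : LocFun n ι} {S : Finset (Coord n ι)}
    (hS : ∀ c, c ∉ S → pder c f = 0) : locD μ f = ∑ c ∈ S, pder c f * coordShift μ c := by
  rw [locD_apply]
  refine finsum_eq_sum_of_support_subset _ fun c hc => ?_
  by_contra h
  exact hc (by simp only [hS c h, zero_mul])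

theorem exists_pder_support (f : LocFun n ι) :
    ∃ S : Finset (Coord n ι), ∀ c, c ∉ S → pder c f = 0 :=
  let ⟨S, hS⟩ := exists_dependsOn f
  ⟨S, fun _ hc => pder_eq_zero_of_dependsOn hS hc⟩

theorem locD_mul (μ : Fin n) (f g : LocFun n ι) :
    locD μ (f * g) = locD μ f * g + f * locD μ g := by
  classical
  obtain ⟨S, hS⟩ := exists_pder_support f
  obtain ⟨T, hT⟩ := exists_pder_support g
  have h1 : ∀ c, c ∉ S ∪ T → pder c f = 0 := fun c hc => hS c fun h => hc (by simp [h])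
  have h2 : ∀ c, c ∉ S ∪ T → pder c g = 0 := fun c hc => hT c fun h => hc (by simp [h])
  rw [locD_eq_sum μ h1, locD_eq_sum μ h2, locD_eq_sum (S := S ∪ T) μ (fun c hc => by
    rw [pder_mul, h1 c hc, h2 c hc]; simp), Finset.sum_mul, Finset.mul_sum,
    ← Finset.sum_add_distrib]
  refine Finset.sum_congr rfl fun c _ => ?_
  rw [pder_mul]
  ring

theorem locD_one (μ : Fin n) : locD μ (1 : LocFun n ι) = 0 := by
  have h := locD_mul μ (1 : LocFun n ι) 1
  simpa using h

theorem locD_coord (μ : Fin n) (c : Coord n ι) : locD μ (coord c) = coordShift μ c := by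
  classical
  rw [locD_eq_sum (S := {c}) μ (fun c' hc => by
    rw [pder_coord, if_neg (by simpa using hc)])]
  simp [pder_coord]

theorem MI.succ_comm (I : MI n) (μ ν : Fin n) : (I.succ μ).succ ν = (I.succ ν).succ μ := by
  simp only [MI.succ]
  abel

theorem locD_coordShift (μ ν : Fin n) (c : Coord n ι) :
    locD ν (coordShift μ c) = locD μ (coordShift ν c) := by
  rcases c with ρ | ⟨i, I⟩
  · simp only [coordShift]
    split_ifs <;> simp [locD_one]
  · simp only [coordShift, locD_coord]
    rw [MI.succ_comm]

theorem locD_sum_mul {σ : Type*} (μ : Fin n) (S : Finset σ) (f g : σ → LocFun n ι) :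
    locD μ (∑ c ∈ S, f c * g c) = ∑ c ∈ S, (locD μ (f c) * g c + f c * locD μ (g c)) := by
  rw [map_sum]
  exact Finset.sum_congr rfl fun c _ => locD_mul _ _ _

theorem locD_comm (μ ν : Fin n) (f : LocFun n ι) : locD μ (locD ν f) = locD ν (locD μ f) := by
  obtain ⟨S, hS⟩ := exists_pder_support f
  have key : ∀ μ ν : Fin n, locD μ (locD ν f) =
      ∑ c ∈ S, ∑ c' ∈ S, pder c' (pder c f) * coordShift μ c' * coordShift ν c +
        ∑ c ∈ S, pder c f * locD μ (coordShift ν c) := by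
    intro μ ν
    rw [locD_eq_sum ν hS, locD_sum_mul, Finset.sum_add_distrib]
    congr 1
    refine Finset.sum_congr rfl fun c _ => ?_
    rw [locD_eq_sum (S := S) μ (fun c' hc' => by rw [pder_comm, hS c' hc', map_zero]),
      Finset.sum_mul]
  rw [key, key]
  congr 1
  · rw [Finset.sum_comm]
    refine Finset.sum_congr rfl fun c _ => Finset.sum_congr rfl fun c' _ => ?_
    rw [pder_comm]
    ring
  · exact Finset.sum_congr rfl fun c _ => by rw [locD_coordShift]

theorem iterD_zero {A : Type*} [AddCommGroup A] [Module ℝ A] (D : Fin n → Module.End ℝ A) :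
    iterD D 0 = 1 := by
  simp [iterD]

theorem iterD_succ {A : Type*} [AddCommGroup A] [Module ℝ A] (D : Fin n → Module.End ℝ A)
    (hD : ∀ μ ν, Commute (D μ) (D ν)) (I : MI n) (μ : Fin n) :
    iterD D (I.succ μ) = D μ * iterD D I := by
  have key : ∀ l : List (Fin n), l.Nodup →
      (l.map fun ν => D ν ^ (I.succ μ) ν).prod =
        (if μ ∈ l then D μ else 1) * (l.map fun ν => D ν ^ I ν).prod := by
    intro l
    induction l with
    | nil => simp
    | cons ν l ih =>
      intro hl
      rw [List.nodup_cons] at hl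
      rw [List.map_cons, List.prod_cons, ih hl.2, List.map_cons, List.prod_cons]
      rcases eq_or_ne μ ν with rfl | h
      · rw [if_neg hl.1, if_pos (by simp), one_mul, ← mul_assoc, ← pow_succ']
        simp [MI.succ]
      · have h1 : I.succ μ ν = I ν := by simp [MI.succ, Ne.symm h]
        have h2 : Commute (D ν ^ I ν) (if μ ∈ l then D μ else 1) := by
          split_ifs
          · exact (hD ν μ).pow_left _
          · exact Commute.one_right _
        rw [h1, ← mul_assoc, h2.eq, mul_assoc]
        simp [h]
  have := key (List.finRange n) (List.nodup_finRange n)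
  simpa [iterD] using this

theorem iterD_locD_succ (I : MI n) (μ : Fin n) (f : LocFun n ι) :
    iterD locD (I.succ μ) f = locD μ (iterD locD I f) := by
  rw [iterD_succ _ (fun μ ν => LinearMap.ext fun f => locD_comm μ ν f)]
  rfl

/-! ### Pullbacks and scaling integrals -/

/-- The pullback of local functions along the map of jet space with components `Ψ`. -/
def pullback (Ψ : Coord n ι → LocFun n ι) : LocFun n ι →ₐ[ℝ] LocFun n ι where
  toFun f := ⟨fun u => evalFun (fun c => evalFun u (Ψ c)) f, by
    obtain ⟨S, g, hg, hf⟩ := f.2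
    obtain ⟨T, hT⟩ := exists_dependsOn_family S Ψ
    choose! k hk hk' using hT
    refine ⟨T, fun v => g fun s => k s v, hg.comp (contDiff_pi.2 fun s => hk s s.2), fun u => ?_⟩
    exact (hf _).trans (congrArg g (funext fun s => hk' s s.2 u))⟩
  map_one' := locFun_ext fun u => map_one (evalFun fun c => evalFun u (Ψ c))
  map_zero' := locFun_ext fun u => map_zero (evalFun fun c => evalFun u (Ψ c))
  map_mul' f g := locFun_ext fun u => map_mul (evalFun fun c => evalFun u (Ψ c)) f g
  map_add' f g := locFun_ext fun u => map_add (evalFun fun c => evalFun u (Ψ c)) f g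
  commutes' r := locFun_ext fun u => (evalFun fun c => evalFun u (Ψ c)).commutes r

theorem evalFun_pullback (Ψ : Coord n ι → LocFun n ι) (f : LocFun n ι) (u : Coord n ι → ℝ) :
    evalFun u (pullback Ψ f) = evalFun (fun c => evalFun u (Ψ c)) f := rfl

theorem pullback_coord (Ψ : Coord n ι → LocFun n ι) (c : Coord n ι) :
    pullback Ψ (coord c) = Ψ c := rfl

open Classical in
/-- The substitution of `0` for the coordinates in `A`. -/
def restrictZero (A : Set (Coord n ι)) : LocFun n ι →ₐ[ℝ] LocFun n ι :=
  pullback fun c => if c ∈ A then 0 else coord c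

theorem hasFDerivAt_intervalIntegral_param {E : Type*} [NormedAddCommGroup E] [NormedSpace ℝ E]
    [FiniteDimensional ℝ E] {F : E × ℝ → ℝ} (hF : ContDiff ℝ ∞ F) (x : E) :
    HasFDerivAt (fun v => ∫ t in (0 : ℝ)..1, F (v, t))
      (∫ t in (0 : ℝ)..1, (fderiv ℝ F (x, t)).comp (ContinuousLinearMap.inl ℝ E ℝ)) x := by
  have : ProperSpace E := FiniteDimensional.proper ℝ E
  have hF' : Continuous fun p : E × ℝ =>
      (fderiv ℝ F p).comp (ContinuousLinearMap.inl ℝ E ℝ) :=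
    ((hF.continuous_fderiv (by simp))).clm_comp continuous_const
  have hK := (isCompact_closedBall x 1).prod (isCompact_Icc (a := (0 : ℝ)) (b := 1))
  obtain ⟨C, hC⟩ := hK.exists_bound_of_continuousOn hF'.continuousOn
  refine intervalIntegral.hasFDerivAt_integral_of_dominated_of_fderiv_le (bound := fun _ => C)
    (F' := fun v t => (fderiv ℝ F (v, t)).comp (ContinuousLinearMap.inl ℝ E ℝ))
    (Metric.closedBall_mem_nhds x one_pos) ?_ ?_ ?_ ?_ ?_ ?_
  · exact Filter.Eventually.of_forall fun v =>
      (hF.continuous.comp (by fun_prop : Continuous fun t : ℝ => (v, t))).aestronglyMeasurable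
  · exact (hF.continuous.comp (by fun_prop : Continuous fun t : ℝ => (x, t))).intervalIntegrable _ _
  · exact (hF'.comp (by fun_prop : Continuous fun t : ℝ => (x, t))).aestronglyMeasurable
  · refine Filter.Eventually.of_forall fun t ht v hv => hC (v, t) ⟨hv, ?_⟩
    rw [Set.uIoc_of_le zero_le_one] at ht
    exact ⟨ht.1.le, ht.2⟩
  · exact intervalIntegrable_const
  · refine Filter.Eventually.of_forall fun t _ v _ => ?_
    have h1 : HasFDerivAt F (fderiv ℝ F (v, t)) (v, t) :=
      (hF.differentiable (by simp) _).hasFDerivAt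
    exact h1.comp v (hasFDerivAt_prodMk_left v t)

theorem contDiff_intervalIntegral_param {E : Type*} [NormedAddCommGroup E] [NormedSpace ℝ E]
    [FiniteDimensional ℝ E] {F : E × ℝ → ℝ} (hF : ContDiff ℝ ∞ F) :
    ContDiff ℝ ∞ fun v => ∫ t in (0 : ℝ)..1, F (v, t) := by
  rw [contDiff_infty]
  intro m
  induction m generalizing F with
  | zero =>
    rw [Nat.cast_zero, contDiff_zero]
    exact intervalIntegral.continuous_parametric_intervalIntegral_of_continuous'
      (f := fun v t => F (v, t)) hF.continuous 0 1
  | succ m ih =>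
    rw [Nat.cast_succ, contDiff_succ_iff_fderiv_apply]
    refine ⟨fun x => (hasFDerivAt_intervalIntegral_param hF x).differentiableAt, by simp, ?_⟩
    intro y
    have h : (fun x => fderiv ℝ (fun v => ∫ t in (0 : ℝ)..1, F (v, t)) x y) =
        fun x => ∫ t in (0 : ℝ)..1, fderiv ℝ F (x, t) (y, 0) := by
      funext x
      rw [(hasFDerivAt_intervalIntegral_param hF x).fderiv,
        ContinuousLinearMap.intervalIntegral_apply]
      · rfl
      · have hF' : Continuous fun p : E × ℝ =>
            (fderiv ℝ F p).comp (ContinuousLinearMap.inl ℝ E ℝ) :=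
          ((hF.continuous_fderiv (by simp))).clm_comp continuous_const
        exact (hF'.comp (by fun_prop : Continuous fun t : ℝ => (x, t))).intervalIntegrable _ _
    rw [h]
    exact ih (F := fun p => fderiv ℝ F p (y, 0))
      ((hF.fderiv_right (by simp)).clm_apply contDiff_const)

open Classical in
/-- The jet space point `u` with the coordinates in `A` multiplied by `t`. -/
def scaleAt (A : Set (Coord n ι)) (t : ℝ) (u : Coord n ι → ℝ) : Coord n ι → ℝ :=
  fun c => if c ∈ A then t * u c else u c

open Classical in
theorem contDiff_scale_integrand (A : Set (Coord n ι)) (m : ℕ) {S : Finset (Coord n ι)}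
    {g : (S → ℝ) → ℝ} (hg : ContDiff ℝ ∞ g) :
    ContDiff ℝ ∞ fun p : (S → ℝ) × ℝ =>
      p.2 ^ m * g fun s => if s.1 ∈ A then p.2 * p.1 s else p.1 s := by
  refine (contDiff_snd.pow m).mul (hg.comp (contDiff_pi.2 fun s => ?_))
  split_ifs
  · fun_prop
  · fun_prop

theorem continuous_evalFun_scaleAt (A : Set (Coord n ι)) (f : LocFun n ι) (u : Coord n ι → ℝ) :
    Continuous fun t => evalFun (scaleAt A t u) f := by
  obtain ⟨S, g, hg, hf⟩ := exists_dependsOn f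
  simp only [hf]
  refine hg.continuous.comp (continuous_pi fun s => ?_)
  simp only [scaleAt]
  split_ifs <;> fun_prop

theorem intervalIntegrable_scale (A : Set (Coord n ι)) (m : ℕ) (f : LocFun n ι)
    (u : Coord n ι → ℝ) :
    IntervalIntegrable (fun t => t ^ m * evalFun (scaleAt A t u) f) MeasureTheory.volume 0 1 :=
  ((continuous_pow m).mul (continuous_evalFun_scaleAt A f u)).intervalIntegrable _ _

/-- The local function `u ↦ ∫₀¹ tᵐ f(σₜ u) dt`, where `σₜ` multiplies the coordinates in `A`
by `t`. -/
def scaleInt (A : Set (Coord n ι)) (m : ℕ) : Module.End ℝ (LocFun n ι) where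
  toFun f := ⟨fun u => ∫ t in (0 : ℝ)..1, t ^ m * evalFun (scaleAt A t u) f, by
    obtain ⟨S, g, hg, hf⟩ := exists_dependsOn f
    refine ⟨S, _, contDiff_intervalIntegral_param (contDiff_scale_integrand A m hg), fun u => ?_⟩
    simp only [hf]
    rfl⟩
  map_add' f g := locFun_ext fun u => by
    refine Eq.trans ?_ (intervalIntegral.integral_add (intervalIntegrable_scale A m f u)
      (intervalIntegrable_scale A m g u))
    simp only [← mul_add, ← map_add]
    rfl
  map_smul' r f := locFun_ext fun u => by
    refine Eq.trans ?_ (intervalIntegral.integral_const_mul r _)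
    refine intervalIntegral.integral_congr fun t _ => ?_
    simp only [map_smul, smul_eq_mul]
    ring

theorem evalFun_scaleInt (A : Set (Coord n ι)) (m : ℕ) (f : LocFun n ι) (u : Coord n ι → ℝ) :
    evalFun u (scaleInt A m f) = ∫ t in (0 : ℝ)..1, t ^ m * evalFun (scaleAt A t u) f := rfl

open Classical in
theorem pder_scaleInt (A : Set (Coord n ι)) (m : ℕ) (c : Coord n ι) (f : LocFun n ι) :
    pder c (scaleInt A m f) = scaleInt A (if c ∈ A then m + 1 else m) (pder c f) := by
  obtain ⟨S, g, hg, hf⟩ := exists_dependsOn f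
  have hF := contDiff_scale_integrand A m hg
  refine locFun_ext fun u => ?_
  rw [evalFun_pder (S := S) (scaleInt A m f) (contDiff_intervalIntegral_param hF) (fun u => by
    rw [evalFun_scaleInt]; simp only [hf]; rfl),
    (hasFDerivAt_intervalIntegral_param hF _).fderiv, ContinuousLinearMap.intervalIntegral_apply,
    evalFun_scaleInt]
  · refine intervalIntegral.integral_congr fun t _ => ?_
    have hpath : HasDerivAt (fun r : ℝ => ((fun s : S => Function.update u c r s.1), t))
        ((fun s : S => if s.1 = c then (1 : ℝ) else 0), 0) (u c) := by
      refine HasDerivAt.prodMk ?_ (hasDerivAt_const _ _)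
      rw [hasDerivAt_pi]
      intro s
      by_cases h : s.1 = c
      · simp only [h, Function.update_self, if_true]
        exact hasDerivAt_id _
      · simp only [Function.update_of_ne h, h, if_false]
        exact hasDerivAt_const _ _
    have hd := (hF.differentiable (by simp)
      ((fun s : S => Function.update u c (u c) s.1), t)).hasFDerivAt
    have h1 := hd.comp_hasDerivAt (u c) hpath
    have hpath2 : ∀ c', HasDerivAt (fun r => scaleAt A t (Function.update u c r) c')
        (if c' = c then (if c ∈ A then t else 1) else 0) (u c) := by
      intro c'
      simp only [scaleAt]
      by_cases h : c' = c
      · subst h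
        simp only [Function.update_self, if_true]
        split_ifs
        · simpa using (hasDerivAt_id (u c')).const_mul t
        · exact hasDerivAt_id _
      · simp only [Function.update_of_ne h, h, if_false]
        exact hasDerivAt_const _ _
    have h2 := (hasDerivAt_curve (S := S) ⟨g, hg, hf⟩ hpath2).const_mul (t ^ m)
    have h3 := h1.unique (h2.congr_of_eventuallyEq (Filter.Eventually.of_forall fun r => by
      simp only [hf]; rfl))
    simp only [Function.update_eq_self] at h3
    refine h3.trans ?_
    simp only [ite_mul, zero_mul, Finset.sum_ite_eq']
    by_cases hc : c ∈ S
    · rw [if_pos hc]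
      split_ifs <;> ring
    · rw [if_neg hc, pder_eq_zero_of_dependsOn ⟨g, hg, hf⟩ hc]
      simp
  · refine Continuous.intervalIntegrable ?_ _ _
    have h := (hF.continuous_fderiv (by simp)).comp
      (by fun_prop : Continuous fun t : ℝ => ((fun s : S => u s.1), t))
    exact h.clm_comp continuous_const

theorem scaleInt_mul_coord_of_mem {A : Set (Coord n ι)} {c : Coord n ι} (hc : c ∈ A) (m : ℕ)
    (f : LocFun n ι) : scaleInt A m (f * coord c) = scaleInt A (m + 1) f * coord c := by
  refine locFun_ext fun u => ?_
  rw [map_mul (evalFun u), evalFun_scaleInt, evalFun_scaleInt,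
    ← intervalIntegral.integral_mul_const]
  refine intervalIntegral.integral_congr fun t _ => ?_
  simp only [map_mul, evalFun_coord, scaleAt, if_pos hc]
  ring

open Classical in
theorem hasDerivAt_evalFun_scaleAt (A : Set (Coord n ι)) {f : LocFun n ι} {S : Finset (Coord n ι)}
    (hS : DependsOn f S) (u : Coord n ι → ℝ) (t : ℝ) :
    HasDerivAt (fun t => evalFun (scaleAt A t u) f)
      (∑ c ∈ S with c ∈ A, u c * evalFun (scaleAt A t u) (pder c f)) t := by
  have h := hasDerivAt_curve (p := fun t => scaleAt A t u) (p' := fun c => if c ∈ A then u c else 0)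
    (t := t) hS (fun c => by
      simp only [scaleAt]
      split_ifs
      · simpa using (hasDerivAt_id t).mul_const (u c)
      · exact hasDerivAt_const _ _)
  simpa only [ite_mul, zero_mul, Finset.sum_filter] using h

theorem scaleAt_one (A : Set (Coord n ι)) (u : Coord n ι → ℝ) : scaleAt A 1 u = u := by
  funext c
  simp [scaleAt]

theorem evalFun_scaleAt_zero (A : Set (Coord n ι)) (u : Coord n ι → ℝ) (f : LocFun n ι) :
    evalFun (scaleAt A 0 u) f = evalFun u (restrictZero A f) := by
  classical
  rw [restrictZero, evalFun_pullback]
  congr 2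
  funext c
  simp only [scaleAt, zero_mul]
  split_ifs
  · exact (map_zero _).symm
  · rfl

open Classical in
/-- The fundamental theorem of calculus along `t ↦ σₜ u`. -/
theorem sum_coord_mul_scaleInt (A : Set (Coord n ι)) {f : LocFun n ι} {S : Finset (Coord n ι)}
    (hS : DependsOn f S) :
    ∑ c ∈ S with c ∈ A, coord c * scaleInt A 0 (pder c f) = f - restrictZero A f := by
  refine locFun_ext fun u => ?_
  have h := intervalIntegral.integral_eq_sub_of_hasDerivAt (a := 0) (b := 1)
    (fun t _ => hasDerivAt_evalFun_scaleAt A hS u t) (Continuous.intervalIntegrable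
      (continuous_finsetSum _ fun c _ =>
        continuous_const.mul (continuous_evalFun_scaleAt A (pder c f) u)) _ _)
  rw [intervalIntegral.integral_finsetSum (f := fun c t => u c * evalFun (scaleAt A t u) (pder c f))
    (fun c _ => (continuous_const.mul
      (continuous_evalFun_scaleAt A (pder c f) u)).intervalIntegrable _ _), scaleAt_one,
    evalFun_scaleAt_zero] at h
  rw [map_sub, ← h, map_sum]
  refine Finset.sum_congr rfl fun c _ => ?_
  rw [map_mul, evalFun_coord, evalFun_scaleInt, ← intervalIntegral.integral_const_mul]
  refine intervalIntegral.integral_congr fun t _ => ?_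
  simp

open Classical in
theorem smul_scaleInt_add_sum (A : Set (Coord n ι)) (m : ℕ) {f : LocFun n ι}
    {S : Finset (Coord n ι)} (hS : DependsOn f S) :
    ((m : ℝ) + 1) • scaleInt A m f + ∑ c ∈ S with c ∈ A, coord c * scaleInt A (m + 1) (pder c f) =
      f := by
  refine locFun_ext fun u => ?_
  have hc1 : Continuous fun t : ℝ => ((m : ℝ) + 1) * (t ^ m * evalFun (scaleAt A t u) f) :=
    continuous_const.mul ((continuous_pow m).mul (continuous_evalFun_scaleAt A f u))
  have hc2 : ∀ c, Continuous fun t : ℝ =>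
      u c * (t ^ (m + 1) * evalFun (scaleAt A t u) (pder c f)) := fun c =>
    continuous_const.mul ((continuous_pow _).mul (continuous_evalFun_scaleAt A (pder c f) u))
  have hd : ∀ t : ℝ, HasDerivAt (fun t => t ^ (m + 1) * evalFun (scaleAt A t u) f)
      (((m : ℝ) + 1) * (t ^ m * evalFun (scaleAt A t u) f) +
        ∑ c ∈ S with c ∈ A, u c * (t ^ (m + 1) * evalFun (scaleAt A t u) (pder c f))) t := by
    intro t
    have := (hasDerivAt_pow (m + 1) t).mul (hasDerivAt_evalFun_scaleAt A hS u t)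
    refine HasDerivAt.congr_deriv this ?_
    rw [Finset.mul_sum]
    congr 1
    · push_cast
      ring
    · exact Finset.sum_congr rfl fun c _ => by ring
  have h := intervalIntegral.integral_eq_sub_of_hasDerivAt (a := 0) (b := 1)
    (fun t _ => hd t) (Continuous.intervalIntegrable
      (hc1.add (continuous_finsetSum _ fun c _ => hc2 c)) _ _)
  rw [intervalIntegral.integral_add (hc1.intervalIntegrable _ _)
    ((continuous_finsetSum _ fun c _ => hc2 c).intervalIntegrable _ _),
    intervalIntegral.integral_finsetSum (fun c _ => (hc2 c).intervalIntegrable _ _), scaleAt_one,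
    intervalIntegral.integral_const_mul] at h
  simp only [intervalIntegral.integral_const_mul] at h
  rw [map_add, map_smul, map_sum, evalFun_scaleInt]
  simp only [map_mul, evalFun_coord, evalFun_scaleInt, smul_eq_mul]
  rw [h]
  simp

theorem pder_restrictZero {A : Set (Coord n ι)} {c : Coord n ι} (hc : c ∈ A) (f : LocFun n ι) :
    pder c (restrictZero A f) = 0 := by
  classical
  refine locFun_ext fun u => evalFun_pder_of_hasDerivAt ?_
  rw [map_zero]
  refine (hasDerivAt_const (u c) (evalFun u (restrictZero A f))).congr_of_eventuallyEq
    (Filter.Eventually.of_forall fun t => ?_)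
  simp only [← evalFun_scaleAt_zero]
  congr 2
  funext c'
  simp only [scaleAt]
  split_ifs with h
  · simp
  · rw [Function.update_of_ne (show c' ≠ c from fun h' => h (by rwa [h']))]

end Calculus

/-! ### Derivations of the algebra of local forms -/

section Derivations

variable {n : ℕ} {ι γ κ : Type*}

/-- A derivation acting from the right and twisted by the algebra endomorphism `σ`. Even derivations
have `σ = id`, odd ones have `σ = par`. -/
def IsDer (σ : Form n ι γ κ →ₐ[ℝ] Form n ι γ κ) (V : Form n ι γ κ →ₗ[ℝ] Form n ι γ κ) : Prop :=
  ∀ a b, V (a * b) = a * V b + V a * σ b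

/-- Odd right derivations: `V (a b) = a (V b) + (V a) (par b)`. -/
abbrev IsOddDer (V : Form n ι γ κ →ₗ[ℝ] Form n ι γ κ) : Prop := IsDer par V

/-- Even derivations: `V (a b) = a (V b) + (V a) b`. -/
abbrev IsEvenDer (V : Form n ι γ κ →ₗ[ℝ] Form n ι γ κ) : Prop := IsDer (AlgHom.id ℝ _) V

theorem IsDer.ext {σ : Form n ι γ κ →ₐ[ℝ] Form n ι γ κ} {V W : Form n ι γ κ →ₗ[ℝ] Form n ι γ κ}
    (hV : IsDer σ V) (hW : IsDer σ W) (hf : ∀ f, V (ofFun f) = W (ofFun f))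
    (hg : ∀ g, V (gen g) = W (gen g)) (a : Form n ι γ κ) : V a = W a := by
  induction a using form_induction with
  | hfun f => exact hf f
  | hadd a b ha hb => rw [map_add, map_add, ha, hb]
  | hmul a g ha => rw [hV, hW, ha, hg]

theorem IsDer.add {σ : Form n ι γ κ →ₐ[ℝ] Form n ι γ κ} {V W : Form n ι γ κ →ₗ[ℝ] Form n ι γ κ}
    (hV : IsDer σ V) (hW : IsDer σ W) : IsDer σ (V + W) := fun a b => by
  simp only [LinearMap.add_apply, hV a b, hW a b, mul_add, add_mul]
  abel

theorem IsDer.zero {σ : Form n ι γ κ →ₐ[ℝ] Form n ι γ κ} :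
    IsDer σ (0 : Form n ι γ κ →ₗ[ℝ] Form n ι γ κ) := fun a b => by simp

theorem IsEvenDer.map_one {V : Form n ι γ κ →ₗ[ℝ] Form n ι γ κ} (hV : IsEvenDer V) : V 1 = 0 := by
  simpa using hV 1 1

theorem IsEvenDer.commutator {V W : Form n ι γ κ →ₗ[ℝ] Form n ι γ κ}
    (hV : IsEvenDer V) (hW : IsEvenDer W) : IsEvenDer (V ∘ₗ W - W ∘ₗ V) := fun a b => by
  simp only [LinearMap.sub_apply, LinearMap.comp_apply, hV a b, hW a b, map_add, hV _ b, hW _ b,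
    hV a, hW a, AlgHom.id_apply, mul_sub, sub_mul]
  abel

theorem IsOddDer.commutator {V W : Form n ι γ κ →ₗ[ℝ] Form n ι γ κ}
    (hV : IsOddDer V) (hW : IsEvenDer W) (hp : ∀ a, W (par a) = par (W a)) :
    IsOddDer (V ∘ₗ W - W ∘ₗ V) := fun a b => by
  simp only [LinearMap.sub_apply, LinearMap.comp_apply, hV a b, hW a b, map_add, hV _ b,
    hW _ (par b), hV a, hW a, AlgHom.id_apply, mul_sub, sub_mul, hp]
  abel

theorem IsOddDer.anticommutator {V W : Form n ι γ κ →ₗ[ℝ] Form n ι γ κ}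
    (hV : IsOddDer V) (hW : IsOddDer W) (hpV : ∀ a, V (par a) = -par (V a))
    (hpW : ∀ a, W (par a) = -par (W a)) : IsEvenDer (V ∘ₗ W + W ∘ₗ V) := fun a b => by
  simp only [LinearMap.add_apply, LinearMap.comp_apply, hV a b, hW a b, map_add, hV _ (par b),
    hW _ (par b), hV a, hW a, AlgHom.id_apply, mul_add, add_mul, hpV, hpW, par_par, mul_neg]
  abel

theorem IsDer.map_par_odd {V : Form n ι γ κ →ₗ[ℝ] Form n ι γ κ} (hV : IsOddDer V)
    (hf : ∀ f, par (V (ofFun f)) = -V (ofFun f))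
    (hg : ∀ g, par (V (gen g)) = -(psign g • V (gen g))) (a : Form n ι γ κ) :
    V (par a) = -par (V a) := by
  induction a using form_induction with
  | hfun f => rw [par_ofFun, hf, neg_neg]
  | hadd a b ha hb => simp only [map_add, ha, hb, neg_add]
  | hmul a g ha =>
    simp only [map_mul, hV _ _, ha, map_add, hg, par_gen, map_smul, neg_add, mul_neg, mul_smul_comm,
      neg_neg, neg_mul, smul_neg, smul_add]

theorem IsDer.map_par_even {V : Form n ι γ κ →ₗ[ℝ] Form n ι γ κ} (hV : IsEvenDer V)
    (hf : ∀ f, par (V (ofFun f)) = V (ofFun f))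
    (hg : ∀ g, par (V (gen g)) = psign g • V (gen g)) (a : Form n ι γ κ) :
    V (par a) = par (V a) := by
  induction a using form_induction with
  | hfun f => rw [par_ofFun, hf]
  | hadd a b ha hb => simp only [map_add, ha, hb]
  | hmul a g ha =>
    simp only [map_mul, hV _ _, ha, map_add, hg, par_gen, map_smul, AlgHom.id_apply, mul_smul_comm,
      smul_add]

/-! ### Vector fields -/

theorem exists_rder_support (a : Form n ι γ κ) :
    ∃ S : Finset (Gen n ι γ κ), ∀ g, g ∉ S → rder g a = 0 :=
  ⟨(rder_finite a).toFinset, fun g hg => by simpa using hg⟩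

theorem vecField_eq_sum (X : Gen n ι γ κ → Form n ι γ κ) {a : Form n ι γ κ}
    {S : Finset (Gen n ι γ κ)} (hS : ∀ g, g ∉ S → rder g a = 0) :
    vecField X a = ∑ g ∈ S, rder g a * X g := by
  refine finsum_eq_sum_of_support_subset _ fun g hg => ?_
  by_contra h
  exact hg (by simp only [LinearMap.comp_apply, hS g h, map_zero])

theorem vecField_ofFun_mul (X : Gen n ι γ κ → Form n ι γ κ) (f : LocFun n ι) (a : Form n ι γ κ) :
    vecField X (ofFun f * a) = ofFun f * vecField X a := by
  obtain ⟨S, hS⟩ := exists_rder_support a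
  rw [vecField_eq_sum X hS, vecField_eq_sum X (S := S) (fun g hg => by
    rw [rder_ofFun_mul, hS g hg, mul_zero]), Finset.mul_sum]
  exact Finset.sum_congr rfl fun g _ => by rw [rder_ofFun_mul, mul_assoc]

theorem vecField_ofFun (X : Gen n ι γ κ → Form n ι γ κ) (f : LocFun n ι) :
    vecField X (ofFun f) = 0 := by
  rw [vecField_eq_sum X (S := ∅) (fun g _ => rder_ofFun g f), Finset.sum_empty]

theorem vecField_mul_gen (X : Gen n ι γ κ → Form n ι γ κ) (ε : ℝ) (g : Gen n ι γ κ)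
    (hX : ∀ g', gsign g' g • (gen g * X g') = ε • (X g' * gen g)) (a : Form n ι γ κ) :
    vecField X (a * gen g) = a * X g + ε • (vecField X a * gen g) := by
  classical
  obtain ⟨S, hS⟩ := exists_rder_support a
  have h1 : ∀ g', g' ∉ insert g S → rder g' a = 0 := fun g' h =>
    hS g' fun h' => h (Finset.mem_insert_of_mem h')
  rw [vecField_eq_sum X h1, vecField_eq_sum X (S := insert g S) (fun g' h => by
    rw [rder_mul_gen, h1 g' h, if_neg (fun h' => h (by simp [h']))]; simp)]
  simp only [rder_mul_gen, add_mul, Finset.sum_add_distrib, ite_mul, zero_mul, Finset.sum_ite_eq',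
    Finset.mem_insert_self, if_true, Finset.sum_mul, Finset.smul_sum]
  congr 1
  refine Finset.sum_congr rfl fun g' _ => ?_
  rw [smul_mul_assoc, mul_assoc, ← mul_smul_comm, hX, mul_smul_comm, mul_assoc]

theorem vecField_gen (X : Gen n ι γ κ → Form n ι γ κ) (g : Gen n ι γ κ) :
    vecField X (gen g) = X g := by
  classical
  have h : ∀ g', rder g' (gen g) = if g' = g then (1 : Form n ι γ κ) else 0 := by
    intro g'
    have := rder_mul_gen g' g 1
    rwa [one_mul, ← ofFun_one, rder_ofFun, zero_mul, smul_zero, add_zero, ofFun_one] at this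
  rw [vecField_eq_sum X (S := {g}) (fun g' hg' => by rw [h, if_neg (by simpa using hg')]),
    Finset.sum_singleton, h, if_pos rfl, one_mul]

theorem isDer_of_mul_gen {σ : Form n ι γ κ →ₐ[ℝ] Form n ι γ κ}
    {V : Form n ι γ κ →ₗ[ℝ] Form n ι γ κ} (hf : ∀ a f, V (a * ofFun f) = a * V (ofFun f) +
      V a * σ (ofFun f)) (hg : ∀ a g, V (a * gen g) = a * V (gen g) + V a * σ (gen g)) :
    IsDer σ V := by
  intro a b
  induction b using form_induction generalizing a with
  | hfun f => exact hf a f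
  | hadd b c hb hc => simp only [mul_add, map_add, hb, hc]; abel
  | hmul b g hb =>
    rw [← mul_assoc, hg, hb, hg b g, map_mul]
    simp only [mul_add, add_mul, mul_assoc]
    abel

theorem vecField_isOddDer {X : Gen n ι γ κ → Form n ι γ κ}
    (hX : ∀ g, par (X g) = -(psign g • X g)) : IsOddDer (vecField X) := by
  refine isDer_of_mul_gen (fun a f => ?_) (fun a g => ?_)
  · rw [← ofFun_mul_comm, vecField_ofFun_mul, vecField_ofFun, mul_zero, zero_add, par_ofFun,
      ofFun_mul_comm]
  · rw [vecField_gen, vecField_mul_gen X (psign g) g, par_gen, mul_smul_comm]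
    intro g'
    rcases g with o | e
    · rw [inl_mul, hX, neg_mul, smul_mul_assoc, smul_neg, smul_smul]
      rcases g' with o' | e' <;> simp [gsign, psign]
    · rw [inr_mul]
      rcases g' with o' | e' <;> simp [gsign, psign]

theorem vecField_isEvenDer {X : Gen n ι γ κ → Form n ι γ κ}
    (hX : ∀ g, par (X g) = psign g • X g) : IsEvenDer (vecField X) := by
  refine isDer_of_mul_gen (fun a f => ?_) (fun a g => ?_)
  · rw [← ofFun_mul_comm, vecField_ofFun_mul, vecField_ofFun, mul_zero, zero_add, AlgHom.id_apply,
      ofFun_mul_comm]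
  · rw [vecField_gen, vecField_mul_gen X 1 g, one_smul, AlgHom.id_apply]
    intro g'
    rcases g with o | e
    · rw [inl_mul, hX, smul_mul_assoc, smul_smul]
      rcases g' with o' | e' <;> simp [gsign, psign]
    · rw [inr_mul]
      rcases g' with o' | e' <;> simp [gsign]

theorem vecField_par_odd {X : Gen n ι γ κ → Form n ι γ κ}
    (hX : ∀ g, par (X g) = -(psign g • X g)) (a : Form n ι γ κ) :
    vecField X (par a) = -par (vecField X a) :=
  (vecField_isOddDer hX).map_par_odd (fun f => by rw [vecField_ofFun]; simp)
    (fun g => by rw [vecField_gen, hX]) a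

theorem coeffOp_isEvenDer {q : Module.End ℝ (LocFun n ι)}
    (hq : ∀ f g, q (f * g) = q f * g + f * q g) :
    IsEvenDer (coeffOp q : Module.End ℝ (Form n ι γ κ)) := by
  have h1 : q 1 = 0 := by simpa using hq 1 1
  refine isDer_of_mul_gen (fun a f => ?_) (fun a g => ?_)
  · rw [coeffOp_ofFun, AlgHom.id_apply]
    induction a using tens_induction with
    | h0 => simp
    | ht f' b =>
      rw [ofFun, ofFun, tens_mul_tens, coeffOp_tens, tens_mul_tens, coeffOp_tens, tens_mul_tens,
        mul_one, hq, tens_add_left, add_comm]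
    | hadd a b ha hb => simp only [add_mul, map_add, ha, hb]; abel
  · rw [coeffOp_mul_gen, AlgHom.id_apply, gen_eq_tens, coeffOp_tens, h1]
    have : (tens 0 (bareGen g) : Form n ι γ κ) = 0 := TensorProduct.zero_tmul _ _
    rw [this, mul_zero, zero_add]

/-! ### Total derivatives and the horizontal differential -/

theorem par_genShift (μ : Fin n) (g : Gen n ι γ κ) :
    par (genShift μ g) = psign g • genShift μ g := by
  rcases g with (_ | _ | _ | _) | (_ | _) <;> simp [genShift, par_gen, psign]

theorem totD_isEvenDer (μ : Fin n) : IsEvenDer (totD μ : Module.End ℝ (Form n ι γ κ)) :=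
  (coeffOp_isEvenDer fun f g => locD_mul μ f g).add (vecField_isEvenDer (par_genShift μ))

theorem totD_ofFun (μ : Fin n) (f : LocFun n ι) :
    totD μ (ofFun f : Form n ι γ κ) = ofFun (locD μ f) := by
  rw [totD, LinearMap.add_apply, coeffD_eq, coeffOp_ofFun, vecField_ofFun, add_zero]

theorem coeffOp_gen {q : Module.End ℝ (LocFun n ι)} (hq : q 1 = 0) (g : Gen n ι γ κ) :
    coeffOp q (gen g) = 0 := by
  rw [gen_eq_tens, coeffOp_tens, hq]
  exact TensorProduct.zero_tmul _ _

theorem totD_gen (μ : Fin n) (g : Gen n ι γ κ) : totD μ (gen g) = genShift μ g := by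
  rw [totD, LinearMap.add_apply, coeffD_eq, coeffOp_gen (locD_one μ), vecField_gen, zero_add]

theorem totD_mul (μ : Fin n) (a b : Form n ι γ κ) :
    totD μ (a * b) = a * totD μ b + totD μ a * b := totD_isEvenDer μ a b

theorem totD_par (μ : Fin n) (a : Form n ι γ κ) : totD μ (par a) = par (totD μ a) :=
  (totD_isEvenDer μ).map_par_even (fun f => by rw [totD_ofFun, par_ofFun])
    (fun g => by rw [totD_gen, par_genShift]) a

theorem totD_genShift (μ ν : Fin n) (g : Gen n ι γ κ) :
    totD ν (genShift μ g) = totD μ (genShift ν g) := by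
  rcases g with (_ | _ | _ | _) | (_ | _) <;> simp only [genShift, totD_gen, map_zero] <;>
    rw [MI.succ_comm]

theorem totD_comm (μ ν : Fin n) (a : Form n ι γ κ) : totD μ (totD ν a) = totD ν (totD μ a) := by
  have h := ((totD_isEvenDer μ).commutator (totD_isEvenDer (ι := ι) (γ := γ) (κ := κ) ν)).ext
    IsDer.zero (fun f => by
      simp [totD_ofFun, locD_comm μ ν]) (fun g => by simp [totD_gen, totD_genShift μ ν]) a
  simpa [sub_eq_zero] using h

/-- The generator `dx^μ`. -/
abbrev dx (μ : Fin n) : Form n ι γ κ := gen (Sum.inl (OddGen.dx μ))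

/-- The contraction `∂ᴿ/∂(dx^μ)`. -/
abbrev contr (μ : Fin n) : Module.End ℝ (Form n ι γ κ) := rder (Sum.inl (OddGen.dx μ))

theorem extD_apply (a : Form n ι γ κ) : extD a = ∑ μ, totD μ a * dx μ := by
  simp [extD]

theorem totD_mul_dx (μ ν : Fin n) (a : Form n ι γ κ) : totD μ (a * dx ν) = totD μ a * dx ν := by
  rw [totD_mul, totD_gen, genShift, mul_zero, zero_add]

theorem dx_mul_dx (μ ν : Fin n) : (dx μ * dx ν : Form n ι γ κ) = -(dx ν * dx μ) := by
  rw [gen_mul_gen, gsign, neg_one_smul]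

theorem extD_extD (a : Form n ι γ κ) : extD (extD a) = 0 := by
  have h : extD (extD a) = ∑ μ, ∑ ν, totD μ (totD ν a) * (dx ν * dx μ) := by
    simp only [extD_apply, map_sum, totD_mul_dx, mul_assoc]
    exact Finset.sum_comm
  have h2 : extD (extD a) = -extD (extD a) := by
    conv_lhs => rw [h, Finset.sum_comm]
    rw [h, ← Finset.sum_neg_distrib]
    refine Finset.sum_congr rfl fun μ _ => ?_
    rw [← Finset.sum_neg_distrib]
    refine Finset.sum_congr rfl fun ν _ => ?_
    rw [dx_mul_dx μ ν, totD_comm ν μ, mul_neg]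
  have h3 : (2 : ℝ) • extD (extD a) = 0 := by
    rw [two_smul]
    nth_rewrite 1 [h2]
    exact neg_add_cancel _
  exact (smul_eq_zero.1 h3).resolve_left two_ne_zero

/-! ### Spans of monomials -/

/-- The monomial in the generators given by a list. -/
def mon (l : List (Gen n ι γ κ)) : Form n ι γ κ := (l.map gen).prod

theorem mon_nil : (mon [] : Form n ι γ κ) = 1 := rfl

theorem mon_append (l l' : List (Gen n ι γ κ)) : mon (l ++ l') = mon l * mon l' := by
  simp [mon]

theorem mon_cons (g : Gen n ι γ κ) (l : List (Gen n ι γ κ)) : mon (g :: l) = gen g * mon l := by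
  simp [mon]

theorem mon_singleton (g : Gen n ι γ κ) : mon [g] = gen g := by
  simp [mon]

/-- The space spanned by the monomials with property `p` over the local functions. -/
def mspan (p : List (Gen n ι γ κ) → Prop) : Submodule ℝ (Form n ι γ κ) :=
  Submodule.span ℝ {a | ∃ (f : LocFun n ι) (l : List (Gen n ι γ κ)), p l ∧ a = ofFun f * mon l}

theorem ofFun_mul_mon_mem {p : List (Gen n ι γ κ) → Prop} {l : List (Gen n ι γ κ)} (hl : p l)
    (f : LocFun n ι) : ofFun f * mon l ∈ mspan p := Submodule.subset_span ⟨f, l, hl, rfl⟩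

theorem mon_mem {p : List (Gen n ι γ κ) → Prop} {l : List (Gen n ι γ κ)} (hl : p l) :
    mon l ∈ mspan p := by
  have := ofFun_mul_mon_mem hl (1 : LocFun n ι)
  rwa [ofFun_one, one_mul] at this

theorem gen_mem {p : List (Gen n ι γ κ) → Prop} {g : Gen n ι γ κ} (hg : p [g]) :
    gen g ∈ mspan p := mon_singleton g ▸ mon_mem hg

theorem ofFun_mem {p : List (Gen n ι γ κ) → Prop} (hp : p []) (f : LocFun n ι) :
    ofFun f ∈ mspan p := by
  have := ofFun_mul_mon_mem hp f
  rwa [mon_nil, mul_one] at this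

theorem mspan_le {p : List (Gen n ι γ κ) → Prop} {N : Submodule ℝ (Form n ι γ κ)}
    (h : ∀ f l, p l → ofFun f * mon l ∈ N) : mspan p ≤ N :=
  Submodule.span_le.2 (by rintro _ ⟨f, l, hl, rfl⟩; exact h f l hl)

theorem mspan_mono {p q : List (Gen n ι γ κ) → Prop} (h : ∀ l, p l → q l) : mspan p ≤ mspan q :=
  mspan_le fun f _ hl => ofFun_mul_mon_mem (h _ hl) f

/-- A linear map sends `mspan p` to `N` if it does so on monomials. -/
theorem map_mspan {A : Type*} [AddCommGroup A] [Module ℝ A] {V : Form n ι γ κ →ₗ[ℝ] A}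
    {p : List (Gen n ι γ κ) → Prop} {N : Submodule ℝ A}
    (h : ∀ f l, p l → V (ofFun f * mon l) ∈ N) {a : Form n ι γ κ} (ha : a ∈ mspan p) : V a ∈ N :=
  mspan_le (N := N.comap V) h ha

theorem mul_mem_mspan {p q r : List (Gen n ι γ κ) → Prop} (h : ∀ l l', p l → q l' → r (l ++ l'))
    {a b : Form n ι γ κ} (ha : a ∈ mspan p) (hb : b ∈ mspan q) : a * b ∈ mspan r := by
  refine map_mspan (V := LinearMap.mulRight ℝ b) (fun f l hl => ?_) ha
  refine map_mspan (V := LinearMap.mulLeft ℝ (ofFun f * mon l)) (fun f' l' hl' => ?_) hb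
  have : ofFun f * mon l * (ofFun f' * mon l') = ofFun (f * f') * mon (l ++ l') := by
    rw [mon_append, ofFun_mul, mul_assoc, ← mul_assoc (mon l), ← ofFun_mul_comm f', mul_assoc,
      mul_assoc]
  rw [LinearMap.mulLeft_apply, this]
  exact ofFun_mul_mon_mem (h l l' hl hl') _

theorem ofFun_mul_mem {p : List (Gen n ι γ κ) → Prop} (f : LocFun n ι) {a : Form n ι γ κ}
    (ha : a ∈ mspan p) : ofFun f * a ∈ mspan p :=
  mul_mem_mspan (p := fun l => l = []) (by rintro _ l rfl hl; exact hl)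
    (ofFun_mem (p := fun l => l = []) rfl f) ha

theorem mem_mspan_true (a : Form n ι γ κ) : a ∈ mspan (fun _ => True) := by
  induction a using form_induction with
  | hfun f => exact ofFun_mem trivial f
  | hadd a b ha hb => exact add_mem ha hb
  | hmul a g ha =>
    exact mul_mem_mspan (q := fun _ => True) (r := fun _ => True) (fun _ _ _ _ => trivial) ha
      (gen_mem trivial)

theorem coeffOp_mon (q : Module.End ℝ (LocFun n ι)) (f : LocFun n ι) (l : List (Gen n ι γ κ)) :
    coeffOp q (ofFun f * mon l) = ofFun (q f) * mon l := by
  induction l using List.reverseRecOn with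
  | nil => rw [mon_nil, mul_one, mul_one, coeffOp_ofFun]
  | append_singleton l g ih => rw [mon_append, mon_singleton, ← mul_assoc, coeffOp_mul_gen, ih,
      mul_assoc]

theorem coeffOp_mem {p : List (Gen n ι γ κ) → Prop} (q : Module.End ℝ (LocFun n ι))
    {a : Form n ι γ κ} (ha : a ∈ mspan p) : coeffOp q a ∈ mspan p :=
  map_mspan (fun f l hl => by rw [coeffOp_mon]; exact ofFun_mul_mon_mem hl _) ha

/-- A derivation applied to a monomial replaces the generators by their images, one at a time. -/
theorem IsDer.map_mon_mem {σ : Form n ι γ κ →ₐ[ℝ] Form n ι γ κ}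
    (hσ : ∀ g, ∃ r : ℝ, σ (gen g) = r • gen g) {V : Form n ι γ κ →ₗ[ℝ] Form n ι γ κ}
    (hV : IsDer σ V) (h1 : V 1 = 0) (l : List (Gen n ι γ κ)) {N : Submodule ℝ (Form n ι γ κ)}
    (h : ∀ l₁ g l₂, l = l₁ ++ g :: l₂ → mon l₁ * V (gen g) * mon l₂ ∈ N) : V (mon l) ∈ N := by
  induction l using List.reverseRecOn generalizing N with
  | nil => rw [mon_nil, h1]; exact zero_mem _
  | append_singleton l g ih =>
    rw [mon_append, mon_singleton, hV]
    refine add_mem ?_ ?_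
    · simpa [mon_nil] using h l g [] rfl
    · obtain ⟨r, hr⟩ := hσ g
      rw [hr, mul_smul_comm]
      refine N.smul_mem _ (ih (N := N.comap (LinearMap.mulRight ℝ (gen g))) fun l₁ g' l₂ e => ?_)
      have := h l₁ g' (l₂ ++ [g]) (by simp [e])
      rwa [mon_append, mon_singleton, ← mul_assoc] at this

theorem IsDer.map_mem_mspan {σ : Form n ι γ κ →ₐ[ℝ] Form n ι γ κ}
    (hσ : ∀ g, ∃ r : ℝ, σ (gen g) = r • gen g) {V : Form n ι γ κ →ₗ[ℝ] Form n ι γ κ}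
    (hV : IsDer σ V) (h0 : ∀ f, V (ofFun f) = 0) {p q : List (Gen n ι γ κ) → Prop}
    (h : ∀ l₁ g l₂, p (l₁ ++ g :: l₂) → mon l₁ * V (gen g) * mon l₂ ∈ mspan q)
    {a : Form n ι γ κ} (ha : a ∈ mspan p) : V a ∈ mspan q := by
  refine map_mspan (fun f l hl => ?_) ha
  rw [hV, h0, zero_mul, add_zero]
  refine ofFun_mul_mem f (hV.map_mon_mem hσ (by rw [← ofFun_one, h0]) l ?_)
  rintro l₁ g l₂ rfl
  exact h l₁ g l₂ hl

theorem par_gen_exists (g : Gen n ι γ κ) : ∃ r : ℝ, par (gen g) = r • gen g := ⟨_, par_gen g⟩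

theorem id_gen_exists (g : Gen n ι γ κ) : ∃ r : ℝ, AlgHom.id ℝ _ (gen g) = r • gen g :=
  ⟨1, by simp⟩

/-- Monomials in the generators of `Γ` whose total weight lies in `K`. -/
def HasWeight {M : Type*} [AddCommMonoid M] (Γ : Set (Gen n ι γ κ)) (wt : Gen n ι γ κ → M)
    (K : Set M) (l : List (Gen n ι γ κ)) : Prop :=
  (∀ g ∈ l, g ∈ Γ) ∧ (l.map wt).sum ∈ K

/-- The local forms generated by monomials in the generators of `Γ` with total weight in `K`. -/
abbrev gspan {M : Type*} [AddCommMonoid M] (Γ : Set (Gen n ι γ κ)) (wt : Gen n ι γ κ → M)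
    (K : Set M) : Submodule ℝ (Form n ι γ κ) := mspan (HasWeight Γ wt K)

section Weights

variable {M : Type*} [AddCommMonoid M] {Γ : Set (Gen n ι γ κ)} {wt : Gen n ι γ κ → M}

theorem gspan_mono {Γ' : Set (Gen n ι γ κ)} (hΓ : Γ ⊆ Γ') {K K' : Set M} (hK : K ⊆ K') :
    gspan Γ wt K ≤ gspan Γ' wt K' :=
  mspan_mono fun _ hl => ⟨fun g hg => hΓ (hl.1 g hg), hK hl.2⟩

theorem mul_mem_gspan {k k' : M} {a b : Form n ι γ κ} (ha : a ∈ gspan Γ wt {k})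
    (hb : b ∈ gspan Γ wt {k'}) : a * b ∈ gspan Γ wt {k + k'} := by
  refine mul_mem_mspan (fun l l' hl hl' => ⟨fun g hg => ?_, ?_⟩) ha hb
  · rcases List.mem_append.1 hg with h | h
    · exact hl.1 g h
    · exact hl'.1 g h
  · rw [List.map_append, List.sum_append, hl.2, hl'.2]
    rfl

theorem gen_mem_gspan {g : Gen n ι γ κ} (hg : g ∈ Γ) : gen g ∈ gspan Γ wt {wt g} :=
  gen_mem ⟨by simpa using hg, by simp⟩

theorem gen_mem_gspan_of {g : Gen n ι γ κ} (hg : g ∈ Γ) {k : M} (hk : wt g = k) :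
    gen g ∈ gspan Γ wt {k} := hk ▸ gen_mem_gspan hg

theorem ofFun_mem_gspan (f : LocFun n ι) : ofFun f ∈ gspan Γ wt {0} :=
  ofFun_mem ⟨by simp, by simp⟩ f

theorem mon_mem_gspan {l : List (Gen n ι γ κ)} (hl : ∀ g ∈ l, g ∈ Γ) :
    mon l ∈ gspan Γ wt {(l.map wt).sum} := mon_mem ⟨hl, rfl⟩

theorem mem_gspan_of_add_eq {k k' : M} (h : k = k') {a : Form n ι γ κ} (ha : a ∈ gspan Γ wt {k}) :
    a ∈ gspan Γ wt {k'} := h ▸ ha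

/-- A derivation that shifts the weights of the generators by `c` shifts all weights by `c`. -/
theorem IsDer.map_mem_gspan {σ : Form n ι γ κ →ₐ[ℝ] Form n ι γ κ}
    (hσ : ∀ g, ∃ r : ℝ, σ (gen g) = r • gen g) {V : Form n ι γ κ →ₗ[ℝ] Form n ι γ κ}
    (hV : IsDer σ V) (h0 : ∀ f, V (ofFun f) = 0) {c : M}
    (h : ∀ g ∈ Γ, V (gen g) ∈ gspan Γ wt {wt g + c}) {K K' : Set M} (hK : ∀ k ∈ K, k + c ∈ K')
    {a : Form n ι γ κ} (ha : a ∈ gspan Γ wt K) : V a ∈ gspan Γ wt K' := by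
  refine hV.map_mem_mspan hσ h0 (fun l₁ g l₂ hl => ?_) ha
  have h1 := mul_mem_gspan (mul_mem_gspan (wt := wt) (mon_mem_gspan (Γ := Γ) (l := l₁) fun g' hg' =>
    hl.1 g' (by simp [hg'])) (h g (hl.1 g (by simp)))) (mon_mem_gspan (l := l₂) fun g' hg' =>
    hl.1 g' (by simp [hg']))
  refine gspan_mono le_rfl ?_ h1
  rw [Set.singleton_subset_iff]
  convert hK _ hl.2 using 1
  rw [List.map_append, List.sum_append, List.map_cons, List.sum_cons]
  abel

theorem totD_mem_gspan (μ : Fin n) (h : ∀ g ∈ Γ, genShift μ g ∈ gspan Γ wt {wt g}) {K : Set M}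
    {a : Form n ι γ κ} (ha : a ∈ gspan Γ wt K) : totD μ a ∈ gspan Γ wt K := by
  rw [totD, LinearMap.add_apply]
  refine add_mem (coeffOp_mem _ ha) ?_
  exact (vecField_isEvenDer (par_genShift μ)).map_mem_gspan id_gen_exists (vecField_ofFun _)
    (c := 0) (fun g hg => by rw [vecField_gen, add_zero]; exact h g hg)
    (fun k hk => by rwa [add_zero]) ha

end Weights

/-- Form degree and antighost number. -/
def bideg (g : Gen n ι γ κ) : ℤ × ℤ := (formDeg g, antigh g)

theorem forms_eq_gspan (p k : ℤ) :
    forms n ι γ κ p k = gspan Set.univ bideg {(p, k)} := by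
  have h : ∀ l : List (Gen n ι γ κ),
      (l.map bideg).sum = ((l.map formDeg).sum, (l.map antigh).sum) := by
    intro l
    induction l with
    | nil => rfl
    | cons g l ih => simp [ih, bideg]
  rw [forms, gspan, mspan]
  congr 1
  ext a
  simp only [HasWeight, Set.mem_univ, implies_true, true_and, Set.mem_singleton_iff, h,
    Prod.mk.injEq, and_assoc]
  rfl

end Derivations

/-! ### Counting operators -/

section Counting

variable {n : ℕ} {ι γ κ : Type*}

open Classical in
theorem rder_gen (g g' : Gen n ι γ κ) :
    rder g (gen g') = if g = g' then (1 : Form n ι γ κ) else 0 := by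
  have := rder_mul_gen g g' 1
  rwa [one_mul, ← ofFun_one, rder_ofFun, zero_mul, smul_zero, add_zero, ofFun_one] at this

open Classical in
theorem rder_eq_vecField (g : Gen n ι γ κ) :
    rder g = vecField (fun g' => if g' = g then (1 : Form n ι γ κ) else 0) := by
  refine LinearMap.ext fun a => ?_
  obtain ⟨S, hS⟩ := exists_rder_support a
  rw [vecField_eq_sum (S := insert g S) _ (fun g' h => hS g' fun h' =>
    h (Finset.mem_insert_of_mem h'))]
  simp

theorem rder_inl_isOddDer (o : OddGen n ι γ κ) : IsOddDer (rder (Sum.inl o : Gen n ι γ κ)) := by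
  classical
  rw [rder_eq_vecField]
  refine vecField_isOddDer fun g => ?_
  split_ifs with h
  · simp [h, psign]
  · simp

theorem rder_inl_rder_inl_self (o : OddGen n ι γ κ) (a : Form n ι γ κ) :
    rder (Sum.inl o) (rder (Sum.inl o) a) = 0 := by
  have h := rder_rder (Sum.inl o) (Sum.inl o) a
  rw [gsign, neg_one_smul] at h
  have h3 : (2 : ℝ) • rder (Sum.inl o) (rder (Sum.inl o) a) = 0 := by
    rw [two_smul]
    nth_rewrite 1 [h]
    exact neg_add_cancel _
  exact (smul_eq_zero.1 h3).resolve_left two_ne_zero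

/-- The operator `a ↦ (∂ᴿa/∂o) o` that counts the occurrences of an odd generator. -/
def numOp (o : OddGen n ι γ κ) : Module.End ℝ (Form n ι γ κ) :=
  (LinearMap.mulRight ℝ (gen (Sum.inl o))).comp (rder (Sum.inl o))

theorem numOp_apply (o : OddGen n ι γ κ) (a : Form n ι γ κ) :
    numOp o a = rder (Sum.inl o) a * gen (Sum.inl o) := rfl

theorem numOp_isEvenDer (o : OddGen n ι γ κ) : IsEvenDer (numOp o) := fun a b => by
  rw [numOp_apply, numOp_apply, numOp_apply, rder_inl_isOddDer, add_mul, mul_assoc, mul_assoc,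
    ← inl_mul, mul_assoc, AlgHom.id_apply]

theorem numOp_numOp (o : OddGen n ι γ κ) (a : Form n ι γ κ) : numOp o (numOp o a) = numOp o a := by
  classical
  rw [numOp_apply, numOp_apply, rder_mul_gen, if_pos rfl, rder_inl_rder_inl_self, zero_mul,
    smul_zero, add_zero]

theorem numOp_ofFun (o : OddGen n ι γ κ) (f : LocFun n ι) : numOp o (ofFun f) = 0 := by
  rw [numOp_apply, rder_ofFun, zero_mul]

/-- An even derivation for which the generators are eigenvectors is diagonal on monomials. -/
theorem IsEvenDer.map_mon {V : Form n ι γ κ →ₗ[ℝ] Form n ι γ κ} (hV : IsEvenDer V)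
    (h0 : ∀ f, V (ofFun f) = 0) {w : Gen n ι γ κ → ℝ} (hw : ∀ g, V (gen g) = w g • gen g)
    (f : LocFun n ι) (l : List (Gen n ι γ κ)) :
    V (ofFun f * mon l) = (l.map w).sum • (ofFun f * mon l) := by
  have h : V (mon l) = (l.map w).sum • mon l := by
    induction l with
    | nil => rw [mon_nil, hV.map_one]; simp
    | cons g l ih =>
      rw [mon_cons, hV, ih, hw, AlgHom.id_apply, List.map_cons, List.sum_cons, add_smul,
        mul_smul_comm, smul_mul_assoc, add_comm]
  rw [hV, h0, zero_mul, add_zero, h, mul_smul_comm]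

open Classical in
theorem numOp_mon (o : OddGen n ι γ κ) (f : LocFun n ι) (l : List (Gen n ι γ κ)) :
    numOp o (ofFun f * mon l) =
      (l.countP (fun g => decide (g = Sum.inl o)) : ℝ) • (ofFun f * mon l) := by
  rw [(numOp_isEvenDer o).map_mon (numOp_ofFun o)
    (w := fun g => if g = Sum.inl o then 1 else 0) (fun g => ?_)]
  · congr 1
    induction l with
    | nil => simp
    | cons g l ih =>
      rw [List.map_cons, List.sum_cons, ih, List.countP_cons]
      by_cases h : g = Sum.inl o <;> simp [h, add_comm]
  · rw [numOp_apply, rder_gen]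
    by_cases h : g = Sum.inl o
    · simp [h]
    · simp [h, Ne.symm h]

open Classical in
/-- Monomials with a repeated odd generator vanish. -/
theorem mon_eq_zero_of_count {o : OddGen n ι γ κ} {l : List (Gen n ι γ κ)}
    (hl : 2 ≤ l.countP (fun g => decide (g = Sum.inl o))) (f : LocFun n ι) :
    ofFun f * mon l = (0 : Form n ι γ κ) := by
  have h := numOp_numOp o (ofFun f * mon l)
  rw [numOp_mon, map_smul, numOp_mon, smul_smul, ← sub_eq_zero, ← sub_smul] at h
  refine (smul_eq_zero.1 h).resolve_left ?_
  have : (2 : ℝ) ≤ l.countP (fun g => decide (g = Sum.inl o)) := by exact_mod_cast hl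
  nlinarith

open Classical in
theorem sum_formDeg (l : List (Gen n ι γ κ)) :
    (l.map formDeg).sum =
      ∑ μ : Fin n, (l.countP (fun g => decide (g = Sum.inl (OddGen.dx μ))) : ℤ) := by
  induction l with
  | nil => simp
  | cons g l ih =>
    simp only [List.map_cons, List.sum_cons, ih, List.countP_cons, Nat.cast_add,
      Finset.sum_add_distrib]
    rw [add_comm]
    congr 1
    rcases g with (_ | _ | _ | _) | (_ | _) <;> simp [formDeg]

theorem forms_eq_bot_of_lt {p k : ℤ} (hp : (n : ℤ) < p) : forms n ι γ κ p k = ⊥ := by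
  classical
  rw [eq_bot_iff]
  refine Submodule.span_le.2 ?_
  rintro _ ⟨f, l, h1, -, rfl⟩
  rw [sum_formDeg] at h1
  obtain ⟨μ, hμ⟩ : ∃ μ : Fin n, 2 ≤ l.countP (fun g => decide (g = Sum.inl (OddGen.dx μ))) := by
    by_contra! h
    have : ∑ μ : Fin n, (l.countP (fun g => decide (g = Sum.inl (OddGen.dx μ))) : ℤ) ≤
        ∑ _μ : Fin n, (1 : ℤ) :=
      Finset.sum_le_sum fun μ _ => by have := h μ; omega
    simp at this
    omega
  exact mon_eq_zero_of_count hμ f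

theorem forms_eq_bot_of_neg {p k : ℤ} (hp : p < 0) : forms n ι γ κ p k = ⊥ := by
  classical
  rw [eq_bot_iff]
  refine Submodule.span_le.2 ?_
  rintro _ ⟨f, l, h1, -, rfl⟩
  rw [sum_formDeg] at h1
  have : 0 ≤ ∑ μ : Fin n, (l.countP (fun g => decide (g = Sum.inl (OddGen.dx μ))) : ℤ) :=
    Finset.sum_nonneg fun _ _ => by positivity
  omega

end Counting

/-! ### The lowering operators -/

section Lowering

variable {n : ℕ} {ι γ κ : Type*}

/-- The multi-index `I - e_μ` (truncated at `0`). -/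
def MI.pred (I : MI n) (μ : Fin n) : MI n := I - Pi.single μ 1

theorem MI.pred_succ_self (I : MI n) (μ : Fin n) : (I.succ μ).pred μ = I := by
  simp [MI.pred, MI.succ]

theorem MI.succ_pred_self (I : MI n) {μ : Fin n} (h : I μ ≠ 0) : (I.pred μ).succ μ = I := by
  funext ν
  rcases eq_or_ne ν μ with rfl | hν
  · simp [MI.pred, MI.succ]
    omega
  · simp [MI.pred, MI.succ, hν]

theorem MI.pred_succ_of_ne (I : MI n) {μ ν : Fin n} (h : μ ≠ ν) :
    (I.succ μ).pred ν = (I.pred ν).succ μ := by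
  funext ρ
  rcases eq_or_ne ρ ν with rfl | h1
  · simp [MI.pred, MI.succ, h]
  · simp [MI.pred, MI.succ, h1]

theorem MI.pred_comm (I : MI n) (μ ν : Fin n) : (I.pred μ).pred ν = (I.pred ν).pred μ := by
  funext ρ
  simp [MI.pred, Nat.sub_sub, add_comm]

theorem MI.order_pred_lt (I : MI n) {μ : Fin n} (h : I μ ≠ 0) : (I.pred μ).order < I.order := by
  refine Finset.sum_lt_sum (fun ν _ => by simp [MI.pred]) ⟨μ, Finset.mem_univ _, ?_⟩
  simp [MI.pred]
  omega

/-- Lowering of the derivatives of the generators, `∂_I Φ ↦ I_μ ∂_{I - e_μ} Φ`. -/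
def genLower (μ : Fin n) : Gen n ι γ κ → Form n ι γ κ
  | Sum.inl (OddGen.dx _) => 0
  | Sum.inl (OddGen.ghost α I) => (I μ : ℝ) • gen (Sum.inl (OddGen.ghost α (I.pred μ)))
  | Sum.inl (OddGen.afField i I) => (I μ : ℝ) • gen (Sum.inl (OddGen.afField i (I.pred μ)))
  | Sum.inl (OddGen.afRed Δ I) => (I μ : ℝ) • gen (Sum.inl (OddGen.afRed Δ (I.pred μ)))
  | Sum.inr (EvenGen.ghost Δ I) => (I μ : ℝ) • gen (Sum.inr (EvenGen.ghost Δ (I.pred μ)))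
  | Sum.inr (EvenGen.afGauge α I) => (I μ : ℝ) • gen (Sum.inr (EvenGen.afGauge α (I.pred μ)))

/-- The number `1` of fields, ghosts or antifields carried by a generator other than `dx^μ`. -/
def jetWt : Gen n ι γ κ → ℕ
  | Sum.inl (OddGen.dx _) => 0
  | _ => 1

/-- The order of the derivative of a generator. -/
def jetOrd : Gen n ι γ κ → ℕ
  | Sum.inl (OddGen.dx _) => 0
  | Sum.inl (OddGen.ghost _ I) => I.order
  | Sum.inl (OddGen.afField _ I) => I.order
  | Sum.inl (OddGen.afRed _ I) => I.order
  | Sum.inr (EvenGen.ghost _ I) => I.order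
  | Sum.inr (EvenGen.afGauge _ I) => I.order

/-- The derivation `T^μ` lowering the derivatives of the generators. Together with the total
derivatives these operators satisfy the canonical commutation relations
`[T^ν, ∂_μ] = δ^ν_μ N`, with `N` the counting operator of the generators other than `dx^μ`. -/
def lowerOp (μ : Fin n) : Form n ι γ κ →ₗ[ℝ] Form n ι γ κ := vecField (genLower μ)

/-- The counting operator of the generators other than `dx^μ`. -/
def countOp : Form n ι γ κ →ₗ[ℝ] Form n ι γ κ := vecField fun g => (jetWt g : ℝ) • gen g

theorem par_genLower (μ : Fin n) (g : Gen n ι γ κ) :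
    par (genLower μ g) = psign g • genLower μ g := by
  rcases g with (_ | _ | _ | _) | (_ | _) <;> simp [genLower, par_gen, psign]

theorem lowerOp_isEvenDer (μ : Fin n) : IsEvenDer (lowerOp μ : Form n ι γ κ →ₗ[ℝ] Form n ι γ κ) :=
  vecField_isEvenDer (par_genLower μ)

theorem countOp_isEvenDer : IsEvenDer (countOp : Form n ι γ κ →ₗ[ℝ] Form n ι γ κ) :=
  vecField_isEvenDer fun g => by rw [map_smul, par_gen, smul_comm]

theorem lowerOp_ofFun (μ : Fin n) (f : LocFun n ι) : lowerOp μ (ofFun f : Form n ι γ κ) = 0 :=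
  vecField_ofFun _ f

theorem countOp_ofFun (f : LocFun n ι) : countOp (ofFun f : Form n ι γ κ) = 0 :=
  vecField_ofFun _ f

theorem lowerOp_gen (μ : Fin n) (g : Gen n ι γ κ) : lowerOp μ (gen g) = genLower μ g :=
  vecField_gen _ g

theorem countOp_gen (g : Gen n ι γ κ) : countOp (gen g) = (jetWt g : ℝ) • gen g :=
  vecField_gen _ g

theorem smul_gen_pred_succ {F : MI n → Form n ι γ κ} (I : MI n) (μ ν : Fin n) :
    ((I.succ μ) ν : ℝ) • F ((I.succ μ).pred ν) - (I ν : ℝ) • F ((I.pred ν).succ μ) =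
      if μ = ν then F I else 0 := by
  rcases eq_or_ne μ ν with rfl | h
  · rw [if_pos rfl, MI.pred_succ_self]
    by_cases hI : I μ = 0
    · simp [hI, MI.succ]
    · rw [MI.succ_pred_self I hI, ← sub_smul]
      simp [MI.succ]
  · rw [if_neg h, MI.pred_succ_of_ne I h]
    simp [MI.succ, h.symm]

/-- The canonical commutation relations. -/
theorem lowerOp_totD (μ ν : Fin n) (a : Form n ι γ κ) :
    lowerOp ν (totD μ a) = totD μ (lowerOp ν a) + if μ = ν then countOp a else 0 := by
  have hW : IsEvenDer (if μ = ν then countOp else 0 : Form n ι γ κ →ₗ[ℝ] Form n ι γ κ) := by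
    split_ifs
    · exact countOp_isEvenDer
    · exact IsDer.zero
  have h := ((lowerOp_isEvenDer ν).commutator (totD_isEvenDer (ι := ι) (γ := γ) (κ := κ) μ)).ext
    hW (fun f => by
      split_ifs <;> simp [totD_ofFun, lowerOp_ofFun, countOp_ofFun]) (fun g => by
      simp only [LinearMap.sub_apply, LinearMap.comp_apply, totD_gen, lowerOp_gen]
      rcases g with (ρ | ⟨α, I⟩ | ⟨i, I⟩ | ⟨Δ, I⟩) | (⟨Δ, I⟩ | ⟨α, I⟩) <;>
        simp only [genShift, genLower, lowerOp_gen, map_smul, totD_gen, map_zero, sub_zero]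
      · split_ifs <;> simp [countOp_gen, jetWt]
      · refine (smul_gen_pred_succ (F := fun I => gen (Sum.inl (OddGen.ghost α I))) I μ ν).trans ?_
        split_ifs <;> simp [countOp_gen, jetWt]
      · refine (smul_gen_pred_succ
          (F := fun I => gen (Sum.inl (OddGen.afField i I))) I μ ν).trans ?_
        split_ifs <;> simp [countOp_gen, jetWt]
      · refine (smul_gen_pred_succ (F := fun I => gen (Sum.inl (OddGen.afRed Δ I))) I μ ν).trans ?_
        split_ifs <;> simp [countOp_gen, jetWt]
      · refine (smul_gen_pred_succ (F := fun I => gen (Sum.inr (EvenGen.ghost Δ I))) I μ ν).trans ?_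
        split_ifs <;> simp [countOp_gen, jetWt]
      · refine (smul_gen_pred_succ
          (F := fun I => gen (Sum.inr (EvenGen.afGauge α I))) I μ ν).trans ?_
        split_ifs <;> simp [countOp_gen, jetWt]) a
  rw [LinearMap.sub_apply, sub_eq_iff_eq_add'] at h
  rw [LinearMap.comp_apply, LinearMap.comp_apply] at h
  rw [h]
  split_ifs <;> rfl

theorem smul_gen_pred_pred {F : MI n → Form n ι γ κ} (I : MI n) (μ ν : Fin n) :
    (I μ : ℝ) • ((I.pred μ) ν : ℝ) • F ((I.pred μ).pred ν) =
      (I ν : ℝ) • ((I.pred ν) μ : ℝ) • F ((I.pred ν).pred μ) := by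
  rcases eq_or_ne μ ν with rfl | h
  · rfl
  · rw [MI.pred_comm I μ ν, smul_smul, smul_smul]
    simp [MI.pred, h, h.symm, mul_comm]

theorem lowerOp_comm (μ ν : Fin n) (a : Form n ι γ κ) :
    lowerOp ν (lowerOp μ a) = lowerOp μ (lowerOp ν a) := by
  have h := ((lowerOp_isEvenDer ν).commutator (lowerOp_isEvenDer (ι := ι) (γ := γ) (κ := κ) μ)).ext
    IsDer.zero (fun f => by simp [lowerOp_ofFun]) (fun g => by
      simp only [LinearMap.sub_apply, LinearMap.comp_apply, lowerOp_gen, LinearMap.zero_apply,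
        sub_eq_zero]
      rcases g with (ρ | ⟨α, I⟩ | ⟨i, I⟩ | ⟨Δ, I⟩) | (⟨Δ, I⟩ | ⟨α, I⟩) <;>
        simp only [genLower, lowerOp_gen, map_smul, map_zero]
      · exact smul_gen_pred_pred (F := fun I => gen (Sum.inl (OddGen.ghost α I))) I μ ν
      · exact smul_gen_pred_pred (F := fun I => gen (Sum.inl (OddGen.afField i I))) I μ ν
      · exact smul_gen_pred_pred (F := fun I => gen (Sum.inl (OddGen.afRed Δ I))) I μ ν
      · exact smul_gen_pred_pred (F := fun I => gen (Sum.inr (EvenGen.ghost Δ I))) I μ ν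
      · exact smul_gen_pred_pred (F := fun I => gen (Sum.inr (EvenGen.afGauge α I))) I μ ν) a
  simpa [sub_eq_zero] using h

theorem countOp_comm_of_homogeneous {V : Form n ι γ κ →ₗ[ℝ] Form n ι γ κ} (hV : IsEvenDer V)
    (hf : ∀ f, countOp (V (ofFun f)) = 0)
    (hg : ∀ g, countOp (V (gen g)) = (jetWt g : ℝ) • V (gen g)) (a : Form n ι γ κ) :
    countOp (V a) = V (countOp a) := by
  have h := (countOp_isEvenDer.commutator hV).ext
    IsDer.zero (fun f => by simp [countOp_ofFun, hf]) (fun g => by simp [countOp_gen, hg]) a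
  simpa [sub_eq_zero] using h

theorem countOp_lowerOp (μ : Fin n) (a : Form n ι γ κ) :
    countOp (lowerOp μ a) = lowerOp μ (countOp a) :=
  countOp_comm_of_homogeneous (lowerOp_isEvenDer μ) (fun f => by simp [lowerOp_ofFun]) (fun g => by
    rw [lowerOp_gen]
    rcases g with (ρ | ⟨α, I⟩ | ⟨i, I⟩ | ⟨Δ, I⟩) | (⟨Δ, I⟩ | ⟨α, I⟩) <;>
      simp [genLower, countOp_gen, jetWt]) a

theorem countOp_totD (μ : Fin n) (a : Form n ι γ κ) : countOp (totD μ a) = totD μ (countOp a) :=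
  countOp_comm_of_homogeneous (totD_isEvenDer μ) (fun f => by simp [totD_ofFun, countOp_ofFun])
    (fun g => by
    rw [totD_gen]
    rcases g with (ρ | ⟨α, I⟩ | ⟨i, I⟩ | ⟨Δ, I⟩) | (⟨Δ, I⟩ | ⟨α, I⟩) <;>
      simp [genShift, countOp_gen, jetWt]) a

theorem countOp_mul_dx (μ : Fin n) (a : Form n ι γ κ) :
    countOp (a * dx μ) = countOp a * dx μ := by
  rw [countOp_isEvenDer, countOp_gen, AlgHom.id_apply]
  simp [jetWt]

theorem countOp_extD (a : Form n ι γ κ) : countOp (extD a) = extD (countOp a) := by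
  simp only [extD_apply, map_sum, countOp_mul_dx, countOp_totD]

theorem contr_mul_dx (μ ν : Fin n) (a : Form n ι γ κ) :
    contr μ (a * dx ν) = (if μ = ν then a else 0) - contr μ a * dx ν := by
  classical
  rw [rder_mul_gen, gsign, neg_one_smul, ← sub_eq_add_neg]
  congr 1
  simp

theorem contr_comm_of_even {V : Form n ι γ κ →ₗ[ℝ] Form n ι γ κ} (hV : IsEvenDer V) (μ : Fin n)
    (hp : ∀ a, V (par a) = par (V a)) (hf : ∀ f, contr μ (V (ofFun f)) = 0)
    (hg : ∀ g, contr μ (V (gen g)) = 0) (a : Form n ι γ κ) : contr μ (V a) = V (contr μ a) := by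
  classical
  have h := ((rder_inl_isOddDer (OddGen.dx μ)).commutator hV hp).ext
    IsDer.zero (fun f => by simp [rder_ofFun, hf]) (fun g => by
      simp only [LinearMap.sub_apply, LinearMap.comp_apply, hg, rder_gen]
      split_ifs <;> simp [hV.map_one]) a
  simpa [sub_eq_zero] using h

theorem contr_totD (μ ν : Fin n) (a : Form n ι γ κ) : contr μ (totD ν a) = totD ν (contr μ a) := by
  classical
  refine contr_comm_of_even (totD_isEvenDer ν) μ (totD_par ν)
    (fun f => by rw [totD_ofFun, rder_ofFun]) (fun g => ?_) a
  rw [totD_gen]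
  rcases g with (ρ | ⟨α, I⟩ | ⟨i, I⟩ | ⟨Δ, I⟩) | (⟨Δ, I⟩ | ⟨α, I⟩) <;>
    simp [genShift, rder_gen]

theorem lowerOp_mul_dx (μ ν : Fin n) (a : Form n ι γ κ) :
    lowerOp μ (a * dx ν) = lowerOp μ a * dx ν := by
  rw [lowerOp_isEvenDer, lowerOp_gen, genLower, mul_zero, zero_add, AlgHom.id_apply]

/-! ### The horizontal homotopy -/

theorem sum_contr_mul_dx {p k : ℤ} {a : Form n ι γ κ} (ha : a ∈ forms n ι γ κ p k) :
    ∑ μ, contr μ a * dx μ = (p : ℝ) • a := by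
  classical
  have h : a ∈ LinearMap.ker ((∑ μ : Fin n, numOp (OddGen.dx μ)) -
      (p : ℝ) • (LinearMap.id : Module.End ℝ (Form n ι γ κ))) := by
    refine Submodule.span_le.2 ?_ ha
    rintro _ ⟨f, l, h1, -, rfl⟩
    have h2 : (p : ℝ) =
        ∑ μ : Fin n, (l.countP (fun g => decide (g = Sum.inl (OddGen.dx μ))) : ℝ) := by
      rw [← h1, sum_formDeg]
      push_cast
      rfl
    rw [SetLike.mem_coe, LinearMap.mem_ker, LinearMap.sub_apply, LinearMap.sum_apply, sub_eq_zero,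
      LinearMap.smul_apply, LinearMap.id_apply, h2, Finset.sum_smul]
    exact Finset.sum_congr rfl fun μ _ => numOp_mon _ f l
  rw [LinearMap.mem_ker, LinearMap.sub_apply, LinearMap.sum_apply, sub_eq_zero] at h
  exact h

/-- The homotopy operator `∑_μ T^μ ∂ᴿ/∂(dx^μ)`. -/
def horHtp (a : Form n ι γ κ) : Form n ι γ κ := ∑ ν, lowerOp ν (contr ν a)

/-- The operator `∑_μ ∂_μ T^μ`. -/
def raiseLower : Form n ι γ κ →ₗ[ℝ] Form n ι γ κ := ∑ μ : Fin n, totD μ ∘ₗ lowerOp μ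

theorem raiseLower_apply (a : Form n ι γ κ) : raiseLower a = ∑ μ, totD μ (lowerOp μ a) := by
  simp [raiseLower]

theorem horHtp_extD (a : Form n ι γ κ) :
    horHtp (extD a) = ∑ ν, lowerOp ν (totD ν a) -
      ∑ ν, ∑ μ, lowerOp ν (totD μ (contr ν a)) * dx μ := by
  simp only [horHtp, extD_apply, map_sum, contr_mul_dx, map_sub, Finset.sum_sub_distrib,
    lowerOp_mul_dx, contr_totD]
  congr 1
  refine Finset.sum_congr rfl fun ν _ => ?_
  rw [Finset.sum_eq_single ν]
  · rw [if_pos rfl]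
  · intro μ _ h
    rw [if_neg h.symm, map_zero]
  · simp

theorem extD_horHtp (a : Form n ι γ κ) :
    extD (horHtp a) = ∑ ν, ∑ μ, totD μ (lowerOp ν (contr ν a)) * dx μ := by
  simp only [horHtp, extD_apply, map_sum]

/-- The homotopy formula. Commuting `T^μ` past `∂_μ` produces the counting operator, `n` times from
the trace over `μ` and `p` times from the count of the `dx^μ`. -/
theorem homotopy_formula {p k : ℤ} {a : Form n ι γ κ} (ha : a ∈ forms n ι γ κ p k) :
    extD (horHtp a) + horHtp (extD a) = raiseLower a + ((n : ℝ) - p) • countOp a := by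
  have h : horHtp (extD a) = raiseLower a + (n : ℝ) • countOp a -
      (extD (horHtp a) + countOp ((p : ℝ) • a)) := by
    rw [← sum_contr_mul_dx ha, horHtp_extD, extD_horHtp, raiseLower_apply]
    simp only [lowerOp_totD, if_true, Finset.sum_add_distrib, add_mul, map_sum, countOp_mul_dx]
    simp [Nat.cast_smul_eq_nsmul]
  rw [h, map_smul, sub_smul]
  abel

/-- The local forms annihilated by all products of `m` lowering operators. -/
def lowNil (n : ℕ) (ι γ κ : Type*) : ℕ → Submodule ℝ (Form n ι γ κ)
  | 0 => ⊥
  | m + 1 => ⨅ μ, (lowNil n ι γ κ m).comap (lowerOp μ)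

theorem mem_lowNil_succ {m : ℕ} {a : Form n ι γ κ} :
    a ∈ lowNil n ι γ κ (m + 1) ↔ ∀ μ, lowerOp μ a ∈ lowNil n ι γ κ m := by
  simp [lowNil, Submodule.mem_iInf]

/-- Lowering operators lower the total order of derivatives, so that they act nilpotently. -/
theorem mspan_jetOrd_le_lowNil (m : ℕ) :
    mspan (fun l => (l.map jetOrd).sum < m) ≤ lowNil n ι γ κ m := by
  induction m with
  | zero => exact mspan_le fun f l hl => absurd hl (Nat.not_lt_zero _)
  | succ m ih =>
    intro a ha
    rw [mem_lowNil_succ]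
    intro μ
    refine ih ?_
    refine (lowerOp_isEvenDer μ).map_mem_mspan id_gen_exists (lowerOp_ofFun μ)
      (fun l₁ g l₂ hl => ?_) ha
    have key : ∀ g', jetOrd g' < jetOrd g →
        mon l₁ * gen g' * mon l₂ ∈
          mspan (fun l : List (Gen n ι γ κ) => (l.map jetOrd).sum < m) := by
      intro g' hg'
      rw [mul_assoc, ← mon_cons, ← mon_append]
      refine mon_mem ?_
      simp only [List.map_append, List.map_cons, List.sum_append, List.sum_cons] at hl ⊢
      omega
    have key2 : ∀ (I : MI n) (G : MI n → Gen n ι γ κ), (∀ I, jetOrd (G I) = I.order) → g = G I →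
        mon l₁ * ((I μ : ℝ) • gen (G (I.pred μ))) * mon l₂ ∈
          mspan (fun l : List (Gen n ι γ κ) => (l.map jetOrd).sum < m) := by
      intro I G hG hg
      by_cases hI : I μ = 0
      · simp [hI]
      · rw [mul_smul_comm, smul_mul_assoc]
        refine Submodule.smul_mem _ _ (key _ ?_)
        rw [hg, hG, hG]
        exact MI.order_pred_lt I hI
    rw [lowerOp_gen]
    rcases g with (ρ | ⟨α, I⟩ | ⟨i, I⟩ | ⟨Δ, I⟩) | (⟨Δ, I⟩ | ⟨α, I⟩) <;> rw [genLower]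
    · simp
    · exact key2 I (fun I => Sum.inl (OddGen.ghost α I)) (fun _ => rfl) rfl
    · exact key2 I (fun I => Sum.inl (OddGen.afField i I)) (fun _ => rfl) rfl
    · exact key2 I (fun I => Sum.inl (OddGen.afRed Δ I)) (fun _ => rfl) rfl
    · exact key2 I (fun I => Sum.inr (EvenGen.ghost Δ I)) (fun _ => rfl) rfl
    · exact key2 I (fun I => Sum.inr (EvenGen.afGauge α I)) (fun _ => rfl) rfl

theorem exists_mem_mspan_lt (w : Gen n ι γ κ → ℕ) (a : Form n ι γ κ) :
    ∃ m, a ∈ mspan (fun l => (l.map w).sum < m) := by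
  refine Submodule.span_induction (p := fun a _ => ∃ m, a ∈ mspan (fun l => (l.map w).sum < m))
    ?_ ⟨0, zero_mem _⟩ ?_ ?_ (mem_mspan_true a)
  · rintro _ ⟨f, l, -, rfl⟩
    exact ⟨_, ofFun_mul_mon_mem (Nat.lt_succ_self _) f⟩
  · rintro a b - - ⟨m, hm⟩ ⟨m', hm'⟩
    exact ⟨max m m', add_mem (mspan_mono (fun l h => lt_max_of_lt_left h) hm)
      (mspan_mono (fun l h => lt_max_of_lt_right h) hm')⟩
  · rintro r a - ⟨m, hm⟩
    exact ⟨m, Submodule.smul_mem _ _ hm⟩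

theorem exists_mem_lowNil (a : Form n ι γ κ) : ∃ m, a ∈ lowNil n ι γ κ m :=
  let ⟨m, hm⟩ := exists_mem_mspan_lt jetOrd a
  ⟨m, mspan_jetOrd_le_lowNil m hm⟩

/-- On forms annihilated by all products of `m + 1` lowering operators, the operator `∑ ∂_μ T^μ`
has the top eigenvalue `m w`, if `w` is the eigenvalue of the counting operator. -/
theorem raiseLower_sub_mem (m : ℕ) {w : ℝ} {a : Form n ι γ κ} (ha : a ∈ lowNil n ι γ κ (m + 1))
    (hw : countOp a = w • a) : raiseLower a - (m * w) • a ∈ lowNil n ι γ κ m := by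
  induction m generalizing a with
  | zero =>
    have h : ∀ μ, lowerOp μ a = 0 := mem_lowNil_succ.1 ha
    simp [raiseLower_apply, h]
  | succ m ih =>
    rw [mem_lowNil_succ] at ha ⊢
    intro ν
    have h := ih (ha ν) (by rw [countOp_lowerOp, hw, map_smul])
    convert h using 1
    simp only [map_sub, raiseLower_apply, map_sum, lowerOp_totD, Finset.sum_add_distrib,
      Finset.sum_ite_eq', Finset.mem_univ, if_true, countOp_lowerOp, hw, map_smul]
    rw [Finset.sum_congr rfl fun μ _ => by rw [lowerOp_comm μ ν]]
    push_cast
    module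

theorem dx_mem (μ : Fin n) : (dx μ : Form n ι γ κ) ∈ gspan Set.univ bideg {((1 : ℤ), (0 : ℤ))} :=
  gen_mem_gspan_of (wt := bideg) (Set.mem_univ _) rfl

theorem mul_dx_mem {p k : ℤ} {a : Form n ι γ κ} (ha : a ∈ forms n ι γ κ p k) (μ : Fin n) :
    a * dx μ ∈ forms n ι γ κ (p + 1) k := by
  rw [forms_eq_gspan] at ha ⊢
  exact mem_gspan_of_add_eq (by simp) (mul_mem_gspan ha (dx_mem μ))

theorem genShift_mem (μ : Fin n) (g : Gen n ι γ κ) :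
    genShift μ g ∈ gspan Set.univ bideg {bideg g} := by
  rcases g with (ρ | ⟨α, I⟩ | ⟨i, I⟩ | ⟨Δ, I⟩) | (⟨Δ, I⟩ | ⟨α, I⟩) <;> rw [genShift]
  · exact zero_mem _
  all_goals exact gen_mem_gspan_of (wt := bideg) (Set.mem_univ _) rfl

theorem totD_mem {p k : ℤ} {a : Form n ι γ κ} (ha : a ∈ forms n ι γ κ p k) (μ : Fin n) :
    totD μ a ∈ forms n ι γ κ p k := by
  rw [forms_eq_gspan] at ha ⊢
  exact totD_mem_gspan μ (fun g _ => genShift_mem μ g) ha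

theorem extD_mem {p k : ℤ} {a : Form n ι γ κ} (ha : a ∈ forms n ι γ κ p k) :
    extD a ∈ forms n ι γ κ (p + 1) k := by
  rw [extD_apply]
  exact sum_mem fun μ _ => mul_dx_mem (totD_mem ha μ) μ

theorem lowerOp_mem {p k : ℤ} {a : Form n ι γ κ} (ha : a ∈ forms n ι γ κ p k) (μ : Fin n) :
    lowerOp μ a ∈ forms n ι γ κ p k := by
  rw [forms_eq_gspan] at ha ⊢
  refine (lowerOp_isEvenDer μ).map_mem_gspan id_gen_exists (lowerOp_ofFun μ) (c := 0)
    (fun g _ => ?_) (fun k hk => by rwa [add_zero]) ha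
  rw [lowerOp_gen, add_zero]
  rcases g with (ρ | ⟨α, I⟩ | ⟨i, I⟩ | ⟨Δ, I⟩) | (⟨Δ, I⟩ | ⟨α, I⟩) <;> rw [genLower]
  · exact zero_mem _
  all_goals exact Submodule.smul_mem _ _ (gen_mem_gspan_of (wt := bideg) (Set.mem_univ _) rfl)

theorem contr_mem {p k : ℤ} {a : Form n ι γ κ} (ha : a ∈ forms n ι γ κ p k) (μ : Fin n) :
    contr μ a ∈ forms n ι γ κ (p - 1) k := by
  classical
  rw [forms_eq_gspan] at ha ⊢
  refine (rder_inl_isOddDer _).map_mem_gspan par_gen_exists (rder_ofFun _) (c := (-1, 0))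
    (fun g _ => ?_) (fun k hk => ?_) ha
  · rw [rder_gen]
    split_ifs with h
    · subst h
      rw [← ofFun_one]
      exact mem_gspan_of_add_eq (by simp [bideg, formDeg, antigh]; rfl) (ofFun_mem_gspan _)
    · exact zero_mem _
  · rw [Set.mem_singleton_iff] at hk ⊢
    rw [hk]
    simp [sub_eq_add_neg]

theorem horHtp_mem {p k : ℤ} {a : Form n ι γ κ} (ha : a ∈ forms n ι γ κ p k) :
    horHtp a ∈ forms n ι γ κ (p - 1) k :=
  sum_mem fun μ _ => lowerOp_mem (contr_mem ha μ) μ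

theorem raiseLower_mem {p k : ℤ} {a : Form n ι γ κ} (ha : a ∈ forms n ι γ κ p k) :
    raiseLower a ∈ forms n ι γ κ p k := by
  rw [raiseLower_apply]
  exact sum_mem fun μ _ => totD_mem (lowerOp_mem ha μ) μ

theorem extD_raiseLower_of_closed {p k : ℤ} {a : Form n ι γ κ} (ha : a ∈ forms n ι γ κ p k)
    (hd : extD a = 0) : raiseLower a = extD (horHtp a) - ((n : ℝ) - p) • countOp a := by
  have h := homotopy_formula ha
  have h0 : horHtp (0 : Form n ι γ κ) = 0 := by simp [horHtp]
  rw [hd, h0, add_zero] at h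
  rw [h, add_sub_cancel_right]

/-- Closed forms of degree less than `n` that are eigenvectors of the counting operator with
positive eigenvalue are exact. On a closed form, the homotopy formula makes `∑ ∂_μ T^μ` exact up to
`-(n - p) w`; as its top eigenvalue is `m w` with `m ≥ 0`, the factor `(n - p + m) w` can be divided
out and `m` lowered. -/
theorem exact_of_closed_of_countOp {p k : ℤ} (hp : p < n) {w : ℝ} (hw : 0 < w)
    {a : Form n ι γ κ} (ha : a ∈ forms n ι γ κ p k) (hd : extD a = 0) (hc : countOp a = w • a) :
    ∃ c ∈ forms n ι γ κ (p - 1) k, extD c = a := by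
  obtain ⟨m, hm⟩ := exists_mem_lowNil a
  induction m generalizing a with
  | zero => exact ⟨0, zero_mem _, by rw [map_zero, (Submodule.mem_bot ℝ).1 hm]⟩
  | succ m ih =>
    have e := extD_raiseLower_of_closed ha hd
    have hb : extD (raiseLower a - (m * w) • a) = 0 := by
      rw [e, map_sub, map_sub, extD_extD, hc, map_smul, map_smul, map_smul, hd]
      simp
    have hcc : countOp (raiseLower a - (m * w) • a) = w • (raiseLower a - (m * w) • a) := by
      have : countOp (raiseLower a) = raiseLower (countOp a) := by
        simp only [raiseLower_apply, map_sum, countOp_totD, countOp_lowerOp]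
      rw [map_sub, this, map_smul, hc, map_smul, smul_sub, smul_comm w]
    obtain ⟨c, hcm, hcd⟩ := ih (sub_mem (raiseLower_mem ha) (Submodule.smul_mem _ _ ha)) hb hcc
      (raiseLower_sub_mem m hm hc)
    have hpos : ((n : ℝ) - p + m) * w ≠ 0 := by
      have : (p : ℝ) < n := by exact_mod_cast hp
      have : 0 < (n : ℝ) - p + m := by
        have : (0 : ℝ) ≤ m := Nat.cast_nonneg m
        linarith
      positivity
    refine ⟨(((n : ℝ) - p + m) * w)⁻¹ • (horHtp a - c),
      Submodule.smul_mem _ _ (sub_mem (horHtp_mem ha) hcm), ?_⟩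
    rw [map_smul, map_sub, hcd, e, hc]
    rw [inv_smul_eq_iff₀ hpos]
    module

theorem eq_zero_of_sum_eigenvectors {A : Type*} [AddCommGroup A] [Module ℝ A]
    (N : Module.End ℝ A) (s : Finset ℕ) (x : ℕ → A) (hx : ∀ w ∈ s, N (x w) = (w : ℝ) • x w)
    (hs : ∑ w ∈ s, x w = 0) : ∀ w ∈ s, x w = 0 := by
  classical
  induction s using Finset.induction_on generalizing x with
  | empty => simp
  | insert v s hv ih =>
    have h1 : ∑ w ∈ s, ((w : ℝ) - v) • x w = 0 := by
      have h2 : N (∑ w ∈ insert v s, x w) - (v : ℝ) • ∑ w ∈ insert v s, x w = 0 := by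
        rw [hs]
        simp
      rw [map_sum, Finset.smul_sum, ← Finset.sum_sub_distrib, Finset.sum_insert hv,
        hx v (Finset.mem_insert_self v s), sub_self, zero_add] at h2
      rw [← h2]
      exact Finset.sum_congr rfl fun w hw => by
        rw [hx w (Finset.mem_insert_of_mem hw), sub_smul]
    have h3 : ∀ w ∈ s, x w = 0 := by
      intro w hw
      have h4 := ih (fun w => ((w : ℝ) - v) • x w) (fun w hw => by
        rw [map_smul, hx w (Finset.mem_insert_of_mem hw), smul_comm]) h1 w hw
      refine (smul_eq_zero.1 h4).resolve_left ?_
      refine sub_ne_zero.2 ?_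
      exact_mod_cast fun h : w = v => hv (h ▸ hw)
    intro w hw
    rcases Finset.mem_insert.1 hw with rfl | hw
    · rwa [Finset.sum_insert hv, Finset.sum_eq_zero h3, add_zero] at hs
    · exact h3 w hw

/-- Form degree, antighost number and number of generators other than `dx^μ`. -/
def trideg (g : Gen n ι γ κ) : (ℤ × ℤ) × ℕ := (bideg g, jetWt g)

theorem sum_trideg (l : List (Gen n ι γ κ)) :
    (l.map trideg).sum = ((l.map bideg).sum, (l.map jetWt).sum) := by
  induction l with
  | nil => rfl
  | cons g l ih => simp [ih, trideg]

theorem countOp_of_mem_gspan {p k : ℤ} {w : ℕ} {a : Form n ι γ κ}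
    (ha : a ∈ gspan Set.univ trideg {((p, k), w)}) : countOp a = (w : ℝ) • a := by
  have h : a ∈ LinearMap.ker (countOp -
      (w : ℝ) • (LinearMap.id : Module.End ℝ (Form n ι γ κ))) := by
    refine mspan_le (fun f l hl => ?_) ha
    rw [LinearMap.mem_ker, LinearMap.sub_apply, sub_eq_zero,
      countOp_isEvenDer.map_mon countOp_ofFun (w := fun g => (jetWt g : ℝ)) countOp_gen f l]
    have h2 := hl.2
    rw [sum_trideg, Set.mem_singleton_iff, Prod.mk.injEq] at h2
    rw [← h2.2]
    congr 1
    rw [Nat.cast_list_sum, List.map_map]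
    rfl
  rw [LinearMap.mem_ker, LinearMap.sub_apply, sub_eq_zero] at h
  exact h

theorem trideg_gspan_le_forms (p k : ℤ) (w : ℕ) :
    (gspan Set.univ trideg {((p, k), w)} : Submodule ℝ (Form n ι γ κ)) ≤ forms n ι γ κ p k := by
  rw [forms_eq_gspan]
  refine mspan_mono fun l hl => ⟨hl.1, ?_⟩
  have h2 := hl.2
  rw [sum_trideg, Set.mem_singleton_iff, Prod.mk.injEq] at h2
  exact h2.1

/-- Closed forms of degree less than `n` are exact up to a closed form that depends on neither
ghosts nor antifields. -/
theorem exists_eq_add_extD {p k : ℤ} (hp : p < n) {a : Form n ι γ κ}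
    (ha : a ∈ forms n ι γ κ p k) (hd : extD a = 0) :
    ∃ a₀ ∈ (gspan Set.univ trideg {((p, k), 0)} : Submodule ℝ (Form n ι γ κ)), extD a₀ = 0 ∧
      ∃ c ∈ forms n ι γ κ (p - 1) k, a = a₀ + extD c := by
  classical
  have h1 : forms n ι γ κ p k ≤ ⨆ w : ℕ, gspan Set.univ trideg {((p, k), w)} := by
    rw [forms_eq_gspan]
    refine mspan_le fun f l hl => ?_
    refine Submodule.mem_iSup_of_mem (l.map jetWt).sum (ofFun_mul_mon_mem ⟨hl.1, ?_⟩ f)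
    rw [sum_trideg, hl.2]
    rfl
  obtain ⟨x, hx, hsum⟩ := (Submodule.mem_iSup_iff_exists_finsupp _ _).1 (h1 ha)
  have hclosed : ∀ w ∈ x.support, extD (x w) = 0 := by
    refine eq_zero_of_sum_eigenvectors countOp _ (fun w => extD (x w)) (fun w _ => ?_) ?_
    · rw [countOp_extD, countOp_of_mem_gspan (hx w), map_smul]
    · rw [← map_sum]
      exact (congrArg extD hsum).trans hd
  have hex : ∀ w, ∃ c ∈ forms n ι γ κ (p - 1) k, w ∈ x.support → w ≠ 0 → extD c = x w := by
    intro w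
    by_cases hw : w ∈ x.support ∧ w ≠ 0
    · obtain ⟨c, hc, hcd⟩ := exact_of_closed_of_countOp hp (w := w)
        (by exact_mod_cast Nat.pos_of_ne_zero hw.2) (trideg_gspan_le_forms p k w (hx w))
        (hclosed w hw.1) (countOp_of_mem_gspan (hx w))
      exact ⟨c, hc, fun _ _ => hcd⟩
    · exact ⟨0, zero_mem _, fun h h' => absurd ⟨h, h'⟩ hw⟩
  choose c hc hcd using hex
  refine ⟨x 0, hx 0, ?_, ∑ w ∈ x.support.erase 0, c w, sum_mem fun w _ => hc w, ?_⟩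
  · by_cases h : 0 ∈ x.support
    · exact hclosed 0 h
    · rw [Finsupp.notMem_support_iff.1 h, map_zero]
  · rw [map_sum, ← hsum, Finsupp.sum, Finset.sum_congr rfl fun w hw => hcd w
      (Finset.mem_of_mem_erase hw) (Finset.ne_of_mem_erase hw)]
    by_cases h : 0 ∈ x.support
    · rw [Finset.add_sum_erase _ _ h]
    · rw [Finset.erase_eq_of_notMem h, Finsupp.notMem_support_iff.1 h, zero_add]

theorem antigh_eq_zero_of_jetWt {g : Gen n ι γ κ} (h : jetWt g = 0) : antigh g = 0 := by
  rcases g with (_ | _ | _ | _) | (_ | _) <;> simp_all [jetWt, antigh]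

/-- The algebraic Poincaré lemma in positive antighost number. -/
theorem poincare_of_pos {p k : ℤ} (hp : p < n) (hk : 0 < k) {a : Form n ι γ κ}
    (ha : a ∈ forms n ι γ κ p k) (hd : extD a = 0) :
    ∃ c ∈ forms n ι γ κ (p - 1) k, a = extD c := by
  obtain ⟨a₀, h₀, -, c, hc, rfl⟩ := exists_eq_add_extD hp ha hd
  have h : (gspan Set.univ trideg {((p, k), 0)} : Submodule ℝ (Form n ι γ κ)) ≤ ⊥ := by
    refine mspan_le fun f l hl => ?_
    exfalso
    have h2 := hl.2
    rw [sum_trideg, Set.mem_singleton_iff, Prod.mk.injEq, List.sum_eq_zero_iff] at h2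
    have h3 : ((l.map bideg).sum).2 = 0 := by
      have h4 := h2.2
      clear h2 hl
      induction l with
      | nil => rfl
      | cons g l ih =>
        simp only [List.map_cons, List.mem_cons, forall_eq_or_imp] at h4
        rw [List.map_cons, List.sum_cons, Prod.snd_add, ih h4.2]
        simp [bideg, antigh_eq_zero_of_jetWt h4.1]
    rw [h2.1] at h3
    simp at h3
    omega
  exact ⟨c, hc, by rw [(Submodule.mem_bot ℝ).1 (h h₀), zero_add]⟩

end Lowering

/-! ### The vertical derivative and the integration over the fibres -/

section Vertical

variable {n : ℕ} {ι γ κ : Type*}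

theorem IsDer.sumMap {G : Type*} {σ : Form n ι γ κ →ₐ[ℝ] Form n ι γ κ}
    {V : G → Form n ι γ κ →ₗ[ℝ] Form n ι γ κ} (hfin : ∀ a, {g | V g a ≠ 0}.Finite)
    (hV : ∀ g, IsDer σ (V g)) : IsDer σ (sumMap V hfin) := by
  intro a b
  change ∑ᶠ g, V g (a * b) = a * ∑ᶠ g, V g b + (∑ᶠ g, V g a) * σ b
  rw [mul_finsum' _ _ (hfin b), finsum_mul' _ _ (hfin a), ← finsum_add_distrib]
  · exact finsum_congr fun g => hV g a b
  · exact (hfin b).subset fun g hg h => hg (by simp only [h, mul_zero])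
  · exact (hfin a).subset fun g hg h => hg (by simp only [h, zero_mul])

theorem coeffOp_pder_finite (a : Form n ι γ κ) : {c | coeffOp (pder c) a ≠ 0}.Finite := by
  induction a using tens_induction with
  | h0 => simp
  | ht f b =>
    refine (pder_finite f).subset fun c hc h => hc ?_
    rw [coeffOp_tens, h]
    exact TensorProduct.zero_tmul _ _
  | hadd a b ha hb =>
    refine (ha.union hb).subset fun c hc => ?_
    by_contra h
    simp only [Set.mem_union, Set.mem_ofPred_eq, not_or, not_not] at h
    exact hc (by rw [map_add, h.1, h.2, add_zero])

/-- The antifield that plays the role of the vertical differential of a jet coordinate. -/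
def vertGen : Coord n ι → Form n ι γ κ
  | Sum.inl _ => 0
  | Sum.inr e => gen (Sum.inl (OddGen.afField e.1 e.2))

/-- The vertical derivative of local forms, with the antifields `∂_I φ*_i` in the role of the
vertical differentials of the jet coordinates `∂_I φ^i`. -/
def vertD : Form n ι γ κ →ₗ[ℝ] Form n ι γ κ :=
  sumMap (fun c => (LinearMap.mulRight ℝ (vertGen c)).comp (coeffOp (pder c))) (fun a =>
    (coeffOp_pder_finite a).subset fun c hc h0 => hc (by
      simp only [LinearMap.comp_apply, h0, map_zero]))

theorem mul_vertGen (a : Form n ι γ κ) (c : Coord n ι) :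
    a * vertGen c = vertGen c * par a := by
  rcases c with ν | e
  · simp [vertGen]
  · rw [vertGen, inl_mul, par_par]

theorem vertD_isOddDer : IsOddDer (vertD : Form n ι γ κ →ₗ[ℝ] Form n ι γ κ) := by
  refine IsDer.sumMap _ fun c a b => ?_
  simp only [LinearMap.comp_apply, LinearMap.mulRight_apply,
    coeffOp_isEvenDer (fun f g => pder_mul c f g) a b, AlgHom.id_apply, add_mul, mul_assoc]
  rw [mul_vertGen b c]

theorem vertD_tens {f : LocFun n ι} {S : Finset (Coord n ι)} (hS : ∀ c, c ∉ S → pder c f = 0)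
    (l : List (Gen n ι γ κ)) :
    vertD (ofFun f * mon l) = ∑ c ∈ S, ofFun (pder c f) * mon l * vertGen c := by
  have h : vertD (ofFun f * mon l : Form n ι γ κ) =
      ∑ᶠ c, coeffOp (pder c) (ofFun f * mon l) * vertGen c := rfl
  rw [h, finsum_eq_sum_of_support_subset (s := S)]
  · exact Finset.sum_congr rfl fun c _ => by rw [coeffOp_mon]
  · intro c hc
    by_contra h'
    exact hc (by simp only [coeffOp_mon, hS c h', ofFun_zero, zero_mul])

theorem vertD_ofFun {f : LocFun n ι} {S : Finset (Coord n ι)} (hS : ∀ c, c ∉ S → pder c f = 0) :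
    vertD (ofFun f : Form n ι γ κ) = ∑ c ∈ S, ofFun (pder c f) * vertGen c := by
  simpa [mon_nil] using vertD_tens (γ := γ) (κ := κ) hS []

theorem vertD_one : vertD (1 : Form n ι γ κ) = 0 := by
  rw [← ofFun_one, vertD_ofFun (S := ∅) (fun c _ => pder_one c), Finset.sum_empty]

theorem vertD_gen (g : Gen n ι γ κ) : vertD (gen g) = 0 := by
  have := vertD_tens (f := (1 : LocFun n ι)) (S := ∅) (fun c _ => pder_one c) [g]
  simpa [mon_singleton, ofFun_one] using this

theorem vertD_coord (c : Coord n ι) : vertD (ofFun (coord c) : Form n ι γ κ) = vertGen c := by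
  classical
  rw [vertD_ofFun (S := {c}) (fun c' hc' => by rw [pder_coord, if_neg (by simpa using hc')]),
    Finset.sum_singleton, pder_coord, if_pos rfl, ofFun_one, one_mul]

theorem vertD_coordShift (μ : Fin n) (c : Coord n ι) :
    vertD (ofFun (coordShift μ c) : Form n ι γ κ) = totD μ (vertGen c) := by
  rcases c with ν | ⟨i, I⟩
  · simp only [coordShift, vertGen, map_zero]
    split_ifs
    · rw [ofFun_one, vertD_one]
    · rw [ofFun_zero, map_zero]
  · rw [coordShift, vertD_coord, vertGen, vertGen, totD_gen, genShift]

theorem vertD_totD (μ : Fin n) (a : Form n ι γ κ) : vertD (totD μ a) = totD μ (vertD a) := by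
  have h := (vertD_isOddDer.commutator (totD_isEvenDer (ι := ι) (γ := γ) (κ := κ) μ)
    (totD_par μ)).ext IsDer.zero (fun f => by
      obtain ⟨S, hS⟩ := exists_pder_support f
      have hS' : ∀ c c', c' ∉ S → pder c' (pder c f) = 0 := fun c c' h => by
        rw [pder_comm, hS c' h, map_zero]
      simp only [LinearMap.sub_apply, LinearMap.comp_apply, LinearMap.zero_apply, sub_eq_zero]
      rw [totD_ofFun, vertD_ofFun hS, locD_eq_sum μ hS, ofFun_sum, map_sum, map_sum]
      simp only [ofFun_mul, vertD_isOddDer _ _, totD_mul, totD_ofFun, vertD_coordShift,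
        Finset.sum_add_distrib, par_ofFun]
      congr 1
      simp only [vertD_ofFun (hS' _), locD_eq_sum μ (hS' _), ofFun_sum, Finset.sum_mul]
      rw [Finset.sum_comm]
      refine Finset.sum_congr rfl fun c _ => Finset.sum_congr rfl fun c' _ => ?_
      rw [ofFun_mul, pder_comm, mul_assoc, mul_assoc, ofFun_mul_comm (coordShift μ c')])
      (fun g => by
      simp only [LinearMap.sub_apply, LinearMap.comp_apply, vertD_gen, totD_gen, map_zero, sub_zero]
      rcases g with (ρ | ⟨α, I⟩ | ⟨i, I⟩ | ⟨Δ, I⟩) | (⟨Δ, I⟩ | ⟨α, I⟩) <;>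
        simp [genShift, vertD_gen]) a
  simpa [sub_eq_zero] using h

theorem vertD_extD (a : Form n ι γ κ) : vertD (extD a) = -extD (vertD a) := by
  simp only [extD_apply, map_sum, vertD_isOddDer _ _, vertD_gen, par_gen, psign, vertD_totD]
  simp

/-- The components of the odd vector field that maps the antifields `∂_I φ*_i` to `∂_I φ^i`. -/
def afToFieldVec : Gen n ι γ κ → Form n ι γ κ
  | Sum.inl (OddGen.afField i I) => ofFun (coord (Sum.inr (i, I)))
  | _ => 0

/-- The operator that replaces the antifields `∂_I φ*_i` by `∂_I φ^i`, one at a time. -/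
def afToField : Form n ι γ κ →ₗ[ℝ] Form n ι γ κ := vecField afToFieldVec

theorem par_afToFieldVec (g : Gen n ι γ κ) :
    par (afToFieldVec g) = -(psign g • afToFieldVec g) := by
  rcases g with (ρ | ⟨α, I⟩ | ⟨i, I⟩ | ⟨Δ, I⟩) | (⟨Δ, I⟩ | ⟨α, I⟩) <;>
    simp [psign, par_ofFun, afToFieldVec]

theorem afToField_isOddDer : IsOddDer (afToField : Form n ι γ κ →ₗ[ℝ] Form n ι γ κ) :=
  vecField_isOddDer par_afToFieldVec

theorem afToField_ofFun (f : LocFun n ι) : afToField (ofFun f : Form n ι γ κ) = 0 :=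
  vecField_ofFun _ f

theorem afToField_gen (g : Gen n ι γ κ) : afToField (gen g) = (match g with
    | Sum.inl (OddGen.afField i I) => ofFun (coord (Sum.inr (i, I)))
    | _ => 0 : Form n ι γ κ) := by
  rw [afToField, vecField_gen]
  rcases g with (_ | _ | _ | _) | (_ | _) <;> rfl

theorem afToField_totD (μ : Fin n) (a : Form n ι γ κ) :
    afToField (totD μ a) = totD μ (afToField a) := by
  have h := (afToField_isOddDer.commutator (totD_isEvenDer (ι := ι) (γ := γ) (κ := κ) μ)
    (totD_par μ)).ext IsDer.zero (fun f => by
      simp [totD_ofFun, afToField_ofFun]) (fun g => by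
      rcases g with (ρ | ⟨α, I⟩ | ⟨i, I⟩ | ⟨Δ, I⟩) | (⟨Δ, I⟩ | ⟨α, I⟩) <;>
        simp [genShift, afToField_gen, totD_gen, totD_ofFun, locD_coord, coordShift]) a
  simpa [sub_eq_zero] using h

theorem scaleInt_locD (m : ℕ) (μ : Fin n) (f : LocFun n ι) :
    scaleInt (Set.range Sum.inr) m (locD μ f) = locD μ (scaleInt (Set.range Sum.inr) m f) := by
  classical
  obtain ⟨S, hS⟩ := exists_pder_support f
  rw [locD_eq_sum μ hS, locD_eq_sum (S := S) μ (fun c hc => by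
    rw [pder_scaleInt, hS c hc, map_zero]), map_sum]
  refine Finset.sum_congr rfl fun c _ => ?_
  rw [pder_scaleInt]
  rcases c with ν | ⟨i, I⟩
  · rw [if_neg (by simp), coordShift]
    split_ifs
    · rw [mul_one, mul_one]
    · rw [mul_zero, mul_zero, map_zero]
  · rw [if_pos (Set.mem_range_self _), coordShift,
      scaleInt_mul_coord_of_mem (Set.mem_range_self _)]

theorem coeffOp_vecField_genShift (q : Module.End ℝ (LocFun n ι)) (μ : Fin n) (a : Form n ι γ κ) :
    coeffOp q (vecField (genShift μ) a) = vecField (genShift μ) (coeffOp q a) := by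
  obtain ⟨S, hS⟩ := exists_rder_support a
  rw [vecField_eq_sum _ hS, vecField_eq_sum (S := S) _ (fun g hg => by
    rw [← coeffOp_rder, hS g hg, map_zero]), map_sum]
  refine Finset.sum_congr rfl fun g _ => ?_
  rw [← coeffOp_rder]
  rcases g with (ρ | ⟨α, I⟩ | ⟨i, I⟩ | ⟨Δ, I⟩) | (⟨Δ, I⟩ | ⟨α, I⟩) <;>
    simp [genShift, coeffOp_mul_gen]

theorem coeffOp_totD {q : Module.End ℝ (LocFun n ι)} {μ : Fin n}
    (hq : ∀ f, q (locD μ f) = locD μ (q f)) (a : Form n ι γ κ) :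
    coeffOp q (totD μ a) = totD μ (coeffOp q a) := by
  rw [totD, LinearMap.add_apply, LinearMap.add_apply, map_add, coeffOp_vecField_genShift, coeffD_eq]
  congr 1
  exact form_hom_ext (S := coeffOp q ∘ₗ coeffOp (locD μ)) (T := coeffOp (locD μ) ∘ₗ coeffOp q)
    (fun f b => by simp only [LinearMap.comp_apply, coeffOp_tens, hq]) a

/-- The integral over the fibres that inverts the vertical derivative. -/
def fiberInt : Form n ι γ κ →ₗ[ℝ] Form n ι γ κ :=
  afToField ∘ₗ coeffOp (scaleInt (Set.range Sum.inr) 0)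

theorem fiberInt_extD (a : Form n ι γ κ) : fiberInt (extD a) = -extD (fiberInt a) := by
  simp only [fiberInt, LinearMap.comp_apply, extD_apply, map_sum, coeffOp_mul_gen,
    coeffOp_totD (scaleInt_locD 0 _), afToField_isOddDer _ _, afToField_gen, par_gen, psign,
    afToField_totD]
  simp

theorem jetWt_eq_zero_of_hasWeight {p k : ℤ} {l : List (Gen n ι γ κ)}
    (hl : HasWeight Set.univ trideg {((p, k), 0)} l) : ∀ g ∈ l, jetWt g = 0 := by
  have h2 := hl.2
  rw [sum_trideg, Set.mem_singleton_iff, Prod.mk.injEq, List.sum_eq_zero_iff] at h2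
  exact fun g hg => h2.2 _ (List.mem_map_of_mem hg)

theorem exists_dx_of_jetWt {g : Gen n ι γ κ} (hg : jetWt g = 0) :
    ∃ μ, g = Sum.inl (OddGen.dx μ) := by
  rcases g with (ρ | _ | _ | _) | (_ | _)
  · exact ⟨ρ, rfl⟩
  all_goals simp [jetWt] at hg

theorem afToField_ofFun_mul_mon {l : List (Gen n ι γ κ)} (hl : ∀ g ∈ l, jetWt g = 0)
    (f : LocFun n ι) : afToField (ofFun f * mon l : Form n ι γ κ) = 0 := by
  rw [← Submodule.mem_bot ℝ, afToField_isOddDer, afToField_ofFun, zero_mul, add_zero]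
  have h : afToField (mon l : Form n ι γ κ) ∈ (⊥ : Submodule ℝ (Form n ι γ κ)) := by
    refine afToField_isOddDer.map_mon_mem par_gen_exists ?_ l ?_
    · rw [← ofFun_one, afToField_ofFun]
    · rintro l₁ g l₂ rfl
      obtain ⟨μ, rfl⟩ := exists_dx_of_jetWt (hl g (by simp))
      simp [afToField_gen]
  rw [(Submodule.mem_bot ℝ).1 h, mul_zero]
  exact zero_mem _

theorem fiberInt_vertD {p k : ℤ} {a : Form n ι γ κ}
    (ha : a ∈ gspan Set.univ trideg {((p, k), 0)}) :
    fiberInt (vertD a) = a - coeffOp (restrictZero (Set.range Sum.inr)).toLinearMap a := by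
  classical
  have h : a ∈ LinearMap.ker (fiberInt ∘ₗ vertD - (LinearMap.id -
      coeffOp (restrictZero (Set.range Sum.inr)).toLinearMap) :
        Form n ι γ κ →ₗ[ℝ] Form n ι γ κ) := by
    refine mspan_le (fun f l hl => ?_) ha
    obtain ⟨S, hS⟩ := exists_dependsOn f
    have hl' := jetWt_eq_zero_of_hasWeight hl
    rw [LinearMap.mem_ker, LinearMap.sub_apply, LinearMap.sub_apply, sub_eq_zero,
      LinearMap.id_apply, coeffOp_mon, LinearMap.comp_apply, vertD_tens fun c hc =>
        pder_eq_zero_of_dependsOn hS hc,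
      ← sub_mul, AlgHom.toLinearMap_apply, ← ofFun_sub, ← sum_coord_mul_scaleInt _ hS, map_sum,
      ofFun_sum, Finset.sum_mul, Finset.sum_filter]
    refine Finset.sum_congr rfl fun c _ => ?_
    rcases c with ν | ⟨i, I⟩
    · simp [vertGen]
    · rw [if_pos (Set.mem_range_self _), fiberInt, LinearMap.comp_apply, vertGen, coeffOp_mul_gen,
        coeffOp_mon, afToField_isOddDer, afToField_ofFun_mul_mon hl', zero_mul, add_zero,
        afToField_gen, ofFun_mul, mul_assoc, ← ofFun_mul_comm]
      rw [← mul_assoc, ← ofFun_mul, ← ofFun_mul, mul_comm]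
  rw [LinearMap.mem_ker, LinearMap.sub_apply, sub_eq_zero] at h
  exact h

theorem fiberInt_mem {p : ℤ} {a : Form n ι γ κ} (ha : a ∈ forms n ι γ κ p 1) :
    fiberInt a ∈ forms n ι γ κ p 0 := by
  rw [forms_eq_gspan] at ha ⊢
  refine afToField_isOddDer.map_mem_gspan par_gen_exists afToField_ofFun (c := (0, -1))
    (fun g _ => ?_) (fun k hk => ?_) (coeffOp_mem _ ha)
  · rw [afToField_gen]
    rcases g with (ρ | ⟨α, I⟩ | ⟨i, I⟩ | ⟨Δ, I⟩) | (⟨Δ, I⟩ | ⟨α, I⟩)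
    case inl.afField =>
      exact mem_gspan_of_add_eq (by simp [bideg, formDeg, antigh]; rfl) (ofFun_mem_gspan _)
    all_goals exact zero_mem _
  · rw [Set.mem_singleton_iff] at hk ⊢
    rw [hk]
    simp

theorem vertD_mem {p : ℤ} {a : Form n ι γ κ} (ha : a ∈ forms n ι γ κ p 0) :
    vertD a ∈ forms n ι γ κ p 1 := by
  rw [forms_eq_gspan] at ha ⊢
  refine map_mspan (fun f l hl => ?_) ha
  obtain ⟨S, hS⟩ := exists_pder_support f
  rw [vertD_tens hS]
  refine sum_mem fun c _ => ?_
  rcases c with ν | ⟨i, I⟩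
  · simp [vertGen]
  · exact mem_gspan_of_add_eq (by simp) (mul_mem_gspan (wt := bideg) (k := (p, 0))
      (k' := (0, 1)) (ofFun_mul_mon_mem hl _)
      (gen_mem_gspan_of (g := Sum.inl (OddGen.afField i I)) (wt := bideg) (k := (0, 1))
        (Set.mem_univ _) rfl))

/-! ### The Poincaré lemma in antighost number zero -/

theorem coeffOp_extD {q q' : Module.End ℝ (LocFun n ι)} {a : Form n ι γ κ}
    (h : ∀ μ, totD μ (coeffOp q a) = coeffOp q' (totD μ a)) :
    extD (coeffOp q a) = coeffOp q' (extD a) := by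
  simp only [extD_apply, map_sum, coeffOp_mul_gen, h]

theorem totD_eq_of_jetWt {l : List (Gen n ι γ κ)} (hl : ∀ g ∈ l, jetWt g = 0) (μ : Fin n)
    (f : LocFun n ι) : totD μ (ofFun f * mon l : Form n ι γ κ) = ofFun (locD μ f) * mon l := by
  have h : totD μ (mon l : Form n ι γ κ) ∈ (⊥ : Submodule ℝ (Form n ι γ κ)) := by
    refine (totD_isEvenDer μ).map_mon_mem id_gen_exists (totD_isEvenDer μ).map_one l ?_
    rintro l₁ g l₂ rfl
    obtain ⟨μ, rfl⟩ := exists_dx_of_jetWt (hl g (by simp))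
    simp [totD_gen, genShift]
  rw [totD_mul, (Submodule.mem_bot ℝ).1 h, mul_zero, zero_add, totD_ofFun]

theorem locD_eq_of_pder {f : LocFun n ι} (hf : ∀ e, pder (Sum.inr e) f = 0) (μ : Fin n) :
    locD μ f = pder (Sum.inl μ) f := by
  classical
  rw [locD_eq_sum (S := Finset.univ.image Sum.inl) μ]
  · rw [Finset.sum_image Sum.inl_injective.injOn]
    simp [coordShift]
  · rintro (ν | e) hc
    · simp at hc
    · exact hf e

/-- The differential of the contraction of a closed form with the Euler vector field of
spacetime. -/
theorem extD_euler_contr {p k : ℤ} {z : Form n ι γ κ} (hz : z ∈ forms n ι γ κ p k)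
    (hd : extD z = 0) :
    extD (∑ ν, ofFun (coord (Sum.inl ν)) * contr ν z) =
      (p : ℝ) • z + ∑ ν, ofFun (coord (Sum.inl ν)) * totD ν z := by
  have h1 : ∀ ν, ∑ μ, contr ν (totD μ z) * dx μ = totD ν z := by
    intro ν
    have h := congrArg (contr ν) hd
    simp only [extD_apply, map_sum, contr_mul_dx, map_zero, Finset.sum_sub_distrib,
      Finset.sum_ite_eq, Finset.mem_univ, if_true, sub_eq_zero] at h
    exact h.symm
  have h2 : extD (∑ ν, ofFun (coord (Sum.inl ν)) * contr ν z) =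
      ∑ μ, contr μ z * dx μ +
        ∑ ν, ofFun (coord (Sum.inl ν)) * ∑ μ, contr ν (totD μ z) * dx μ := by
    have h3 : ∀ μ, totD μ (∑ ν, ofFun (coord (Sum.inl ν)) * contr ν z) =
        contr μ z + ∑ ν, ofFun (coord (Sum.inl ν)) * contr ν (totD μ z) := by
      intro μ
      have h4 : ∀ ν : Fin n, (ofFun (if ν = μ then 1 else 0) : Form n ι γ κ) =
          if ν = μ then 1 else 0 := fun ν => by split_ifs <;> simp [ofFun_one, ofFun_zero]
      simp only [map_sum, totD_mul, totD_ofFun, locD_coord, coordShift, Finset.sum_add_distrib,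
        contr_totD, h4, ite_mul, one_mul, zero_mul, Finset.sum_ite_eq', Finset.mem_univ, if_true]
      rw [add_comm]
    rw [extD_apply]
    simp only [h3, add_mul, Finset.sum_add_distrib, Finset.sum_mul, Finset.mul_sum, mul_assoc]
    rw [Finset.sum_comm (f := fun ν μ => ofFun (coord (Sum.inl ν)) * (contr ν (totD μ z) * dx μ))]
  rw [h2, sum_contr_mul_dx hz]
  simp only [h1]

/-- The span of the monomials in the `dx^μ` of degree `p`, with functions on spacetime as
coefficients. -/
def baseForms (n : ℕ) (ι γ κ : Type*) (p : ℤ) : Submodule ℝ (Form n ι γ κ) :=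
  Submodule.span ℝ {a | ∃ (f : LocFun n ι) (l : List (Gen n ι γ κ)),
    (∀ e, pder (Sum.inr e) f = 0) ∧ HasWeight Set.univ trideg {((p, 0), 0)} l ∧
      a = ofFun f * mon l}

theorem baseForms_ext {p : ℤ} {V W : Form n ι γ κ →ₗ[ℝ] Form n ι γ κ}
    (h : ∀ f l, (∀ e, pder (Sum.inr e) f = 0) → (∀ g ∈ l, jetWt g = 0) →
      V (ofFun f * mon l) = W (ofFun f * mon l)) {a : Form n ι γ κ}
    (ha : a ∈ baseForms n ι γ κ p) : V a = W a := by
  have h1 : a ∈ LinearMap.ker (V - W) := by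
    refine Submodule.span_le.2 ?_ ha
    rintro _ ⟨f, l, hf, hl, rfl⟩
    rw [SetLike.mem_coe, LinearMap.mem_ker, LinearMap.sub_apply, sub_eq_zero]
    exact h f l hf (jetWt_eq_zero_of_hasWeight hl)
  rwa [LinearMap.mem_ker, LinearMap.sub_apply, sub_eq_zero] at h1

theorem baseForms_le (p : ℤ) : baseForms n ι γ κ p ≤ gspan Set.univ trideg {((p, 0), 0)} :=
  Submodule.span_le.2 (by rintro _ ⟨f, l, -, hl, rfl⟩; exact ofFun_mul_mon_mem hl f)

theorem coeffOp_scaleInt_mem_baseForms {p : ℤ} (m : ℕ) {a : Form n ι γ κ}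
    (ha : a ∈ baseForms n ι γ κ p) : coeffOp (scaleInt Set.univ m) a ∈ baseForms n ι γ κ p := by
  classical
  have h : baseForms n ι γ κ p ≤ (baseForms n ι γ κ p).comap (coeffOp (scaleInt Set.univ m)) := by
    refine Submodule.span_le.2 ?_
    rintro _ ⟨f, l, hf, hl, rfl⟩
    rw [SetLike.mem_coe, Submodule.mem_comap, coeffOp_mon]
    exact Submodule.subset_span ⟨_, l, fun e => by rw [pder_scaleInt, hf, map_zero], hl, rfl⟩
  exact h ha

theorem totD_coeffOp_scaleInt {p : ℤ} (m : ℕ) (μ : Fin n) {a : Form n ι γ κ}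
    (ha : a ∈ baseForms n ι γ κ p) :
    totD μ (coeffOp (scaleInt Set.univ m) a) = coeffOp (scaleInt Set.univ (m + 1)) (totD μ a) := by
  classical
  refine baseForms_ext (V := totD μ ∘ₗ coeffOp (scaleInt Set.univ m))
    (W := coeffOp (scaleInt Set.univ (m + 1)) ∘ₗ totD μ) (fun f l hf hl => ?_) ha
  rw [LinearMap.comp_apply, LinearMap.comp_apply, coeffOp_mon, totD_eq_of_jetWt hl,
    totD_eq_of_jetWt hl, coeffOp_mon, locD_eq_of_pder hf, locD_eq_of_pder fun e => by
      rw [pder_scaleInt, hf, map_zero], pder_scaleInt, if_pos (Set.mem_univ _)]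

theorem smul_scaleInt_add_euler {p : ℤ} (m : ℕ) {a : Form n ι γ κ}
    (ha : a ∈ baseForms n ι γ κ p) :
    ((m : ℝ) + 1) • coeffOp (scaleInt Set.univ m) a +
      ∑ ν, ofFun (coord (Sum.inl ν)) * coeffOp (scaleInt Set.univ (m + 1)) (totD ν a) = a := by
  classical
  have h := baseForms_ext (p := p) (V := ((m : ℝ) + 1) • coeffOp (scaleInt Set.univ m) +
    ∑ ν : Fin n, LinearMap.mulLeft ℝ (ofFun (coord (Sum.inl ν))) ∘ₗ
      coeffOp (scaleInt Set.univ (m + 1)) ∘ₗ totD ν) (W := LinearMap.id) (fun f l hf hl => ?_) ha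
  · simpa using h
  · obtain ⟨S, hS⟩ := exists_dependsOn f
    have h1 := smul_scaleInt_add_sum Set.univ m
      (hS.mono (T := S ∪ Finset.univ.image Sum.inl) Finset.subset_union_left)
    simp only [Set.mem_univ, Finset.filter_true] at h1
    have h2 : ∑ c ∈ S ∪ Finset.univ.image Sum.inl,
        coord c * scaleInt Set.univ (m + 1) (pder c f) =
        ∑ ν : Fin n, coord (Sum.inl ν) * scaleInt Set.univ (m + 1) (pder (Sum.inl ν) f) := by
      rw [← Finset.sum_image (s := Finset.univ) (g := Sum.inl)
        (f := fun c => coord c * scaleInt Set.univ (m + 1) (pder c f)) Sum.inl_injective.injOn]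
      refine (Finset.sum_subset ?_ ?_).symm
      · intro c hc
        exact Finset.mem_union_right _ hc
      · rintro (ν | e) _ hc
        · simp at hc
        · rw [hf, map_zero, mul_zero]
    rw [h2] at h1
    simp only [LinearMap.add_apply, LinearMap.smul_apply, LinearMap.sum_apply, LinearMap.comp_apply,
      LinearMap.mulLeft_apply, LinearMap.id_apply, totD_eq_of_jetWt hl, locD_eq_of_pder hf,
      coeffOp_mon, ← mul_assoc, ← ofFun_mul, ← Finset.sum_mul, ← smul_mul_assoc, ← ofFun_smul,
      ← ofFun_sum, ← add_mul, ← ofFun_add]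
    rw [h1]

theorem exact_of_mem_baseForms {p : ℤ} (hp : 1 ≤ p) {z : Form n ι γ κ}
    (hz : z ∈ baseForms n ι γ κ p) (hd : extD z = 0) :
    ∃ c ∈ forms n ι γ κ (p - 1) 0, z = extD c := by
  obtain ⟨m, rfl⟩ : ∃ m : ℕ, p = m + 1 := ⟨(p - 1).toNat, by omega⟩
  have hz' := coeffOp_scaleInt_mem_baseForms m hz
  have hf : ∀ {a : Form n ι γ κ}, a ∈ baseForms n ι γ κ ((m : ℤ) + 1) →
      a ∈ forms n ι γ κ ((m : ℤ) + 1) 0 := fun ha =>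
    trideg_gspan_le_forms _ _ _ (baseForms_le _ ha)
  have hd' : extD (coeffOp (scaleInt Set.univ m) z) = 0 := by
    rw [coeffOp_extD fun μ => totD_coeffOp_scaleInt m μ hz, hd, map_zero]
  refine ⟨∑ ν, ofFun (coord (Sum.inl ν)) * contr ν (coeffOp (scaleInt Set.univ m) z),
    sum_mem fun ν _ => ?_, ?_⟩
  · have h := contr_mem (hf hz') ν
    rw [forms_eq_gspan] at h ⊢
    exact ofFun_mul_mem _ h
  · rw [extD_euler_contr (hf hz') hd']
    simp only [totD_coeffOp_scaleInt m _ hz]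
    have := smul_scaleInt_add_euler m hz
    push_cast
    exact this.symm

theorem restrict_mem_baseForms {p : ℤ} {a : Form n ι γ κ}
    (ha : a ∈ gspan Set.univ trideg {((p, 0), 0)}) :
    coeffOp (restrictZero (Set.range Sum.inr)).toLinearMap a ∈ baseForms n ι γ κ p := by
  refine map_mspan (fun f l hl => ?_) ha
  rw [coeffOp_mon]
  exact Submodule.subset_span ⟨_, l, fun e => pder_restrictZero (Set.mem_range_self e) f, hl, rfl⟩

/-- A closed form without ghosts and antifields is, up to an exact form, its restriction to the zero
section of the jet space: its vertical derivative is closed of antighost number one, hence exact,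
and the integral over the fibres takes it back. -/
theorem exists_sub_restrict_eq {p : ℤ} (hp : p < n) {a : Form n ι γ κ}
    (ha : a ∈ gspan Set.univ trideg {((p, 0), 0)}) (hd : extD a = 0) :
    ∃ c ∈ forms n ι γ κ (p - 1) 0,
      a - coeffOp (restrictZero (Set.range Sum.inr)).toLinearMap a = extD c := by
  have ha' := trideg_gspan_le_forms _ _ _ ha
  obtain ⟨c, hc, h⟩ := poincare_of_pos hp one_pos (vertD_mem ha') (by
    rw [← neg_eq_zero, ← vertD_extD, hd, map_zero])
  refine ⟨-fiberInt c, neg_mem (fiberInt_mem hc), ?_⟩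
  rw [← fiberInt_vertD ha, h, fiberInt_extD, map_neg]

/-- The algebraic Poincaré lemma in antighost number zero and positive degree. -/
theorem poincare_zero {p : ℤ} (hp1 : 1 ≤ p) (hp : p < n) {a : Form n ι γ κ}
    (ha : a ∈ forms n ι γ κ p 0) (hd : extD a = 0) :
    ∃ c ∈ forms n ι γ κ (p - 1) 0, a = extD c := by
  obtain ⟨a₀, h₀, hd₀, c, hc, rfl⟩ := exists_eq_add_extD hp ha hd
  obtain ⟨c', hc', h'⟩ := exists_sub_restrict_eq hp h₀ hd₀
  obtain ⟨c'', hc'', h''⟩ := exact_of_mem_baseForms hp1 (restrict_mem_baseForms h₀) (by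
    have h3 := congrArg extD h'
    rw [map_sub, hd₀, extD_extD, zero_sub, neg_eq_zero] at h3
    exact h3)
  refine ⟨c' + c'' + c, add_mem (add_mem hc' hc'') hc, ?_⟩
  rw [map_add, map_add, ← h', ← h'', sub_add_cancel]

theorem eq_ofFun_of_mem {a : Form n ι γ κ}
    (ha : a ∈ gspan Set.univ trideg {(((0 : ℤ), (0 : ℤ)), 0)}) :
    ∃ f, a = ofFun f := by
  have h : a ∈ LinearMap.range (ofFunHom n ι γ κ).toLinearMap := by
    refine mspan_le (fun f l hl => ?_) ha
    have h1 := jetWt_eq_zero_of_hasWeight hl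
    have h2 := hl.2
    rw [sum_trideg] at h2
    cases l with
    | nil => exact ⟨f, by rw [mon_nil, mul_one]; rfl⟩
    | cons g l =>
      exfalso
      have h3 : ∀ l : List (Gen n ι γ κ), (∀ g ∈ l, jetWt g = 0) →
          ((l.map bideg).sum).1 = l.length := by
        intro l hl
        induction l with
        | nil => rfl
        | cons g l ih =>
          obtain ⟨μ, rfl⟩ := exists_dx_of_jetWt (hl g (by simp))
          rw [List.map_cons, List.sum_cons, Prod.fst_add, ih fun g hg => hl g (by simp [hg])]
          simp [bideg, formDeg, add_comm]
      have h4 := h3 _ h1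
      rw [Set.mem_singleton_iff, Prod.mk.injEq] at h2
      rw [h2.1, List.length_cons] at h4
      push_cast at h4
      omega
  obtain ⟨f, rfl⟩ := h
  exact ⟨f, rfl⟩

theorem ofFun_injective : Function.Injective (ofFun : LocFun n ι → Form n ι γ κ) := by
  intro f g h
  refine locFun_ext fun u => ?_
  rw [← evalAt_ofFun (γ := γ) (κ := κ) u f, h, evalAt_ofFun]

/-- Closed local functions are constant. They equal their restriction to the zero section, since the
exact form by which the two differ has degree `-1`, and their spacetime derivatives vanish. -/
theorem poincare_const (hn : 0 < n) {a : Form n ι γ κ} (ha : a ∈ forms n ι γ κ 0 0)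
    (hd : extD a = 0) : ∃ r : ℝ, a = r • 1 := by
  classical
  have hbot : ∀ c ∈ forms n ι γ κ (0 - 1) 0, c = 0 := fun c hc => by
    rwa [forms_eq_bot_of_neg (by norm_num), Submodule.mem_bot] at hc
  obtain ⟨a₀, h₀, hd₀, c, hc, rfl⟩ := exists_eq_add_extD (by exact_mod_cast hn) ha hd
  obtain ⟨c', hc', h'⟩ := exists_sub_restrict_eq (by exact_mod_cast hn) h₀ hd₀
  rw [hbot c hc, map_zero, add_zero]
  rw [hbot c' hc', map_zero, sub_eq_zero] at h'
  obtain ⟨f, rfl⟩ := eq_ofFun_of_mem h₀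
  rw [coeffOp_ofFun] at h'
  have hf := ofFun_injective h'
  have hv : ∀ e, pder (Sum.inr e) f = 0 := fun e => by
    rw [hf]
    exact pder_restrictZero (Set.mem_range_self e) f
  have hh : ∀ ν, pder (Sum.inl ν) f = 0 := by
    intro ν
    have h := congrArg (contr ν) hd₀
    simp only [extD_apply, map_sum, contr_mul_dx, map_zero,
      Finset.sum_ite_eq, Finset.mem_univ, if_true, totD_ofFun, rder_ofFun, zero_mul,
      sub_zero] at h
    rw [← locD_eq_of_pder hv, ← ofFun_injective (h.trans ofFun_zero.symm)]
  obtain ⟨S, hS⟩ := exists_dependsOn f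
  have h1 := sum_coord_mul_scaleInt Set.univ hS
  rw [Finset.sum_eq_zero fun c _ => by
    rcases c with ν | e
    · rw [hh, map_zero, mul_zero]
    · rw [hv, map_zero, mul_zero]] at h1
  refine ⟨evalFun 0 f, ?_⟩
  rw [← ofFun_one, ← ofFun_smul, sub_eq_zero.1 h1.symm]
  congr 1
  refine locFun_ext fun u => ?_
  rw [← evalFun_scaleAt_zero, map_smul, map_one, smul_eq_mul, mul_one,
    ← evalFun_scaleAt_zero]
  congr 2
  funext c
  simp [scaleAt]

end Vertical

/-! ### The Koszul-Tate differential -/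

section IteratedDerivatives

variable {n : ℕ}

theorem iterD_mem {A : Type*} [AddCommGroup A] [Module ℝ A] {D : Fin n → Module.End ℝ A}
    {N : Submodule ℝ A} (hD : ∀ μ, ∀ a ∈ N, D μ a ∈ N) (I : MI n) {a : A} (ha : a ∈ N) :
    iterD D I a ∈ N := by
  have hpow : ∀ μ (k : ℕ), ∀ a ∈ N, (D μ ^ k) a ∈ N := by
    intro μ k
    induction k with
    | zero => exact fun a ha => by simpa using ha
    | succ k ih => exact fun a ha => by rw [pow_succ']; exact hD μ _ (ih a ha)
  have key : ∀ l : List (Fin n), (l.map fun μ => D μ ^ I μ).prod a ∈ N := by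
    intro l
    induction l with
    | nil => simpa using ha
    | cons μ l ih => rw [List.map_cons, List.prod_cons]; exact hpow μ _ _ ih
  exact key _

theorem map_iterD {A B : Type*} [AddCommGroup A] [Module ℝ A] [AddCommGroup B] [Module ℝ B]
    {D : Fin n → Module.End ℝ A} {D' : Fin n → Module.End ℝ B} (V : A →ₗ[ℝ] B)
    (hV : ∀ μ a, V (D μ a) = D' μ (V a)) (I : MI n) (a : A) :
    V (iterD D I a) = iterD D' I (V a) := by
  have hpow : ∀ μ (k : ℕ) a, V ((D μ ^ k) a) = (D' μ ^ k) (V a) := by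
    intro μ k
    induction k with
    | zero => exact fun a => by simp
    | succ k ih =>
      intro a
      rw [pow_succ', pow_succ', Module.End.mul_apply, Module.End.mul_apply, hV, ih]
  have key : ∀ l : List (Fin n), V ((l.map fun μ => D μ ^ I μ).prod a) =
      (l.map fun μ => D' μ ^ I μ).prod (V a) := by
    intro l
    induction l with
    | nil => simp
    | cons μ l ih =>
      rw [List.map_cons, List.prod_cons, List.map_cons, List.prod_cons, Module.End.mul_apply,
        Module.End.mul_apply, hpow, ih]
  exact key _

variable {ι γ κ : Type*}

theorem iterD_totD_succ (I : MI n) (μ : Fin n) (a : Form n ι γ κ) :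
    iterD totD (I.succ μ) a = totD μ (iterD totD I a) := by
  rw [iterD_succ _ (fun μ ν => LinearMap.ext fun f => totD_comm μ ν f)]
  rfl

theorem iterD_totD_par (I : MI n) (a : Form n ι γ κ) :
    par (iterD totD I a) = iterD totD I (par a) :=
  map_iterD par.toLinearMap (fun μ a => (totD_par μ a).symm) I a

theorem iterD_totD_ofFun (I : MI n) (f : LocFun n ι) :
    iterD totD I (ofFun f : Form n ι γ κ) = ofFun (iterD locD I f) :=
  (map_iterD (ofFunHom n ι γ κ).toLinearMap (fun μ f => (totD_ofFun μ f).symm) I f).symm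

end IteratedDerivatives

namespace GaugeData

variable {n : ℕ} {ι γ κ : Type*} (T : GaugeData n ι γ κ)

theorem par_af (e : ι × MI n) : par (af e : Form n ι γ κ) = -af e := by
  rw [af, par_gen, psign, neg_one_smul]

theorem par_afG (g : γ × MI n) : par (afG g : Form n ι γ κ) = afG g := by
  rw [afG, par_gen, psign, one_smul]

theorem par_deltaGauge (α : γ) : par (T.deltaGauge α) = -T.deltaGauge α := by
  simp only [deltaGauge, Finsupp.sum, map_sum, map_smul, iterD_totD_par, map_mul, par_af, par_ofFun,
    neg_mul, map_neg, smul_neg, Finset.sum_neg_distrib]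

theorem par_deltaRed (Δ : κ) : par (T.deltaRed Δ) = T.deltaRed Δ := by
  simp only [deltaRed, Finsupp.sum, map_add, map_neg, map_sum, map_smul, iterD_totD_par, map_mul,
    par_af, par_afG, par_ofFun, neg_mul, mul_neg, neg_neg]

theorem par_deltaGen (g : Gen n ι γ κ) : par (T.deltaGen g) = -(psign g • T.deltaGen g) := by
  rcases g with (_ | _ | _ | _) | (_ | _) <;>
    simp [deltaGen, psign, par_ofFun, iterD_totD_par, par_deltaGauge, par_deltaRed]

theorem delta_isOddDer : IsOddDer T.delta := vecField_isOddDer T.par_deltaGen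

theorem delta_ofFun (f : LocFun n ι) : T.delta (ofFun f) = 0 := vecField_ofFun _ _

theorem delta_gen (g : Gen n ι γ κ) : T.delta (gen g) = T.deltaGen g := vecField_gen _ _

theorem delta_ofFun_mul (f : LocFun n ι) (a : Form n ι γ κ) :
    T.delta (ofFun f * a) = ofFun f * T.delta a := vecField_ofFun_mul _ _ _

theorem delta_par (a : Form n ι γ κ) : T.delta (par a) = -par (T.delta a) :=
  vecField_par_odd T.par_deltaGen a

theorem delta_genShift (μ : Fin n) (g : Gen n ι γ κ) :
    T.delta (genShift μ g) = totD μ (T.deltaGen g) := by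
  rcases g with (_ | _ | ⟨i, I⟩ | _) | (_ | _) <;>
    simp [genShift, delta_gen, deltaGen, iterD_totD_succ, eqn, iterD_locD_succ, totD_ofFun]

theorem delta_totD (μ : Fin n) (a : Form n ι γ κ) : T.delta (totD μ a) = totD μ (T.delta a) := by
  have h := (T.delta_isOddDer.commutator (totD_isEvenDer μ) (totD_par μ)).ext IsDer.zero
    (fun f => by simp [totD_ofFun, delta_ofFun])
    (fun g => by simp [totD_gen, delta_gen, delta_genShift]) a
  simpa [sub_eq_zero] using h

theorem delta_iterD (I : MI n) (a : Form n ι γ κ) :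
    T.delta (iterD totD I a) = iterD totD I (T.delta a) := map_iterD T.delta T.delta_totD I a

theorem delta_extD (a : Form n ι γ κ) : T.delta (extD a) = -extD (T.delta a) := by
  simp only [extD_apply, map_sum, ← Finset.sum_neg_distrib]
  refine Finset.sum_congr rfl fun μ _ => ?_
  rw [T.delta_isOddDer, delta_gen, deltaGen, mul_zero, zero_add, delta_totD, par_gen, psign,
    neg_one_smul, mul_neg]
  all_goals simp

/-! ### The linear expansions of the Noether identities and of the reducibility relations -/

/-- The Euler operator, which counts all generators. -/
theorem length_smul_eq_sum_rder {m : ℕ} {a : Form n ι γ κ}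
    (ha : a ∈ mspan (fun l : List (Gen n ι γ κ) => l.length = m)) {S : Finset (Gen n ι γ κ)}
    (hS : ∀ g, g ∉ S → rder g a = 0) : (m : ℝ) • a = ∑ g ∈ S, rder g a * gen g := by
  rw [← vecField_eq_sum gen hS]
  have hV : IsEvenDer (vecField gen : Form n ι γ κ →ₗ[ℝ] Form n ι γ κ) := vecField_isEvenDer par_gen
  have h : a ∈ LinearMap.ker ((m : ℝ) • LinearMap.id - vecField gen) := by
    refine mspan_le (fun f l hl => ?_) ha
    rw [LinearMap.mem_ker, LinearMap.sub_apply, hV.map_mon (vecField_ofFun _) (w := fun _ => 1)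
      (fun g => by rw [vecField_gen, one_smul])]
    simp [← hl]
  exact sub_eq_zero.1 h

theorem rder_mem_length {m : ℕ} {a : Form n ι γ κ}
    (ha : a ∈ mspan (fun l : List (Gen n ι γ κ) => l.length = m + 1)) (g : Gen n ι γ κ) :
    rder g a ∈ mspan (fun l : List (Gen n ι γ κ) => l.length = m) := by
  classical
  refine map_mspan (fun f l hl => ?_) ha
  rw [rder_ofFun_mul]
  refine ofFun_mul_mem f ?_
  clear ha
  induction l using List.reverseRecOn generalizing m with
  | nil => simp at hl
  | append_singleton l g' ih =>
    rw [mon_append, mon_singleton, rder_mul_gen]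
    simp only [List.length_append, List.length_singleton, add_left_inj] at hl
    refine add_mem ?_ (Submodule.smul_mem _ _ ?_)
    · split_ifs
      · exact mon_mem hl
      · exact zero_mem _
    · cases m with
      | zero =>
        rw [List.length_eq_zero_iff.1 hl, mon_nil, ← ofFun_one, rder_ofFun, zero_mul]
        exact zero_mem _
      | succ m =>
        exact mul_mem_mspan (p := fun l => l.length = m) (q := fun l => l.length = 1)
          (by simp +contextual) (ih hl)
          (gen_mem rfl)

theorem exists_eq_ofFun_of_length_zero {a : Form n ι γ κ}
    (ha : a ∈ mspan (fun l : List (Gen n ι γ κ) => l.length = 0)) : ∃ f, a = ofFun f := by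
  have h : a ∈ LinearMap.range (ofFunHom n ι γ κ).toLinearMap := by
    refine mspan_le (fun f l hl => ?_) ha
    rw [List.length_eq_zero_iff.1 hl, mon_nil, mul_one]
    exact ⟨f, rfl⟩
  obtain ⟨f, rfl⟩ := h
  exact ⟨f, rfl⟩

/-- The local forms that are linear in the generators and involve only those with property `A`. -/
abbrev linSpan (A : Gen n ι γ κ → Prop) : Submodule ℝ (Form n ι γ κ) :=
  mspan fun l => ∃ g, A g ∧ l = [g]

theorem totD_mem_linSpan {A : Gen n ι γ κ → Prop}
    (hA : ∀ μ g, A g → genShift μ g ∈ linSpan A) (μ : Fin n) {a : Form n ι γ κ}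
    (ha : a ∈ linSpan A) : totD μ a ∈ linSpan A := by
  refine map_mspan (fun f l hl => ?_) ha
  obtain ⟨g, hg, rfl⟩ := hl
  rw [mon_singleton, totD_mul, totD_gen, totD_ofFun]
  refine add_mem (ofFun_mul_mem f (hA μ g hg)) ?_
  rw [← mon_singleton]
  exact ofFun_mul_mon_mem ⟨g, hg, rfl⟩ _

theorem rder_linSpan {A : Gen n ι γ κ → Prop} {g : Gen n ι γ κ} (hg : ¬ A g) {a : Form n ι γ κ}
    (ha : a ∈ linSpan A) : rder g a = 0 := by
  classical
  rw [← Submodule.mem_bot ℝ]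
  refine map_mspan (fun f l hl => ?_) ha
  obtain ⟨g', hg', rfl⟩ := hl
  rw [mon_singleton, rder_ofFun_mul, rder_gen, if_neg (by rintro rfl; exact hg hg'), mul_zero]
  exact zero_mem _

/-- A form that is linear in the generators is determined by its coefficients. -/
theorem exists_eq_sum_of_linSpan {σ : Type*} {A : Gen n ι γ κ → Prop} {v : σ → Gen n ι γ κ}
    (hv : v.Injective) (hA : ∀ g, A g → ∃ x, g = v x) {a : Form n ι γ κ} (ha : a ∈ linSpan A)
    {S : Finset σ} (hS : ∀ x, x ∉ S → rder (v x) a = 0) :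
    ∃ f : σ → LocFun n ι, (∀ x, rder (v x) a = ofFun (f x)) ∧
      a = ∑ x ∈ S, ofFun (f x) * gen (v x) := by
  classical
  have ha' : a ∈ mspan (fun l : List (Gen n ι γ κ) => l.length = 0 + 1) :=
    mspan_mono (by rintro l ⟨g, -, rfl⟩; rfl) ha
  choose f hf using fun x => exists_eq_ofFun_of_length_zero (rder_mem_length ha' (v x))
  refine ⟨f, hf, ?_⟩
  have h := length_smul_eq_sum_rder ha' (S := S.image v) (fun g hg => by
    by_cases h : A g
    · obtain ⟨x, rfl⟩ := hA g h
      exact hS x fun hx => hg (Finset.mem_image_of_mem v hx)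
    · exact rder_linSpan h ha)
  rw [Finset.sum_image hv.injOn] at h
  simpa [hf] using h

theorem af_mul_mem (i : ι) (f : LocFun n ι) : (af (i, 0) * ofFun f : Form n ι γ κ) ∈
    linSpan (fun g => ∃ e : ι × MI n, g = Sum.inl (OddGen.afField e.1 e.2)) := by
  rw [← ofFun_mul_comm, af, ← mon_singleton]
  exact ofFun_mul_mon_mem ⟨_, ⟨(i, 0), rfl⟩, rfl⟩ f

theorem deltaGen_afGauge_mem (g : γ × MI n) :
    T.deltaGen (Sum.inr (EvenGen.afGauge g.1 g.2)) ∈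
      linSpan (fun g => ∃ e : ι × MI n, g = Sum.inl (OddGen.afField e.1 e.2)) := by
  have hD : ∀ (μ : Fin n), ∀ a ∈ linSpan (fun g : Gen n ι γ κ =>
      ∃ e : ι × MI n, g = Sum.inl (OddGen.afField e.1 e.2)), totD μ a ∈ linSpan (fun g =>
      ∃ e : ι × MI n, g = Sum.inl (OddGen.afField e.1 e.2)) := fun μ a ha =>
    totD_mem_linSpan (by
      rintro μ _ ⟨e, rfl⟩
      rw [genShift]
      exact gen_mem ⟨_, ⟨(e.1, e.2.succ μ), rfl⟩, rfl⟩) μ ha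
  refine iterD_mem hD _ (sum_mem fun e _ => Submodule.smul_mem _ _ (iterD_mem hD _ ?_))
  exact af_mul_mem _ _

/-- Monomials that are quadratic in the antifields `φ*` of the equations with property `p`. -/
abbrev quadSpan (p : ι × MI n → Prop) : Submodule ℝ (Form n ι γ κ) :=
  mspan fun l => ∃ e e' : ι × MI n, p e ∧ p e' ∧
    l = [Sum.inl (OddGen.afField e.1 e.2), Sum.inl (OddGen.afField e'.1 e'.2)]

theorem totD_mem_quadSpan (μ : Fin n) {a : Form n ι γ κ}
    (ha : a ∈ quadSpan fun _ : ι × MI n => True) :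
    totD μ a ∈ (quadSpan fun _ : ι × MI n => True : Submodule ℝ (Form n ι γ κ)) := by
  refine map_mspan (fun f l hl => ?_) ha
  obtain ⟨e, e', -, -, rfl⟩ := hl
  rw [totD_mul, totD_ofFun]
  refine add_mem (ofFun_mul_mem f ?_) (ofFun_mul_mon_mem ⟨e, e', trivial, trivial, rfl⟩ _)
  rw [mon_cons, mon_singleton, totD_mul, totD_gen, totD_gen, genShift, genShift]
  refine add_mem ?_ ?_
  · rw [← mon_singleton, ← mon_singleton, ← mon_append]
    exact mon_mem ⟨e, (e'.1, e'.2.succ μ), trivial, trivial, rfl⟩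
  · rw [← mon_singleton, ← mon_singleton, ← mon_append]
    exact mon_mem ⟨(e.1, e.2.succ μ), e', trivial, trivial, rfl⟩

theorem deltaGen_afRed_mem (r : κ × MI n) :
    T.deltaGen (Sum.inl (OddGen.afRed r.1 r.2)) ∈
      linSpan (fun g => ∃ x : γ × MI n, g = Sum.inr (EvenGen.afGauge x.1 x.2)) ⊔
        (quadSpan fun _ : ι × MI n => True : Submodule ℝ (Form n ι γ κ)) := by
  have hD : ∀ (μ : Fin n), ∀ a ∈ linSpan (fun g : Gen n ι γ κ =>
      ∃ x : γ × MI n, g = Sum.inr (EvenGen.afGauge x.1 x.2)), totD μ a ∈ linSpan (fun g =>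
      ∃ x : γ × MI n, g = Sum.inr (EvenGen.afGauge x.1 x.2)) := fun μ a ha =>
    totD_mem_linSpan (by
      rintro μ _ ⟨e, rfl⟩
      rw [genShift]
      exact gen_mem ⟨_, ⟨(e.1, e.2.succ μ), rfl⟩, rfl⟩) μ ha
  refine iterD_mem (fun μ a ha => ?_) _ (add_mem (neg_mem (Submodule.mem_sup_left ?_))
    (Submodule.mem_sup_right ?_))
  · obtain ⟨x, hx, y, hy, rfl⟩ := Submodule.mem_sup.1 ha
    rw [map_add]
    exact Submodule.add_mem_sup (hD μ x hx) (totD_mem_quadSpan μ hy)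
  · refine sum_mem fun x _ => Submodule.smul_mem _ _ (iterD_mem hD _ ?_)
    rw [← ofFun_mul_comm, afG, ← mon_singleton]
    exact ofFun_mul_mon_mem ⟨_, ⟨(x.1, 0), rfl⟩, rfl⟩ _
  · refine Submodule.smul_mem _ _ (sum_mem fun x _ => ?_)
    change af x.1 * af x.2 * ofFun _ ∈ _
    rw [← ofFun_mul_comm, af, af, ← mon_singleton, ← mon_singleton, ← mon_append]
    exact ofFun_mul_mon_mem ⟨_, _, trivial, trivial, rfl⟩ _

theorem rder_af_mem_linSpan (e : ι × MI n) {a : Form n ι γ κ}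
    (ha : a ∈ quadSpan fun _ : ι × MI n => True) :
    rder (Sum.inl (OddGen.afField e.1 e.2)) a ∈
      linSpan (fun g => ∃ e : ι × MI n, g = Sum.inl (OddGen.afField e.1 e.2)) := by
  classical
  refine map_mspan (fun f l hl => ?_) ha
  obtain ⟨e₁, e₂, -, -, rfl⟩ := hl
  rw [rder_ofFun_mul, mon_cons, mon_singleton, rder_mul_gen, rder_gen]
  refine ofFun_mul_mem f (add_mem ?_ (Submodule.smul_mem _ _ ?_))
  · split_ifs
    · exact gen_mem ⟨_, ⟨e₁, rfl⟩, rfl⟩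
    · exact zero_mem _
  · split_ifs
    · rw [one_mul]
      exact gen_mem ⟨_, ⟨e₂, rfl⟩, rfl⟩
    · rw [zero_mul]
      exact zero_mem _

theorem rder_quadSpan {g : Gen n ι γ κ} (hg : ∀ e : ι × MI n, g ≠ Sum.inl (OddGen.afField e.1 e.2))
    {a : Form n ι γ κ} (ha : a ∈ quadSpan fun _ : ι × MI n => True) : rder g a = 0 := by
  classical
  rw [← Submodule.mem_bot ℝ]
  refine map_mspan (fun f l hl => ?_) ha
  obtain ⟨e₁, e₂, -, -, rfl⟩ := hl
  rw [rder_ofFun_mul, mon_cons, mon_singleton, rder_mul_gen, rder_gen, if_neg (hg _),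
    if_neg (hg _)]
  simp

theorem afField_injective : Function.Injective
    fun e : ι × MI n => (Sum.inl (OddGen.afField e.1 e.2) : Gen n ι γ κ) := by
  rintro ⟨i, I⟩ ⟨j, J⟩ h
  simpa using h

theorem afGauge_injective : Function.Injective
    fun e : γ × MI n => (Sum.inr (EvenGen.afGauge e.1 e.2) : Gen n ι γ κ) := by
  rintro ⟨i, I⟩ ⟨j, J⟩ h
  simpa using h

theorem mem_quadSpan_of_rder {E : Finset (ι × MI n)} {a : Form n ι γ κ}
    (ha : a ∈ quadSpan fun _ : ι × MI n => True)
    (hE : ∀ e, e ∉ E → rder (Sum.inl (OddGen.afField e.1 e.2)) a = 0) :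
    a ∈ quadSpan fun e : ι × MI n => e ∈ E := by
  classical
  have ha' : a ∈ mspan (fun l : List (Gen n ι γ κ) => l.length = 2) :=
    mspan_mono (by rintro l ⟨e, e', -, -, rfl⟩; rfl) ha
  have h := length_smul_eq_sum_rder ha'
    (S := E.image fun e => Sum.inl (OddGen.afField e.1 e.2)) (fun g hg => by
      by_cases h : ∃ e : ι × MI n, g = Sum.inl (OddGen.afField e.1 e.2)
      · obtain ⟨e, rfl⟩ := h
        exact hE e fun he => hg (Finset.mem_image_of_mem _ he)
      · exact rder_quadSpan (by simpa using h) ha)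
  rw [Finset.sum_image afField_injective.injOn] at h
  have h2 : a = (1 / 2 : ℝ) • ((2 : ℕ) : ℝ) • a := by
    rw [smul_smul]
    norm_num
  rw [h2, h]
  refine Submodule.smul_mem _ _ (sum_mem fun e he => ?_)
  obtain ⟨f, -, hf⟩ := exists_eq_sum_of_linSpan afField_injective (fun g hg => hg)
    (rder_af_mem_linSpan e ha) (S := E) (fun e' he' => by
      rw [rder_rder, hE e' he', map_zero, smul_zero])
  rw [hf, Finset.sum_mul]
  refine sum_mem fun e' he' => ?_
  rw [mul_assoc, ← mon_singleton, ← mon_singleton, ← mon_append]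
  exact ofFun_mul_mon_mem ⟨e', e, he', he, rfl⟩ _

/-- The Noether identities of a closed level, as linear combinations of the equations. -/
theorem exists_noether_expansion {E : Finset (ι × MI n)} {G : Finset (γ × MI n)}
    {P : Finset (κ × MI n)} (h : T.ClosedLevel E G P) :
    ∃ N : γ × MI n → ι × MI n → LocFun n ι,
      (∀ g e u, evalFun u (N g e) = T.noetherCoeff g e u) ∧
      ∀ g ∈ G, T.deltaGen (Sum.inr (EvenGen.afGauge g.1 g.2)) =
        ∑ e ∈ E, ofFun (N g e) * af e := by
  have key : ∀ g, ∃ f : ι × MI n → LocFun n ι,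
      (∀ e, rder (Sum.inl (OddGen.afField e.1 e.2))
        (T.deltaGen (Sum.inr (EvenGen.afGauge g.1 g.2))) = ofFun (f e)) ∧
      (g ∈ G → T.deltaGen (Sum.inr (EvenGen.afGauge g.1 g.2)) = ∑ e ∈ E, ofFun (f e) * af e) := by
    intro g
    by_cases hg : g ∈ G
    · obtain ⟨f, h1, h2⟩ := exists_eq_sum_of_linSpan afField_injective (fun g hg => hg)
        (T.deltaGen_afGauge_mem g) (h.noether g hg)
      exact ⟨f, h1, fun _ => h2⟩
    · choose f hf using fun e : ι × MI n => exists_eq_ofFun_of_length_zero (rder_mem_length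
        (mspan_mono (by rintro l ⟨g, -, rfl⟩; rfl) (T.deltaGen_afGauge_mem g))
        (Sum.inl (OddGen.afField e.1 e.2)))
      exact ⟨f, hf, fun h => absurd h hg⟩
  choose N h1 h2 using key
  exact ⟨N, fun g e u => by rw [noetherCoeff, h1, evalAt_ofFun], h2⟩

/-- The reducibility relations of a closed level, as linear combinations of the Noether identities
up to terms that are quadratic in the equations. -/
theorem exists_reducibility_expansion {E : Finset (ι × MI n)} {G : Finset (γ × MI n)}
    {P : Finset (κ × MI n)} (h : T.ClosedLevel E G P) :
    ∃ (Z : κ × MI n → γ × MI n → LocFun n ι) (y : κ × MI n → Form n ι γ κ),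
      ∀ r ∈ P, (∀ g u, evalFun u (Z r g) = T.redCoeff r g u) ∧
      T.deltaGen (Sum.inl (OddGen.afRed r.1 r.2)) = ∑ g ∈ G, ofFun (Z r g) * afG g + y r ∧
      y r ∈ quadSpan fun e : ι × MI n => e ∈ E := by
  have key : ∀ r, ∃ (f : γ × MI n → LocFun n ι) (y : Form n ι γ κ), r ∈ P →
      (∀ g u, evalFun u (f g) = T.redCoeff r g u) ∧
      T.deltaGen (Sum.inl (OddGen.afRed r.1 r.2)) = ∑ g ∈ G, ofFun (f g) * afG g + y ∧
      y ∈ quadSpan fun e : ι × MI n => e ∈ E := by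
    intro r
    by_cases hr : r ∈ P
    · obtain ⟨x, hx, y, hy, hxy⟩ := Submodule.mem_sup.1 (T.deltaGen_afRed_mem r)
      have hgx : ∀ g : γ × MI n, rder (Sum.inr (EvenGen.afGauge g.1 g.2))
          (T.deltaGen (Sum.inl (OddGen.afRed r.1 r.2))) =
          rder (Sum.inr (EvenGen.afGauge g.1 g.2)) x := fun g => by
        rw [← hxy, map_add, rder_quadSpan (by simp) hy, add_zero]
      have hey : ∀ e : ι × MI n, rder (Sum.inl (OddGen.afField e.1 e.2))
          (T.deltaGen (Sum.inl (OddGen.afRed r.1 r.2))) =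
          rder (Sum.inl (OddGen.afField e.1 e.2)) y := fun e => by
        rw [← hxy, map_add, rder_linSpan (by simp) hx, zero_add]
      obtain ⟨f, h1, h2⟩ := exists_eq_sum_of_linSpan afGauge_injective (fun g hg => hg) hx
        (fun g hg => by rw [← hgx]; exact h.red r hr g hg)
      refine ⟨f, y, fun _ => ⟨fun g u => ?_, ?_, ?_⟩⟩
      · rw [redCoeff, hgx, h1, evalAt_ofFun]
      · rw [← hxy, h2]
        rfl
      · exact mem_quadSpan_of_rder hy fun e he => by rw [← hey]; exact h.red_af r hr e he
    · exact ⟨0, 0, fun h => absurd h hr⟩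
  choose Z y hZ using key
  exact ⟨Z, y, hZ⟩

/-! ### Degrees -/

theorem deltaGen_mem (g : Gen n ι γ κ) :
    T.deltaGen g ∈ gspan Set.univ bideg {bideg g + (0, -1)} := by
  rcases g with (_ | _ | ⟨i, I⟩ | ⟨Δ, I⟩) | (_ | ⟨α, I⟩)
  case inl.afField =>
    exact neg_mem (mem_gspan_of_add_eq (by simp [bideg, formDeg, antigh]; rfl) (ofFun_mem_gspan _))
  case inr.afGauge =>
    refine mspan_mono ?_ (T.deltaGen_afGauge_mem (α, I))
    rintro l ⟨g, ⟨e, rfl⟩, rfl⟩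
    exact ⟨fun _ _ => Set.mem_univ _, by simp [bideg, formDeg, antigh]⟩
  case inl.afRed =>
    obtain ⟨x, hx, y, hy, hxy⟩ := Submodule.mem_sup.1 (T.deltaGen_afRed_mem (Δ, I))
    rw [← hxy]
    refine add_mem (mspan_mono ?_ hx) (mspan_mono ?_ hy)
    · rintro l ⟨g, ⟨e, rfl⟩, rfl⟩
      exact ⟨fun _ _ => Set.mem_univ _, by simp [bideg, formDeg, antigh]⟩
    · rintro l ⟨e, e', -, -, rfl⟩
      exact ⟨fun _ _ => Set.mem_univ _, by simp [bideg, formDeg, antigh]⟩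
  all_goals exact zero_mem _

theorem delta_mem {p k : ℤ} {a : Form n ι γ κ} (ha : a ∈ forms n ι γ κ p k) :
    T.delta a ∈ forms n ι γ κ p (k - 1) := by
  rw [forms_eq_gspan] at ha ⊢
  exact T.delta_isOddDer.map_mem_gspan par_gen_exists T.delta_ofFun (c := (0, -1))
    (fun g _ => by rw [delta_gen]; exact T.deltaGen_mem g)
    (fun k hk => by rw [Set.mem_singleton_iff] at hk ⊢; rw [hk]; simp [sub_eq_add_neg]) ha

end GaugeData

namespace GaugeTheory

variable {n : ℕ} {ι γ κ : Type*} (T : GaugeTheory n ι γ κ)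

theorem delta_deltaGauge (α : γ) : T.delta (T.deltaGauge α) = 0 := by
  have h := T.noether α
  have h2 := congrArg (fun f => -(ofFun f : Form n ι γ κ)) h
  simp only [ofFun_zero, neg_zero] at h2
  rw [← h2]
  simp only [GaugeData.deltaGauge, Finsupp.sum, map_sum, map_smul, T.delta_iterD,
    ofFun_sum, ofFun_smul, ← Finset.sum_neg_distrib]
  refine Finset.sum_congr rfl fun e _ => ?_
  rw [← ofFun_mul_comm, T.delta_ofFun_mul, GaugeData.af, T.delta_gen, GaugeData.deltaGen,
    GaugeData.eqn, iterD_zero, Module.End.one_apply, mul_neg, ← ofFun_mul, map_neg, smul_neg,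
    iterD_totD_ofFun, mul_comm]

/-- The Koszul-Tate differential squares to zero. -/
theorem delta_delta (a : Form n ι γ κ) : T.delta (T.delta a) = 0 := by
  have hd : ∀ g, T.delta (T.deltaGen g) = 0 := by
    rintro ((_ | _ | _ | _) | (_ | _)) <;>
      simp [GaugeData.deltaGen, T.delta_ofFun, T.delta_iterD, T.delta_deltaGauge, T.reducibility]
  have h := (T.delta_isOddDer.anticommutator T.delta_isOddDer T.delta_par T.delta_par).ext
    IsDer.zero (fun f => by simp [T.delta_ofFun]) (fun g => by simp [T.delta_gen, hd]) a
  have h3 : (2 : ℝ) • T.delta (T.delta a) = 0 := by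
    rw [two_smul]
    exact h
  exact (smul_eq_zero.1 h3).resolve_left two_ne_zero

end GaugeTheory

/-! ### Solving for the dependent equations and identities -/

section Matrices

variable {n : ℕ} {ι : Type*}

open Classical in
/-- A matrix of local functions that is invertible at a point has an inverse up to a factor that
does not vanish at this point. -/
theorem exists_inverse_up_to_factor {α β : Type*} {s : Finset α} {t : Finset β} {p : β → Prop}
    (ht : ∀ b, b ∈ t ↔ p b) (N : α → β → LocFun n ι) (u : Coord n ι → ℝ)
    (hli : LinearIndependent ℝ (fun (a : s) (b : {b // p b}) => evalFun u (N a.1 b.1)))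
    (hsp : Submodule.span ℝ
      (Set.range fun (a : s) (b : {b // p b}) => evalFun u (N a.1 b.1)) = ⊤) :
    ∃ (A : β → α → LocFun n ι) (q : LocFun n ι), evalFun u q ≠ 0 ∧
      (∀ a ∈ s, ∀ a' ∈ s, ∑ b ∈ t, N a b * A b a' = if a = a' then q else 0) ∧
      (∀ b ∈ t, ∀ b' ∈ t, ∑ a ∈ s, A b a * N a b' = if b = b' then q else 0) := by
  have : Fintype {b // p b} := Fintype.subtype t ht
  let σ : s ≃ {b // p b} := (Module.Basis.mk hli hsp.ge).indexEquiv (Pi.basisFun ℝ _)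
  let M : Matrix s s (LocFun n ι) := fun a a' => N a.1 (σ a').1
  have hdet : evalFun u M.det ≠ 0 := by
    have h1 : LinearIndependent ℝ (M.map (evalFun u)).row := by
      have := hli.map' (LinearEquiv.funCongrLeft ℝ ℝ σ).toLinearMap (LinearEquiv.ker _)
      exact this
    rw [Matrix.linearIndependent_rows_iff_isUnit, Matrix.isUnit_iff_isUnit_det] at h1
    have h2 := AlgHom.map_det (evalFun u) M
    rw [h2]
    exact h1.ne_zero
  let A : β → α → LocFun n ι := fun b a =>
    if h : p b ∧ a ∈ s then M.adjugate (σ.symm ⟨b, h.1⟩) ⟨a, h.2⟩ else 0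
  have hA : ∀ b a (hb : p b) (ha : a ∈ s), A b a = M.adjugate (σ.symm ⟨b, hb⟩) ⟨a, ha⟩ :=
    fun b a hb ha => dif_pos ⟨hb, ha⟩
  refine ⟨A, M.det, hdet, fun a ha a' ha' => ?_, fun b hb b' hb' => ?_⟩
  · rw [Finset.sum_subtype t ht, ← σ.sum_comp]
    have h := congrFun (congrFun M.mul_adjugate ⟨a, ha⟩) ⟨a', ha'⟩
    rw [Matrix.mul_apply, Matrix.smul_apply, Matrix.one_apply] at h
    simp only [Subtype.mk.injEq, smul_eq_mul, mul_ite, mul_one, mul_zero] at h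
    rw [← h]
    refine Finset.sum_congr rfl fun x _ => ?_
    rw [hA _ _ (σ x).2 ha']
    simp [M]
  · have h := congrFun (congrFun M.adjugate_mul (σ.symm ⟨b, (ht b).1 hb⟩))
      (σ.symm ⟨b', (ht b').1 hb'⟩)
    rw [Matrix.mul_apply, Matrix.smul_apply, Matrix.one_apply] at h
    simp only [EmbeddingLike.apply_eq_iff_eq, Subtype.mk.injEq, smul_eq_mul, mul_ite, mul_one,
      mul_zero] at h
    rw [← h, Finset.sum_subtype s (fun _ => Iff.rfl)]
    refine Finset.sum_congr rfl fun x _ => ?_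
    rw [hA _ _ ((ht b).1 hb) x.2]
    simp [M]

end Matrices

/-! ### Finite levels -/

section Levels

variable {n : ℕ} {ι γ κ : Type*}

/-- The generators `dx^μ`, the ghosts in `F` and the antifields of the equations in `E`, of the
Noether identities in `G` and of the reducibility relations in `P`. -/
def levelGens (F : Set (Gen n ι γ κ)) (E : Finset (ι × MI n)) (G : Finset (γ × MI n))
    (P : Finset (κ × MI n)) : Set (Gen n ι γ κ) :=
  {g | match g with
    | Sum.inl (OddGen.dx _) => True
    | Sum.inl (OddGen.ghost _ _) => g ∈ F
    | Sum.inl (OddGen.afField i I) => (i, I) ∈ E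
    | Sum.inl (OddGen.afRed Δ I) => (Δ, I) ∈ P
    | Sum.inr (EvenGen.ghost _ _) => g ∈ F
    | Sum.inr (EvenGen.afGauge α I) => (α, I) ∈ G}

/-- Form degree, antighost number, and the number of generators that are not antifields. -/
def levelWt (g : Gen n ι γ κ) : ℤ × ℤ × ℤ :=
  (formDeg g, antigh g, if antigh g = 0 then 1 else 0)

/-- The weights of the forms of form degree `p` and antighost number `k` that contain at most `ℓ`
generators other than antifields. -/
def wtBox (p k ℓ : ℤ) : Set (ℤ × ℤ × ℤ) := {w | w.1 = p ∧ w.2.1 = k ∧ w.2.2 ≤ ℓ}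

/-- The forms of form degree `p` and antighost number `k` on a finite level, with bounded
polynomial degree in the ghosts. -/
abbrev levelForms (F : Set (Gen n ι γ κ)) (E : Finset (ι × MI n)) (G : Finset (γ × MI n))
    (P : Finset (κ × MI n)) (p k ℓ : ℤ) : Submodule ℝ (Form n ι γ κ) :=
  gspan (levelGens F E G P) levelWt (wtBox p k ℓ)

variable {F : Set (Gen n ι γ κ)} {E : Finset (ι × MI n)} {G : Finset (γ × MI n)}
  {P : Finset (κ × MI n)}

theorem af_mem_level {e : ι × MI n} (he : e ∈ E) :
    (Sum.inl (OddGen.afField e.1 e.2) : Gen n ι γ κ) ∈ levelGens F E G P := he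

theorem afG_mem_level {g : γ × MI n} (hg : g ∈ G) :
    (Sum.inr (EvenGen.afGauge g.1 g.2) : Gen n ι γ κ) ∈ levelGens F E G P := hg

theorem afRed_mem_level {r : κ × MI n} (hr : r ∈ P) :
    (Sum.inl (OddGen.afRed r.1 r.2) : Gen n ι γ κ) ∈ levelGens F E G P := hr

variable (T : GaugeData n ι γ κ)

end Levels

/-! ### Filtrations -/

section Filtration

variable {n : ℕ} {ι γ κ : Type*} {M : Type*} [AddCommMonoid M]

/-- The monomials in the generators of `Γ` with weight in `K` and filtration degree at least `j`. -/
abbrev filtSpan (Γ : Set (Gen n ι γ κ)) (wt : Gen n ι γ κ → M) (ν : Gen n ι γ κ → ℕ) (K : Set M)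
    (j : ℕ) : Submodule ℝ (Form n ι γ κ) :=
  mspan fun l => HasWeight Γ wt K l ∧ j ≤ (l.map ν).sum

variable {Γ : Set (Gen n ι γ κ)} {wt : Gen n ι γ κ → M} {ν : Gen n ι γ κ → ℕ}

theorem gen_mem_filtSpan {g : Gen n ι γ κ} (hg : g ∈ Γ) {w : M} (hw : wt g = w) {j : ℕ}
    (hj : j ≤ ν g) : gen g ∈ filtSpan Γ wt ν {w} j :=
  gen_mem ⟨⟨by simpa using hg, by simpa using hw⟩, by simpa using hj⟩

theorem mul_mem_filtSpan {w w' : M} {j j' : ℕ} {a b : Form n ι γ κ}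
    (ha : a ∈ filtSpan Γ wt ν {w} j) (hb : b ∈ filtSpan Γ wt ν {w'} j') :
    a * b ∈ filtSpan Γ wt ν {w + w'} (j + j') := by
  refine mul_mem_mspan (fun l l' hl hl' => ⟨⟨fun g hg => ?_, ?_⟩, ?_⟩) ha hb
  · rcases List.mem_append.1 hg with h | h
    · exact hl.1.1 g h
    · exact hl'.1.1 g h
  · rw [List.map_append, List.sum_append, hl.1.2, hl'.1.2]
    rfl
  · rw [List.map_append, List.sum_append]
    exact add_le_add hl.2 hl'.2

/-- An even derivation that raises the filtration degree of the generators raises all filtration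
degrees. -/
theorem IsEvenDer.map_mon_mem_filtSpan {V : Form n ι γ κ →ₗ[ℝ] Form n ι γ κ} (hV : IsEvenDer V)
    (h : ∀ g ∈ Γ, V (gen g) ∈ filtSpan Γ wt ν {wt g} (ν g + 1)) {K : Set M}
    {l : List (Gen n ι γ κ)} (hl : HasWeight Γ wt K l) :
    V (mon l) ∈ filtSpan Γ wt ν K ((l.map ν).sum + 1) := by
  refine hV.map_mon_mem id_gen_exists hV.map_one l ?_
  rintro l₁ g l₂ rfl
  have hmon : ∀ l : List (Gen n ι γ κ), (∀ g ∈ l, g ∈ Γ) →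
      mon l ∈ filtSpan Γ wt ν {(l.map wt).sum} (l.map ν).sum := fun l hl =>
    mon_mem ⟨⟨hl, rfl⟩, le_rfl⟩
  have h1 := mul_mem_filtSpan (mul_mem_filtSpan (hmon l₁ fun g' hg' =>
    hl.1 g' (by simp [hg'])) (h g (hl.1 g (by simp)))) (hmon l₂ fun g' hg' =>
    hl.1 g' (by simp [hg']))
  refine mspan_mono (fun l' hl' => ⟨⟨hl'.1.1, ?_⟩, le_trans (le_of_eq ?_) hl'.2⟩) h1
  · rw [hl'.1.2]
    convert hl.2 using 1
    rw [List.map_append, List.sum_append, List.map_cons, List.sum_cons]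
    abel
  · rw [List.map_append, List.sum_append, List.map_cons, List.sum_cons]
    ring

theorem IsDer.sub {σ : Form n ι γ κ →ₐ[ℝ] Form n ι γ κ} {V W : Form n ι γ κ →ₗ[ℝ] Form n ι γ κ}
    (hV : IsDer σ V) (hW : IsDer σ W) : IsDer σ (V - W) := fun a b => by
  simp only [LinearMap.sub_apply, hV a b, hW a b, mul_sub, sub_mul]
  abel

open Classical in
/-- Suppose that `D` is, up to terms of higher filtration degree, multiplication by `q` times a
counting operator `W`. Then a suitable shift of `D` raises the order `(k + 1) ν + W`, which is
lexicographic because of `W ≤ k`. -/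
theorem shift_raises_order {D : Form n ι γ κ →ₗ[ℝ] Form n ι γ κ} (hD : IsEvenDer D)
    (hD0 : ∀ f, D (ofFun f) = 0) {q : LocFun n ι} {W : Gen n ι γ κ → ℕ}
    (hW0 : ∀ g ∈ Γ, W g = 0 → D (gen g) = 0)
    (hDg : ∀ g ∈ Γ, D (gen g) - ofFun ((W g : ℝ) • q) * gen g ∈ filtSpan Γ wt ν {wt g} (ν g + 1))
    {K : Set M} {k : ℕ} (hk : ∀ l, HasWeight Γ wt K l → (l.map W).sum ≤ k) {t w : ℕ}
    (hw : t % (k + 1) = w) {a : Form n ι γ κ}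
    (ha : a ∈ mspan fun l => HasWeight Γ wt K l ∧
      ((l.map W).sum = 0 ∨ t ≤ (k + 1) * (l.map ν).sum + (l.map W).sum)) :
    D a - ofFun ((w : ℝ) • q) * a ∈ mspan fun l => HasWeight Γ wt K l ∧
      ((l.map W).sum = 0 ∨ t + 1 ≤ (k + 1) * (l.map ν).sum + (l.map W).sum) := by
  let C : Form n ι γ κ →ₗ[ℝ] Form n ι γ κ := vecField fun g => (W g : ℝ) • gen g
  have hC : IsEvenDer C := vecField_isEvenDer fun g => by rw [map_smul, par_gen, smul_comm]
  let C' : Form n ι γ κ →ₗ[ℝ] Form n ι γ κ := LinearMap.mulLeft ℝ (ofFun q) ∘ₗ C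
  have hC' : IsEvenDer C' := fun a b => by
    simp only [C', LinearMap.comp_apply, LinearMap.mulLeft_apply, hC a b, AlgHom.id_apply, mul_add,
      mul_assoc]
    rw [← mul_assoc, ofFun_mul_comm, mul_assoc]
  have hCmon : ∀ l : List (Gen n ι γ κ), C (mon l) = ((l.map fun g => (W g : ℝ)).sum) • mon l := by
    intro l
    have := hC.map_mon (vecField_ofFun _) (w := fun g => (W g : ℝ))
      (fun g => vecField_gen _ g) 1 l
    rwa [ofFun_one, one_mul] at this
  have hcast : ∀ l : List (Gen n ι γ κ), (l.map fun g => (W g : ℝ)).sum = ((l.map W).sum : ℕ) := by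
    intro l
    induction l with
    | nil => simp
    | cons g l ih => simp [ih]
  have ha' : a ∈ Submodule.comap (D - LinearMap.mulLeft ℝ (ofFun ((w : ℝ) • q)))
      (mspan fun l => HasWeight Γ wt K l ∧
      ((l.map W).sum = 0 ∨ t + 1 ≤ (k + 1) * (l.map ν).sum + (l.map W).sum)) := by
    refine mspan_le (fun f l hl => ?_) ha
    rw [Submodule.mem_comap, LinearMap.sub_apply, LinearMap.mulLeft_apply, hD, hD0, zero_mul,
      add_zero, ← mul_assoc, ofFun_mul_comm _ (ofFun f), mul_assoc, ← mul_sub]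
    refine ofFun_mul_mem f ?_
    by_cases hl0 : (l.map W).sum = 0
    · have h0 : D (mon l) ∈ (⊥ : Submodule ℝ (Form n ι γ κ)) := by
        refine hD.map_mon_mem id_gen_exists hD.map_one l ?_
        rintro l₁ g l₂ rfl
        rw [hW0 g (hl.1.1 g (by simp)) (by simp at hl0; exact hl0.2.1), mul_zero, zero_mul]
        exact zero_mem _
      rw [(Submodule.mem_bot ℝ).1 h0, zero_sub]
      exact neg_mem (ofFun_mul_mon_mem ⟨hl.1, Or.inl hl0⟩ _)
    · have hlt := hl.2.resolve_left hl0
      have hWk := hk l hl.1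
      have h1 : D (mon l) - C' (mon l) ∈ filtSpan Γ wt ν K ((l.map ν).sum + 1) := by
        have hDC : IsEvenDer (D - C') := IsDer.sub hD hC'
        refine hDC.map_mon_mem_filtSpan (fun g hg => ?_) hl.1
        have := hDg g hg
        rwa [LinearMap.sub_apply, LinearMap.comp_apply, LinearMap.mulLeft_apply, vecField_gen,
          mul_smul_comm, ← smul_mul_assoc, ← ofFun_smul]
      have h2 : D (mon l) - ofFun ((w : ℝ) • q) * mon l = (D (mon l) - C' (mon l)) +
          ofFun ((((l.map W).sum : ℝ) - w) • q) * mon l := by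
        simp only [C', LinearMap.comp_apply, LinearMap.mulLeft_apply, hCmon, hcast, sub_smul,
          ofFun_sub, ofFun_smul, sub_mul, mul_smul_comm, smul_mul_assoc]
        abel
      rw [h2]
      refine add_mem (mspan_mono (fun l' hl' => ⟨hl'.1, Or.inr ?_⟩) h1) ?_
      · by_cases hlw : (l.map W).sum = w
        · rw [hlw, sub_self, zero_smul, ofFun_zero, zero_mul]
          exact zero_mem _
        · refine ofFun_mul_mon_mem ⟨hl.1, Or.inr ?_⟩ _
          rcases hlt.lt_or_eq with h | h
          · exact h
          · exfalso
            apply hlw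
            rw [← hw, h, Nat.mul_add_mod, Nat.mod_eq_of_lt (by omega)]
      · have := Nat.mul_le_mul_left (k + 1) hl'.2
        rw [mul_add] at this
        omega
  exact ha'

end Filtration

/-! ### Elimination of the dependent equations and of the antifields `C*` -/

section Reduction

variable {n : ℕ} {ι γ κ : Type*}

open GaugeData (af afG)

/-- The antifield `∂_I C*_Δ`, for `r = (Δ, I)`. -/
def afR (r : κ × MI n) : Form n ι γ κ := gen (Sum.inl (OddGen.afRed r.1 r.2))

open Classical in
/-- The components of the odd vector field that maps the antifields of the dependent equations `E'`
to antifields of the independent identities `J`, and the antifields of the dependent identities `G'`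
to antifields of the relations `P`, with coefficients `A` and `B`. -/
def solveVec (E' : Finset (ι × MI n)) (G' J : Finset (γ × MI n)) (P : Finset (κ × MI n))
    (A : ι × MI n → γ × MI n → LocFun n ι) (B : γ × MI n → κ × MI n → LocFun n ι) :
    Gen n ι γ κ → Form n ι γ κ
  | Sum.inl (OddGen.afField i I) =>
    if (i, I) ∈ E' then ∑ g ∈ J, ofFun (A (i, I) g) * afG g else 0
  | Sum.inr (EvenGen.afGauge α I) =>
    if (α, I) ∈ G' then ∑ r ∈ P, ofFun (B (α, I) r) * afR r else 0
  | _ => 0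

variable {E' : Finset (ι × MI n)} {G' J : Finset (γ × MI n)} {P : Finset (κ × MI n)}
    {A : ι × MI n → γ × MI n → LocFun n ι} {B : γ × MI n → κ × MI n → LocFun n ι}

theorem par_solveVec (g : Gen n ι γ κ) :
    par (solveVec E' G' J P A B g) = -(psign g • solveVec E' G' J P A B g) := by
  rcases g with (_ | _ | _ | _) | (_ | _) <;> simp only [solveVec] <;> (try split_ifs) <;>
    simp [par_ofFun, GaugeData.par_afG, afR, par_gen, psign]

theorem solveVec_mem_level {F : Set (Gen n ι γ κ)} {E : Finset (ι × MI n)} {G : Finset (γ × MI n)}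
    (hJ : J ⊆ G) (g : Gen n ι γ κ) :
    solveVec E' G' J P A B g ∈ gspan (levelGens F E G P) levelWt {levelWt g + (0, 1, 0)} := by
  rcases g with (_ | _ | ⟨i, I⟩ | _) | (_ | ⟨α, I⟩)
  case inl.afField =>
    simp only [solveVec]
    split_ifs
    · refine sum_mem fun g hg => ofFun_mul_mem _ ?_
      exact gen_mem_gspan_of (afG_mem_level (hJ hg)) (by simp [levelWt, formDeg, antigh])
    · exact zero_mem _
  case inr.afGauge =>
    simp only [solveVec]
    split_ifs
    · refine sum_mem fun r hr => ofFun_mul_mem _ ?_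
      exact gen_mem_gspan_of (afRed_mem_level hr) (by simp [levelWt, formDeg, antigh])
    · exact zero_mem _
  all_goals exact zero_mem _

open Classical in
/-- Counts the antifields other than those of the independent equations `I`. -/
def depWt (I : Finset (ι × MI n)) : Gen n ι γ κ → ℕ
  | Sum.inl (OddGen.afField i K) => if (i, K) ∈ I then 0 else 1
  | Sum.inr (EvenGen.afGauge _ _) => 1
  | Sum.inl (OddGen.afRed _ _) => 1
  | _ => 0

open Classical in
/-- A filtration degree for which the anticommutator of the Koszul-Tate differential with the
solving vector field is a counting operator to lowest order: the antifields of the independent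
equations and identities have degree `2` and all others degree `1`, so that the correction terms,
which involve an independent antifield or two antifields, are of higher degree. -/
def filtWt (I : Finset (ι × MI n)) (J : Finset (γ × MI n)) : Gen n ι γ κ → ℕ
  | Sum.inl (OddGen.afField i K) => if (i, K) ∈ I then 2 else 1
  | Sum.inr (EvenGen.afGauge α K) => if (α, K) ∈ J then 2 else 1
  | Sum.inl (OddGen.afRed _ _) => 1
  | _ => 0

theorem depWt_le_antigh (I : Finset (ι × MI n)) (g : Gen n ι γ κ) : (depWt I g : ℤ) ≤ antigh g := by
  rcases g with (_ | _ | _ | _) | (_ | _) <;> simp only [depWt, antigh] <;>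
    (try split_ifs) <;> norm_num

theorem filtWt_le_antigh (I : Finset (ι × MI n)) (J : Finset (γ × MI n)) (g : Gen n ι γ κ) :
    (filtWt I J g : ℤ) ≤ 2 * antigh g := by
  rcases g with (_ | _ | _ | _) | (_ | _) <;> simp only [filtWt, antigh] <;>
    (try split_ifs) <;> norm_num

theorem sum_le_of_levelWt {Γ : Set (Gen n ι γ κ)} {p k ℓ : ℤ} {l : List (Gen n ι γ κ)}
    (hl : HasWeight Γ levelWt (wtBox p k ℓ) l) {w : Gen n ι γ κ → ℕ} {c : ℤ}
    (hw : ∀ g, (w g : ℤ) ≤ c * antigh g) : ((l.map w).sum : ℤ) ≤ c * k := by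
  rw [← hl.2.2.1]
  clear hl
  induction l with
  | nil => simp
  | cons g l ih =>
    simp only [List.map_cons, List.sum_cons, Prod.snd_add, Prod.fst_add, mul_add, Nat.cast_add]
    exact add_le_add (hw g) ih

variable (T : GaugeTheory n ι γ κ)

open Classical in
set_option maxHeartbeats 800000 in
/-- The anticommutator of the Koszul-Tate differential with the solving vector field is `q` times
the operator that counts the antifields other than those of the independent equations, up to terms
of higher filtration degree. Here `N` and `Z` are the coefficients of the identities and relations,
and `A`, `B` are inverse to their invertible blocks up to the factor `q`. -/
theorem anticommutator_sub_mem {E I : Finset (ι × MI n)} {G : Finset (γ × MI n)}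
    {F : Set (Gen n ι γ κ)} {q : LocFun n ι}
    {N : γ × MI n → ι × MI n → LocFun n ι} {Z : κ × MI n → γ × MI n → LocFun n ι}
    {y : κ × MI n → Form n ι γ κ}
    (hI : I ⊆ E) (hE' : ∀ e, e ∈ E' ↔ e ∈ E ∧ e ∉ I) (hJ : J ⊆ G)
    (hG' : ∀ g, g ∈ G' ↔ g ∈ G ∧ g ∉ J)
    (hN : ∀ g ∈ G, T.deltaGen (Sum.inr (EvenGen.afGauge g.1 g.2)) = ∑ e ∈ E, ofFun (N g e) * af e)
    (hZ : ∀ r ∈ P, T.deltaGen (Sum.inl (OddGen.afRed r.1 r.2)) =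
      ∑ g ∈ G, ofFun (Z r g) * afG g + y r)
    (hy : ∀ r ∈ P, y r ∈ GaugeData.quadSpan fun e : ι × MI n => e ∈ E)
    (hNA : ∀ g ∈ J, ∀ g' ∈ J, ∑ e ∈ E', N g e * A e g' = if g = g' then q else 0)
    (hAN : ∀ e ∈ E', ∀ e' ∈ E', ∑ g ∈ J, A e g * N g e' = if e = e' then q else 0)
    (hZB : ∀ r ∈ P, ∀ r' ∈ P, ∑ g ∈ G', Z r g * B g r' = if r = r' then q else 0)
    (hBZ : ∀ g ∈ G', ∀ g' ∈ G', ∑ r ∈ P, B g r * Z r g' = if g = g' then q else 0)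
    (g : Gen n ι γ κ) (hg : g ∈ levelGens F E G P) :
    vecField (solveVec E' G' J P A B) (T.deltaGen g) + T.delta (solveVec E' G' J P A B g) -
      ofFun ((depWt I g : ℝ) • q) * gen g ∈
      filtSpan (levelGens F E G P) levelWt (filtWt I J) {levelWt g} (filtWt I J g + 1) := by
  set s := vecField (solveVec E' G' J P A B) with hs
  have hsd : IsOddDer s := vecField_isOddDer par_solveVec
  have hsplitE : ∀ f : ι × MI n → Form n ι γ κ, ∑ e ∈ E, f e = ∑ e ∈ E', f e + ∑ e ∈ I, f e := by
    intro f
    rw [← Finset.sum_sdiff hI]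
    congr 2
    ext e
    rw [Finset.mem_sdiff, hE']
  have hsplitG : ∀ f : γ × MI n → Form n ι γ κ, ∑ g ∈ G, f g = ∑ g ∈ G', f g + ∑ g ∈ J, f g := by
    intro f
    rw [← Finset.sum_sdiff hJ]
    congr 2
    ext e
    rw [Finset.mem_sdiff, hG']
  have hsaf : ∀ e : ι × MI n, s (af e) = if e ∈ E' then ∑ g ∈ J, ofFun (A e g) * afG g else 0 := by
    intro e
    rw [hs, af, vecField_gen, solveVec]
  have hsafG : ∀ g : γ × MI n,
      s (afG g) = if g ∈ G' then ∑ r ∈ P, ofFun (B g r) * afR r else 0 := by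
    intro e
    rw [hs, afG, vecField_gen, solveVec]
  have hsmul : ∀ f (a : Form n ι γ κ), s (ofFun f * a) = ofFun f * s a := vecField_ofFun_mul _
  rcases g with (_ | _ | ⟨i, K⟩ | ⟨Δ, K⟩) | (_ | ⟨α, K⟩)
  case inl.afField =>
    have h0 : s (T.deltaGen (Sum.inl (OddGen.afField i K))) = 0 := by
      rw [GaugeData.deltaGen, map_neg, hs, vecField_ofFun, neg_zero]
    rw [h0, zero_add]
    by_cases he : (i, K) ∈ I
    · have he' : (i, K) ∉ E' := fun h => ((hE' _).1 h).2 he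
      simp [solveVec, depWt, he, he', ofFun_zero]
    · -- `δ s φ*_e = q φ*_e` up to antifields of independent equations, by `A N = q`
      have he' : (i, K) ∈ E' := (hE' _).2 ⟨hg, he⟩
      rw [solveVec, if_pos he', map_sum, depWt, if_neg he, Nat.cast_one, one_smul]
      have h1 : ∑ g ∈ J, T.delta (ofFun (A (i, K) g) * afG g) =
          ∑ e ∈ E, ofFun (∑ g ∈ J, A (i, K) g * N g e) * af e := by
        simp only [ofFun_sum, Finset.sum_mul]
        rw [Finset.sum_comm]
        refine Finset.sum_congr rfl fun g hg => ?_
        rw [T.delta_ofFun_mul, afG, T.delta_gen, hN g (hJ hg), Finset.mul_sum]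
        simp only [ofFun_mul, mul_assoc]
      have h2 : ∑ e ∈ E', ofFun (∑ g ∈ J, A (i, K) g * N g e) * af e =
          (ofFun q * af (i, K) : Form n ι γ κ) := by
        rw [Finset.sum_eq_single_of_mem (i, K) he']
        · rw [hAN _ he' _ he', if_pos rfl]
        · intro e he he2
          rw [hAN _ he' _ he, if_neg (Ne.symm he2), ofFun_zero, zero_mul]
      rw [h1, hsplitE, h2, af, add_sub_cancel_left]
      refine sum_mem fun e he2 => ofFun_mul_mem _ ?_
      exact gen_mem_filtSpan (af_mem_level (hI he2)) rfl (by simp [filtWt, he, he2])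
  case inr.afGauge =>
    have hsδ : s (T.deltaGen (Sum.inr (EvenGen.afGauge α K))) =
        ∑ g ∈ J, ofFun (∑ e ∈ E', N (α, K) e * A e g) * afG g := by
      rw [hN (α, K) hg, hsplitE, map_add, map_sum, map_sum]
      have h0 : ∑ e ∈ I, s (ofFun (N (α, K) e) * af e) = 0 := by
        refine Finset.sum_eq_zero fun e he => ?_
        rw [hsmul, hsaf, if_neg fun h => ((hE' _).1 h).2 he, mul_zero]
      rw [h0, add_zero]
      simp only [ofFun_sum, Finset.sum_mul]
      rw [Finset.sum_comm]
      refine Finset.sum_congr rfl fun e he => ?_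
      rw [hsmul, hsaf, if_pos he, Finset.mul_sum]
      simp only [ofFun_mul, mul_assoc]
    rw [hsδ, depWt, Nat.cast_one, one_smul]
    by_cases hgJ : (α, K) ∈ J
    · -- an independent identity: `s δ C*_g = q C*_g` by `N A = q`
      have hgG' : (α, K) ∉ G' := fun h => ((hG' _).1 h).2 hgJ
      have h2 : ∑ g ∈ J, ofFun (∑ e ∈ E', N (α, K) e * A e g) * afG g =
          (ofFun q * afG (α, K) : Form n ι γ κ) := by
        rw [Finset.sum_eq_single_of_mem (α, K) hgJ]
        · rw [hNA _ hgJ _ hgJ, if_pos rfl]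
        · intro g' hg' hne
          rw [hNA _ hgJ _ hg', if_neg (Ne.symm hne), ofFun_zero, zero_mul]
      rw [h2, solveVec, if_neg hgG', map_zero, add_zero, afG, sub_self]
      exact zero_mem _
    · -- a dependent identity: `δ s C*_g = q C*_g` by `B Z = q`, while `s δ C*_g` only involves
      -- independent identities
      have hgG' : (α, K) ∈ G' := (hG' _).2 ⟨hg, hgJ⟩
      have hJmem : ∀ f : γ × MI n → LocFun n ι, (∑ g ∈ J, ofFun (f g) * afG g : Form n ι γ κ) ∈
          filtSpan (levelGens F E G P) levelWt (filtWt I J)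
            {levelWt (Sum.inr (EvenGen.afGauge α K) : Gen n ι γ κ)}
            (filtWt I J (Sum.inr (EvenGen.afGauge α K) : Gen n ι γ κ) + 1) := fun f =>
        sum_mem fun g' hg' => ofFun_mul_mem _
          (gen_mem_filtSpan (afG_mem_level (hJ hg')) rfl (by simp [filtWt, hgJ, hg']))
      rw [solveVec, if_pos hgG', map_sum]
      have h1 : ∑ r ∈ P, T.delta (ofFun (B (α, K) r) * afR r) =
          ∑ g ∈ G, ofFun (∑ r ∈ P, B (α, K) r * Z r g) * afG g +
            ∑ r ∈ P, ofFun (B (α, K) r) * y r := by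
        simp only [ofFun_sum, Finset.sum_mul]
        rw [Finset.sum_comm, ← Finset.sum_add_distrib]
        refine Finset.sum_congr rfl fun r hr => ?_
        rw [T.delta_ofFun_mul, afR, T.delta_gen, hZ r hr, mul_add, Finset.mul_sum]
        simp only [ofFun_mul, mul_assoc]
      have h2 : ∑ g ∈ G', ofFun (∑ r ∈ P, B (α, K) r * Z r g) * afG g =
          (ofFun q * afG (α, K) : Form n ι γ κ) := by
        rw [Finset.sum_eq_single_of_mem (α, K) hgG']
        · rw [hBZ _ hgG' _ hgG', if_pos rfl]
        · intro g' hg' hne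
          rw [hBZ _ hgG' _ hg', if_neg (Ne.symm hne), ofFun_zero, zero_mul]
      rw [h1, hsplitG, h2, afG]
      have e : ∀ a b c d : Form n ι γ κ, a + (b + c + d) - b = a + c + d := fun a b c d => by abel
      rw [e]
      refine add_mem (add_mem (hJmem _) (hJmem _)) (sum_mem fun r hr => ofFun_mul_mem _ ?_)
      refine mspan_mono ?_ (hy r hr)
      rintro l ⟨e, e', he, he', rfl⟩
      refine ⟨⟨fun g hg => ?_, by simp [levelWt, formDeg, antigh]⟩, ?_⟩
      · simp only [List.mem_cons, List.not_mem_nil, or_false] at hg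
        rcases hg with rfl | rfl
        · exact af_mem_level he
        · exact af_mem_level he'
      · simp only [filtWt, hgJ, if_false, List.map_cons, List.map_nil, List.sum_cons, List.sum_nil]
        split_ifs <;> norm_num
  case inl.afRed =>
    rw [solveVec, map_zero, add_zero, hZ (Δ, K) hg, map_add, map_sum, hsplitG, depWt, Nat.cast_one,
      one_smul]
    · -- `s δ C*_r = q C*_r` by `Z B = q`, up to `s y_r`, whose monomials `φ* C*` have degree `≥ 2`
      have h0 : ∑ g ∈ J, s (ofFun (Z (Δ, K) g) * afG g) = 0 := by
        refine Finset.sum_eq_zero fun g' hg' => ?_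
        rw [hsmul, hsafG, if_neg fun h => ((hG' _).1 h).2 hg', mul_zero]
      have h1 : ∑ g ∈ G', s (ofFun (Z (Δ, K) g) * afG g) =
          ∑ r ∈ P, ofFun (∑ g ∈ G', Z (Δ, K) g * B g r) * afR r := by
        simp only [ofFun_sum, Finset.sum_mul]
        rw [Finset.sum_comm]
        refine Finset.sum_congr rfl fun g' hg' => ?_
        rw [hsmul, hsafG, if_pos hg', Finset.mul_sum]
        simp only [ofFun_mul, mul_assoc]
      have h2 : ∑ r ∈ P, ofFun (∑ g ∈ G', Z (Δ, K) g * B g r) * afR r =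
          (ofFun q * afR (Δ, K) : Form n ι γ κ) := by
        rw [Finset.sum_eq_single_of_mem (Δ, K) hg]
        · rw [hZB _ hg _ hg, if_pos rfl]
        · intro r hr hne
          rw [hZB _ hg _ hr, if_neg (Ne.symm hne), ofFun_zero, zero_mul]
      rw [h0, h1, h2, add_zero, afR, add_sub_cancel_left]
      refine map_mspan (fun f l hl => ?_) (hy _ hg)
      obtain ⟨e, e', he, he', rfl⟩ := hl
      rw [hsmul]
      refine ofFun_mul_mem f ?_
      have hsmem : ∀ e : ι × MI n, s (af e) ∈
          filtSpan (levelGens F E G P) levelWt (filtWt I J) {((0, 2, 0) : ℤ × ℤ × ℤ)} 1 := by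
        intro e
        rw [hsaf]
        split_ifs
        · refine sum_mem fun g hg => ofFun_mul_mem _ ?_
          exact gen_mem_filtSpan (afG_mem_level (hJ hg)) rfl (by simp [filtWt, hg])
        · exact zero_mem _
      have haf : ∀ e ∈ E, af e ∈
          filtSpan (levelGens F E G P) levelWt (filtWt I J) {((0, 1, 0) : ℤ × ℤ × ℤ)} 1 :=
        fun e he => gen_mem_filtSpan (af_mem_level he) rfl (by
          simp only [filtWt]
          split_ifs <;> norm_num)
      have e1 : levelWt (Sum.inl (OddGen.afRed Δ K) : Gen n ι γ κ) = (0, 1, 0) + (0, 2, 0) := by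
        simp [levelWt, formDeg, antigh]
      have e2 : filtWt I J (Sum.inl (OddGen.afRed Δ K) : Gen n ι γ κ) = 1 := rfl
      rw [e1, e2, mon_cons, mon_singleton, hsd]
      refine add_mem (mul_mem_filtSpan (haf e he) (hsmem e')) ?_
      change s (af e) * par (af e') ∈ _
      rw [GaugeData.par_af, mul_neg, add_comm ((0, 1, 0) : ℤ × ℤ × ℤ)]
      exact neg_mem (mul_mem_filtSpan (hsmem e) (haf e' he'))
    all_goals simp
  all_goals
    simp [solveVec, depWt, GaugeData.deltaGen, ofFun_zero]

theorem vecField_solveVec_mem_level {E : Finset (ι × MI n)} {G : Finset (γ × MI n)}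
    {F : Set (Gen n ι γ κ)} (hJ : J ⊆ G) {p k ℓ : ℤ} {a : Form n ι γ κ}
    (ha : a ∈ levelForms F E G P p k ℓ) :
    vecField (solveVec E' G' J P A B) a ∈ levelForms F E G P p (k + 1) ℓ :=
  (vecField_isOddDer par_solveVec).map_mem_gspan par_gen_exists (vecField_ofFun _) (c := (0, 1, 0))
    (fun g _ => by rw [vecField_gen]; exact solveVec_mem_level hJ g)
    (fun w hw => by simpa [wtBox] using hw) ha

/-- At a point where the regularity conditions hold, every cycle is homologous, up to a factor that
does not vanish at this point, to a cycle that involves no other antifields than those of a set of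
independent equations. With `D = s δ + δ s`, the cycle `D y = δ (s y)` is a boundary, whereas
`D - w q` raises the order of `y`; the order of monomials with dependent antifields is bounded. -/
theorem exists_reduction {E : Finset (ι × MI n)} {G : Finset (γ × MI n)}
    (h : T.ClosedLevel E G P) {u : Coord n ι → ℝ} (hreg : T.RegularAt E G P u) :
    ∃ I ⊆ E, LinearIndependent ℝ
      (fun (a : I) (c : Coord n ι) => evalFun u (pder c (T.eqn a.1))) ∧
      ∀ (F : Set (Gen n ι γ κ)) (p : ℤ) (k : ℕ) (ℓ : ℤ), ∀ a ∈ levelForms F E G P p k ℓ,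
        T.delta a = 0 → ∃ χ, evalFun u χ ≠ 0 ∧ ∃ z ∈ levelForms F E G P p (k + 1) ℓ,
          ∃ y ∈ levelForms F I ∅ ∅ p k ℓ, T.delta y = 0 ∧ ofFun χ * a = y + T.delta z := by
  classical
  obtain ⟨I, hI, J, hJ, hlin, hN1, hN2, hZ1, hZ2⟩ := hreg
  obtain ⟨N, hNc, hN⟩ := T.exists_noether_expansion h
  obtain ⟨Z, y, hZ⟩ := T.exists_reducibility_expansion h
  have hE' : ∀ e, e ∈ E \ I ↔ e ∈ E ∧ e ∉ I := fun e => Finset.mem_sdiff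
  have hG' : ∀ g, g ∈ G \ J ↔ g ∈ G ∧ g ∉ J := fun e => Finset.mem_sdiff
  simp only [← hNc] at hN1 hN2
  have hZc : ∀ (r : P) (g : γ × MI n), T.redCoeff r.1 g u = evalFun u (Z r.1 g) :=
    fun r g => ((hZ r.1 r.2).1 g u).symm
  simp only [hZc] at hZ1 hZ2
  -- the two blocks are inverted up to different factors; rescaling gives both the factor `q₁ q₂`
  obtain ⟨A, q₁, hq₁, hNA, hAN⟩ := exists_inverse_up_to_factor hE' N u hN1 hN2
  obtain ⟨B, q₂, hq₂, hZB, hBZ⟩ := exists_inverse_up_to_factor hG' Z u hZ1 hZ2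
  refine ⟨I, hI, hlin, fun F p k ℓ a ha hda => ?_⟩
  let q := q₁ * q₂
  have hq : evalFun u q ≠ 0 := by
    rw [map_mul]
    exact mul_ne_zero hq₁ hq₂
  let X : Gen n ι γ κ → Form n ι γ κ := solveVec (E \ I) (G \ J) J P
    (fun e g => q₂ * A e g) (fun g r => q₁ * B g r)
  let D : Form n ι γ κ →ₗ[ℝ] Form n ι γ κ := vecField X ∘ₗ T.delta + T.delta ∘ₗ vecField X
  have hD : IsEvenDer D := (vecField_isOddDer par_solveVec).anticommutator T.delta_isOddDer
    (vecField_par_odd par_solveVec) T.delta_par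
  have hD0 : ∀ f, D (ofFun f) = 0 := fun f => by
    simp [D, T.delta_ofFun, vecField_ofFun]
  have hDg : ∀ g ∈ levelGens F E G P, D (gen g) - ofFun ((depWt I g : ℝ) • q) * gen g ∈
      filtSpan (levelGens F E G P) levelWt (filtWt I J) {levelWt g} (filtWt I J g + 1) := by
    intro g hg
    have := anticommutator_sub_mem (F := F) T (q := q₁ * q₂) (A := fun e g => q₂ * A e g)
      (B := fun g r => q₁ * B g r) hI hE' hJ hG' hN (fun r hr => (hZ r hr).2.1)
      (fun r hr => (hZ r hr).2.2)
      (fun g hg g' hg' => by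
        simp only [mul_left_comm _ q₂, ← Finset.mul_sum, hNA g hg g' hg', mul_ite, mul_zero]
        rw [mul_comm q₂])
      (fun e he e' he' => by
        simp only [mul_assoc, ← Finset.mul_sum, hAN e he e' he', mul_ite, mul_zero]
        rw [mul_comm q₂])
      (fun g hg g' hg' => by
        simp only [mul_left_comm _ q₁, ← Finset.mul_sum, hZB g hg g' hg', mul_ite, mul_zero])
      (fun e he e' he' => by
        simp only [mul_assoc, ← Finset.mul_sum, hBZ e he e' he', mul_ite, mul_zero]) g hg
    simpa [D, T.delta_gen, vecField_gen] using this
  have hW0 : ∀ g ∈ levelGens F E G P, depWt I g = 0 → D (gen g) = 0 := by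
    intro g hg hg0
    rw [LinearMap.add_apply, LinearMap.comp_apply, LinearMap.comp_apply, T.delta_gen, vecField_gen]
    rcases g with (_ | _ | ⟨i, K⟩ | ⟨Δ, K⟩) | (_ | ⟨α, K⟩)
    case inl.afField =>
      have he : (i, K) ∈ I := by
        by_contra he
        simp [depWt, he] at hg0
      simp [GaugeData.deltaGen, X, solveVec, he, vecField_ofFun]
    all_goals first
      | simp [depWt] at hg0; done
      | simp [GaugeData.deltaGen, X, solveVec]
  have hbound : ∀ l, HasWeight (levelGens F E G P) levelWt (wtBox p k ℓ) l →
      (l.map (depWt I)).sum ≤ k := fun l hl => by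
    have := sum_le_of_levelWt hl (w := depWt I) (c := 1)
      (fun g => by rw [one_mul]; exact depWt_le_antigh I g)
    omega
  have hbound' : ∀ l, HasWeight (levelGens F E G P) levelWt (wtBox p k ℓ) l →
      (l.map (filtWt I J)).sum ≤ 2 * k := fun l hl => by
    have := sum_le_of_levelWt hl (w := filtWt I J) (c := 2) (filtWt_le_antigh I J)
    omega
  -- raising the order `t` of the remainder step by step
  have key : ∀ t : ℕ, ∃ χ, evalFun u χ ≠ 0 ∧ ∃ z ∈ levelForms F E G P p (k + 1) ℓ,
      ∃ y ∈ mspan (fun l : List (Gen n ι γ κ) =>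
        HasWeight (levelGens F E G P) levelWt (wtBox p k ℓ) l ∧ ((l.map (depWt I)).sum = 0 ∨
          t ≤ (k + 1) * (l.map (filtWt I J)).sum + (l.map (depWt I)).sum)),
        T.delta y = 0 ∧ ofFun χ * a = y + T.delta z := by
    intro t
    induction t with
    | zero =>
      refine ⟨1, by simp, 0, zero_mem _, a,
        mspan_mono (fun l hl => ⟨hl, Or.inr (Nat.zero_le _)⟩) ha, hda, ?_⟩
      rw [ofFun_one, one_mul, map_zero, add_zero]
    | succ t ih =>
      obtain ⟨χ, hχ, z, hz, y, hy, hdy, e⟩ := ih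
      by_cases ht : t % (k + 1) = 0
      -- no monomial has order `t`: this would force the number of dependent antifields to be zero
      · refine ⟨χ, hχ, z, hz, y, mspan_mono (fun l hl => ⟨hl.1, ?_⟩) hy, hdy, e⟩
        rcases Nat.eq_zero_or_pos (l.map (depWt I)).sum with h0 | h0
        · exact Or.inl h0
        · refine Or.inr (Nat.lt_of_le_of_ne (hl.2.resolve_left h0.ne') fun h1 => ?_)
          have hle := hbound l hl.1
          rw [h1, Nat.mul_add_mod, Nat.mod_eq_of_lt (by omega)] at ht
          omega
      · have hy' := shift_raises_order hD hD0 hW0 hDg hbound rfl hy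
        have hyl : y ∈ levelForms F E G P p k ℓ := mspan_mono (fun l hl => hl.1) hy
        set w := t % (k + 1)
        have hDy : D y = T.delta (vecField X y) := by
          simp [D, hdy]
        refine ⟨-((w : ℝ) • q) * χ, ?_, -vecField X y - ofFun ((w : ℝ) • q) * z,
          sub_mem (neg_mem (vecField_solveVec_mem_level hJ hyl)) (ofFun_mul_mem _ hz),
          D y - ofFun ((w : ℝ) • q) * y, hy', ?_, ?_⟩
        · rw [map_mul, map_neg, map_smul]
          exact mul_ne_zero (neg_ne_zero.2 (smul_ne_zero (by exact_mod_cast ht) hq)) hχ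
        · rw [map_sub, hDy, T.delta_delta, T.delta_ofFun_mul, hdy, mul_zero, sub_zero]
        · rw [ofFun_mul, ofFun_neg, mul_assoc, e, hDy, map_sub, map_neg, T.delta_ofFun_mul]
          rw [neg_mul, mul_add]
          abel
  -- this order exceeds the largest possible one, `(k + 1) 2k + k`
  obtain ⟨χ, hχ, z, hz, y', hy', hdy, e⟩ := key ((k + 1) * (2 * k) + k + 1)
  refine ⟨χ, hχ, z, hz, y', mspan_mono (fun l hl => ⟨fun g hg => ?_, hl.1.2⟩) hy', hdy, e⟩
  have hl0 : (l.map (depWt I)).sum = 0 := by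
    refine hl.2.resolve_right fun hl2 => ?_
    have h1 := hbound l hl.1
    have h2 := Nat.mul_le_mul_left (k + 1) (hbound' l hl.1)
    omega
  have hg0 : depWt I g = 0 := List.sum_eq_zero_iff.1 hl0 _ (List.mem_map_of_mem hg)
  have hgl := hl.1.1 g hg
  rcases g with (_ | _ | ⟨i, K⟩ | ⟨Δ, K⟩) | (_ | ⟨α, K⟩)
  case inl.afField =>
    change (i, K) ∈ I
    by_contra he
    simp [depWt, he] at hg0
  all_goals first
    | exact hgl
    | simp [depWt] at hg0

end Reduction

/-! ### Smooth local inverses and cutoffs -/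

section Inverse

open Topology

theorem exists_contDiff_local_inverse {V : Type*} [NormedAddCommGroup V] [NormedSpace ℝ V]
    [FiniteDimensional ℝ V] {f : V → V} (hf : ContDiff ℝ ∞ f) {v₀ : V} {f' : V ≃L[ℝ] V}
    (hf' : HasFDerivAt f (f' : V →L[ℝ] V) v₀) :
    ∃ φ : V → V, ContDiff ℝ ∞ φ ∧ (∀ᶠ v in 𝓝 v₀, φ (f v) = v) ∧
      ∀ᶠ w in 𝓝 (f v₀), f (φ w) = w := by
  have : CompleteSpace V := FiniteDimensional.complete ℝ V
  let e := (hf.contDiffAt (x := v₀)).toOpenPartialHomeomorph f hf' (by simp)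
  have he : ∀ v, e v = f v := fun v => rfl
  have hv₀ : v₀ ∈ e.source := ContDiffAt.mem_toOpenPartialHomeomorph_source _ hf' (by simp)
  -- the derivative stays invertible near `v₀`, so that the inverse is smooth on a neighbourhood
  let R : Set V := {v | fderiv ℝ f v ∈ Set.range ((↑) : (V ≃L[ℝ] V) → V →L[ℝ] V)}
  have hR : IsOpen R :=
    (ContinuousLinearEquiv.isOpen (𝕜 := ℝ)).preimage (hf.continuous_fderiv (by simp))
  have hv₀R : v₀ ∈ R := ⟨f', hf'.fderiv.symm⟩
  let O : Set V := e.target ∩ e.symm ⁻¹' R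
  have hO : IsOpen O := e.isOpen_inter_preimage_symm hR
  have hw₀ : f v₀ ∈ O := ⟨e.map_source hv₀, by
    change e.symm (e v₀) ∈ R
    rwa [e.left_inv hv₀]⟩
  have hsymm : ∀ w ∈ O, ContDiffAt ℝ ∞ e.symm w := by
    rintro w ⟨hw, g', hg'⟩
    refine e.contDiffAt_symm hw (f₀' := g') ?_ hf.contDiffAt
    rw [hg']
    exact (hf.differentiable (by simp) _).hasFDerivAt
  obtain ⟨r, hr, hball⟩ := Metric.isOpen_iff.1 hO (f v₀) hw₀
  let χ : ContDiffBump (f v₀) := ⟨r / 4, r / 2, by positivity, by linarith⟩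
  refine ⟨fun w => χ w • e.symm w, ?_, ?_, ?_⟩
  · rw [contDiff_iff_contDiffAt]
    intro w
    by_cases hw : w ∈ tsupport χ
    · refine χ.contDiffAt.smul (hsymm w (hball ?_))
      rw [χ.tsupport_eq, Metric.mem_closedBall] at hw
      rw [Metric.mem_ball]
      change dist w (f v₀) ≤ r / 2 at hw
      linarith
    · refine (contDiffAt_const (c := (0 : V))).congr_of_eventuallyEq ?_
      filter_upwards [notMem_tsupport_iff_eventuallyEq.1 hw] with y hy
      rw [hy, Pi.zero_apply, zero_smul]
  · have h1 : ∀ᶠ v in 𝓝 v₀, f v ∈ Metric.closedBall (f v₀) (r / 4) :=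
      hf.continuous.continuousAt (Metric.closedBall_mem_nhds _ (by positivity))
    filter_upwards [h1, e.open_source.mem_nhds hv₀] with v hv hvs
    rw [χ.one_of_mem_closedBall hv, one_smul]
    exact e.left_inv hvs
  · filter_upwards [Metric.closedBall_mem_nhds (f v₀) (show (0 : ℝ) < r / 4 by positivity),
      e.open_target.mem_nhds hw₀.1] with w hw hwt
    rw [χ.one_of_mem_closedBall hw, one_smul]
    exact e.right_inv hwt

variable {n : ℕ} {ι : Type*}

theorem exists_cutoff (S : Finset (Coord n ι)) {v₀ : S → ℝ} {U : Set (S → ℝ)} (hU : U ∈ 𝓝 v₀) :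
    ∃ χ : LocFun n ι, (∀ u : Coord n ι → ℝ, (fun s : S => u s) ∉ U → evalFun u χ = 0) ∧
      ∀ u : Coord n ι → ℝ, (fun s : S => u s) = v₀ → evalFun u χ = 1 := by
  obtain ⟨f, hs, -, hf, -, h1⟩ := exists_contDiff_tsupport_subset (n := ⊤) hU
  refine ⟨ofSmooth S f hf, fun u hu => ?_, fun u hu => ?_⟩
  · rw [evalFun_ofSmooth]
    by_contra h
    exact hu (hs (subset_tsupport f h))
  · rw [evalFun_ofSmooth, hu, h1]

/-- Coordinates that can be replaced by functions with linearly independent differentials. -/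
theorem exists_coordinates {σ : Type*} [Finite σ] {τ : Type*} {w : σ → τ → ℝ}
    (hw : LinearIndependent ℝ w) :
    ∃ c : σ → τ, c.Injective ∧ LinearIndependent ℝ fun (a : σ) (b : σ) => w b (c a) := by
  have := Fintype.ofFinite σ
  classical
  let v : τ → σ → ℝ := fun t a => w a t
  have hspan : Submodule.span ℝ (Set.range v) = ⊤ := by
    by_contra hne
    obtain ⟨f, hf0, hf⟩ := Submodule.exists_le_ker_of_lt_top _ (lt_top_iff_ne_top.2 hne)
    refine hf0 (LinearMap.pi_ext' fun a => LinearMap.ext_ring ?_)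
    refine Fintype.linearIndependent_iff.1 hw (fun a => f (Pi.single a 1)) ?_ a
    funext t
    have h1 : f (v t) = 0 := hf (Submodule.subset_span ⟨t, rfl⟩)
    rw [LinearMap.pi_apply_eq_sum_univ f (v t)] at h1
    rw [Finset.sum_apply, Pi.zero_apply, ← h1]
    refine Finset.sum_congr rfl fun a _ => ?_
    rw [Pi.smul_apply, smul_eq_mul, smul_eq_mul, mul_comm]
    congr 2
    funext b
    simp [Pi.single_apply, eq_comm]
  obtain ⟨κ, a, ha, hsp, hli⟩ := exists_linearIndependent' ℝ v
  let e : σ ≃ κ := (Pi.basisFun ℝ σ).indexEquiv (Module.Basis.mk hli (hsp.trans hspan).ge)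
  exact ⟨a ∘ e, ha.comp e.injective, hli.comp e e.injective⟩

end Inverse

/-! ### The Koszul complex of independent equations -/

section Koszul

variable {n : ℕ} {ι γ κ : Type*}

open GaugeData (af)

theorem vecField_congr_left {X X' : Gen n ι γ κ → Form n ι γ κ} {χ : LocFun n ι}
    (h : ∀ g, ofFun χ * X g = ofFun χ * X' g) (a : Form n ι γ κ) :
    ofFun χ * vecField X a = ofFun χ * vecField X' a := by
  obtain ⟨S, hS⟩ := exists_rder_support a
  rw [vecField_eq_sum X hS, vecField_eq_sum X' hS, Finset.mul_sum, Finset.mul_sum]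
  refine Finset.sum_congr rfl fun g _ => ?_
  rw [← mul_assoc, ofFun_mul_comm, mul_assoc, h, ← mul_assoc, ← ofFun_mul_comm, mul_assoc]

theorem coeffOp_mul_ofFun (φ : LocFun n ι →ₐ[ℝ] LocFun n ι) (a : Form n ι γ κ) (f : LocFun n ι) :
    coeffOp φ.toLinearMap (a * ofFun f) = coeffOp φ.toLinearMap a * ofFun (φ f) := by
  induction a using tens_induction with
  | h0 => simp
  | ht f' b =>
    rw [ofFun, ofFun, tens_mul_tens, coeffOp_tens, coeffOp_tens, tens_mul_tens]
    simp
  | hadd a b ha hb => rw [add_mul, map_add, map_add, ha, hb, add_mul]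

theorem coeffOp_scaleInt_mul_coord {A : Set (Coord n ι)} {c : Coord n ι} (hc : c ∈ A) (m : ℕ)
    (a : Form n ι γ κ) : coeffOp (scaleInt A m) (a * ofFun (coord c)) =
      coeffOp (scaleInt A (m + 1)) a * ofFun (coord c) := by
  induction a using tens_induction with
  | h0 => simp
  | ht f' b =>
    rw [ofFun, tens_mul_tens, coeffOp_tens, coeffOp_tens, tens_mul_tens,
      scaleInt_mul_coord_of_mem hc]
  | hadd a b ha hb => rw [add_mul, map_add, map_add, ha, hb, add_mul]

open Classical in
/-- The components of the Koszul differential of the functions `Y`: the antifield of `e` is mapped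
to `-Y e`. -/
def koszulVec (I : Finset (ι × MI n)) (Y : I → LocFun n ι) : Gen n ι γ κ → Form n ι γ κ
  | Sum.inl (OddGen.afField i K) => if h : (i, K) ∈ I then -ofFun (Y ⟨(i, K), h⟩) else 0
  | _ => 0

variable {I : Finset (ι × MI n)}

theorem koszulVec_af (Y : I → LocFun n ι) (e : I) :
    koszulVec I Y (Sum.inl (OddGen.afField e.1.1 e.1.2) : Gen n ι γ κ) = -ofFun (Y e) := by
  simp [koszulVec]

theorem koszulVec_eq (Y : I → LocFun n ι) (g : Gen n ι γ κ) :
    (∃ e, g = Sum.inl (OddGen.afField e.1.1 e.1.2) ∧ koszulVec I Y g = -ofFun (Y e)) ∨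
      ∀ Y' : I → LocFun n ι, koszulVec I Y' g = 0 := by
  rcases g with (_ | _ | ⟨i, K⟩ | ⟨Δ, K⟩) | (_ | ⟨α, K⟩)
  case inl.afField =>
    by_cases h : (i, K) ∈ I
    · exact Or.inl ⟨⟨(i, K), h⟩, rfl, koszulVec_af Y ⟨(i, K), h⟩⟩
    · exact Or.inr fun _ => by simp [koszulVec, h]
  all_goals exact Or.inr fun _ => rfl

theorem par_koszulVec (Y : I → LocFun n ι) (g : Gen n ι γ κ) :
    par (koszulVec I Y g) = -(psign g • koszulVec I Y g) := by
  rcases koszulVec_eq Y g with ⟨e, rfl, h⟩ | h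
  · rw [h, map_neg, par_ofFun, psign, neg_one_smul, neg_neg]
  · rw [h]
    simp

/-- The Koszul differential of the functions `Y`. -/
abbrev koszul (Y : I → LocFun n ι) : Form n ι γ κ →ₗ[ℝ] Form n ι γ κ := vecField (koszulVec I Y)

theorem coeffOp_koszul (φ : LocFun n ι →ₐ[ℝ] LocFun n ι) (Y : I → LocFun n ι) (a : Form n ι γ κ) :
    coeffOp φ.toLinearMap (koszul Y a) = koszul (fun e => φ (Y e)) (coeffOp φ.toLinearMap a) := by
  obtain ⟨S, hS⟩ := exists_rder_support a
  rw [koszul, koszul, vecField_eq_sum _ hS, vecField_eq_sum (S := S) _ (fun g hg => by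
    rw [← coeffOp_rder, hS g hg, map_zero]), map_sum]
  refine Finset.sum_congr rfl fun g _ => ?_
  rw [← coeffOp_rder]
  rcases koszulVec_eq Y g with ⟨e, rfl, h⟩ | h
  · rw [h, koszulVec_af, mul_neg, map_neg, coeffOp_mul_ofFun, mul_neg]
  · rw [h, h, mul_zero, mul_zero, map_zero]

theorem coeffOp_scaleInt_koszul {c : I → Coord n ι} (m : ℕ) (a : Form n ι γ κ) :
    coeffOp (scaleInt (Set.range c) m) (koszul (fun e => coord (c e)) a) =
      koszul (fun e => coord (c e)) (coeffOp (scaleInt (Set.range c) (m + 1)) a) := by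
  obtain ⟨S, hS⟩ := exists_rder_support a
  rw [koszul, vecField_eq_sum _ hS, vecField_eq_sum (S := S) _ (fun g hg => by
    rw [← coeffOp_rder, hS g hg, map_zero]), map_sum]
  refine Finset.sum_congr rfl fun g _ => ?_
  rw [← coeffOp_rder]
  rcases koszulVec_eq (fun e => coord (c e)) g with ⟨e, rfl, h⟩ | h
  · rw [h, mul_neg, map_neg, coeffOp_scaleInt_mul_coord (Set.mem_range_self e), mul_neg]
  · rw [h, mul_zero, mul_zero, map_zero]

/-- The differential `∑ (∂/∂c_e) φ*_e` along the coordinates `c_e`. -/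
def coordDiff (c : I → Coord n ι) : Form n ι γ κ →ₗ[ℝ] Form n ι γ κ :=
  ∑ e, (LinearMap.mulRight ℝ (af e.1)).comp (coeffOp (pder (c e)))

theorem coordDiff_apply (c : I → Coord n ι) (a : Form n ι γ κ) :
    coordDiff c a = ∑ e, coeffOp (pder (c e)) a * af e.1 := by
  simp [coordDiff]

theorem coordDiff_isOddDer (c : I → Coord n ι) :
    IsOddDer (coordDiff c : Form n ι γ κ →ₗ[ℝ] Form n ι γ κ) := by
  intro a b
  simp only [coordDiff_apply, Finset.mul_sum, Finset.sum_mul, ← Finset.sum_add_distrib]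
  refine Finset.sum_congr rfl fun e _ => ?_
  rw [coeffOp_isEvenDer fun f g => pder_mul (c e) f g, AlgHom.id_apply, add_mul, mul_assoc,
    mul_assoc, mul_assoc, af, inl_mul, par_par]

theorem coordDiff_par (c : I → Coord n ι) (a : Form n ι γ κ) :
    coordDiff c (par a) = -par (coordDiff c a) := by
  simp only [coordDiff_apply, map_sum, map_mul, coeffOp_par, GaugeData.par_af, mul_neg,
    Finset.sum_neg_distrib, neg_neg]

theorem coordDiff_ofFun (c : I → Coord n ι) (f : LocFun n ι) :
    (coordDiff c (ofFun f) : Form n ι γ κ) = ∑ e, ofFun (pder (c e) f) * af e.1 := by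
  simp only [coordDiff_apply, coeffOp_ofFun]

theorem coordDiff_gen (c : I → Coord n ι) (g : Gen n ι γ κ) : coordDiff c (gen g) = 0 := by
  rw [coordDiff_apply]
  exact Finset.sum_eq_zero fun e _ => by rw [coeffOp_gen (pder_one _), zero_mul]

theorem coordDiff_mem {F : Set (Gen n ι γ κ)} (c : I → Coord n ι) {p k ℓ : ℤ} {a : Form n ι γ κ}
    (ha : a ∈ levelForms F I ∅ ∅ p k ℓ) : coordDiff c a ∈ levelForms F I ∅ ∅ p (k + 1) ℓ := by
  refine map_mspan (fun f l hl => ?_) ha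
  rw [coordDiff_apply]
  refine sum_mem fun e _ => ?_
  rw [coeffOp_mon, mul_assoc, af, ← mon_singleton, ← mon_append]
  refine ofFun_mul_mon_mem ⟨fun g hg => ?_, ?_⟩ _
  · rcases List.mem_append.1 hg with h | h
    · exact hl.1 g h
    · rw [List.mem_singleton.1 h]
      exact af_mem_level e.2
  · rw [List.map_append, List.sum_append]
    obtain ⟨h1, h2, h3⟩ := hl.2
    refine ⟨?_, ?_, ?_⟩ <;> simp [levelWt, formDeg, antigh, h1, h2, h3]

/-- The anticommutator of the Koszul differential of coordinates with the differential along these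
coordinates is minus the Euler operator. -/
theorem koszul_coordDiff_add {F : Set (Gen n ι γ κ)} {c : I → Coord n ι} (hc : c.Injective)
    (f : LocFun n ι) {l : List (Gen n ι γ κ)} {p k ℓ : ℤ}
    (hl : HasWeight (levelGens F I ∅ ∅) levelWt (wtBox p k ℓ) l) :
    koszul (fun e => coord (c e)) (coordDiff c (ofFun f * mon l)) +
      coordDiff c (koszul (fun e => coord (c e)) (ofFun f * mon l)) =
      -(ofFun ((k : ℝ) • f + ∑ e, pder (c e) f * coord (c e)) * mon l) := by
  let V : Form n ι γ κ →ₗ[ℝ] Form n ι γ κ := koszul (fun e => coord (c e)) ∘ₗ coordDiff c +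
    coordDiff c ∘ₗ koszul (fun e => coord (c e))
  have hV : IsEvenDer V := (vecField_isOddDer (par_koszulVec _)).anticommutator
    (coordDiff_isOddDer c) (vecField_par_odd (par_koszulVec _)) (coordDiff_par c)
  have hVg : ∀ g ∈ levelGens F I ∅ ∅, V (gen g) = -((antigh g : ℝ) • gen g) := by
    intro g hg
    simp only [V, LinearMap.add_apply, LinearMap.comp_apply, coordDiff_gen, map_zero, zero_add,
      vecField_gen]
    rcases g with (_ | _ | ⟨i, K⟩ | ⟨Δ, K⟩) | (_ | ⟨α, K⟩)
    case inl.afField =>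
      rw [koszulVec_af (γ := γ) (κ := κ) (fun e => coord (c e)) ⟨(i, K), hg⟩, map_neg,
        coordDiff_ofFun, Finset.sum_eq_single_of_mem ⟨(i, K), hg⟩ (Finset.mem_univ _)]
      · simp [pder_coord, ofFun_one, antigh, af]
      · intro e _ he
        rw [pder_coord, if_neg (hc.ne he), ofFun_zero, zero_mul]
    case inl.afRed => exact absurd hg (Finset.notMem_empty _)
    case inr.afGauge => exact absurd hg (Finset.notMem_empty _)
    all_goals simp [koszulVec, antigh]
  have hVf : V (ofFun f) = -ofFun (∑ e, pder (c e) f * coord (c e)) := by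
    simp only [V, LinearMap.add_apply, LinearMap.comp_apply, coordDiff_ofFun, vecField_ofFun,
      map_zero, add_zero, map_sum, vecField_ofFun_mul, af, vecField_gen, koszulVec_af, mul_neg,
      Finset.sum_neg_distrib, ofFun_sum, ofFun_mul]
  have hVl : ∀ l : List (Gen n ι γ κ), (∀ g ∈ l, g ∈ levelGens F I ∅ ∅) →
      V (mon l) = -((((l.map levelWt).sum.2.1 : ℤ) : ℝ) • mon l) := by
    intro l hl
    induction l with
    | nil => simp [mon_nil, hV.map_one]
    | cons g l ih =>
      rw [mon_cons, hV, ih fun g' hg' => hl g' (by simp [hg']), hVg g (hl g (by simp)),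
        AlgHom.id_apply, mul_neg, neg_mul, ← neg_add, mul_smul_comm, smul_mul_assoc, ← add_smul,
        List.map_cons, List.sum_cons]
      simp [levelWt, add_comm]
  change V (ofFun f * mon l) = _
  rw [hV, hVl l hl.1, hVf, hl.2.2.1, AlgHom.id_apply, ofFun_add, ofFun_smul, add_mul, neg_add,
    mul_neg, mul_smul_comm, smul_mul_assoc, neg_mul]

/-- The Koszul complex of coordinate functions is acyclic in positive degree. The Euler operator
plus `k` is inverted by the scaling integral with `t^(k - 1)`, applied to the coefficients. -/
theorem exists_koszul_coord_eq {F : Set (Gen n ι γ κ)} {c : I → Coord n ι} (hc : c.Injective)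
    {p ℓ : ℤ} {k : ℕ} (hk : 0 < k) {a : Form n ι γ κ} (ha : a ∈ levelForms F I ∅ ∅ p k ℓ)
    (hd : koszul (fun e => coord (c e)) a = 0) :
    ∃ z ∈ levelForms F I ∅ ∅ p (k + 1) ℓ, a = koszul (fun e => coord (c e)) z := by
  classical
  obtain ⟨m, rfl⟩ := Nat.exists_eq_add_of_le' hk
  have h : a ∈ LinearMap.ker (coeffOp (scaleInt (Set.range c) m) ∘ₗ
      (koszul (fun e => coord (c e)) ∘ₗ coordDiff c +
        coordDiff c ∘ₗ koszul (fun e => coord (c e))) + LinearMap.id) := by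
    refine mspan_le (fun f l hl => ?_) ha
    obtain ⟨S, hS⟩ := exists_dependsOn f
    rw [LinearMap.mem_ker, LinearMap.add_apply, LinearMap.comp_apply, LinearMap.add_apply,
      LinearMap.comp_apply, LinearMap.comp_apply, koszul_coordDiff_add hc f hl, map_neg,
      coeffOp_mon, LinearMap.id_apply, neg_add_eq_zero]
    congr 2
    have h1 := smul_scaleInt_add_sum (Set.range c) m
      (hS.mono (T := S ∪ Finset.univ.image c) Finset.subset_union_left)
    have h2 : @Finset.filter _ (fun x => x ∈ Set.range c) (fun _ => Classical.propDecidable _)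
        (S ∪ Finset.univ.image c) = Finset.univ.image c := by
      ext x
      simp only [Finset.mem_filter, Finset.mem_union, Finset.mem_image, Finset.mem_univ, true_and,
        Set.mem_range]
      tauto
    rw [h2, Finset.sum_image hc.injOn] at h1
    rw [map_add, map_smul, map_sum]
    simp only [scaleInt_mul_coord_of_mem (Set.mem_range_self _)]
    convert h1 using 2
    · push_cast
      rfl
    · exact Finset.sum_congr rfl fun e _ => mul_comm _ _
  refine ⟨-coeffOp (scaleInt (Set.range c) (m + 1)) (coordDiff c a),
    neg_mem (coeffOp_mem _ (coordDiff_mem c ha)), ?_⟩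
  rw [map_neg, ← coeffOp_scaleInt_koszul]
  rw [LinearMap.mem_ker, LinearMap.add_apply, LinearMap.comp_apply, LinearMap.add_apply,
    LinearMap.comp_apply, LinearMap.comp_apply, hd, map_zero, add_zero, LinearMap.id_apply] at h
  exact (neg_eq_of_add_eq_zero_right h).symm

theorem delta_eq_koszul (T : GaugeData n ι γ κ) {F : Set (Gen n ι γ κ)} {p k ℓ : ℤ}
    {a : Form n ι γ κ} (ha : a ∈ levelForms F I ∅ ∅ p k ℓ) :
    T.delta a = koszul (fun e : I => T.eqn e.1) a := by
  let V : Form n ι γ κ →ₗ[ℝ] Form n ι γ κ := T.delta - koszul (fun e : I => T.eqn e.1)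
  have hV : IsOddDer V := IsDer.sub T.delta_isOddDer (vecField_isOddDer (par_koszulVec _))
  have hf : ∀ f, V (ofFun f) = 0 := fun f => by
    rw [LinearMap.sub_apply, T.delta_ofFun, vecField_ofFun, sub_zero]
  have h1 : a ∈ LinearMap.ker V := by
    refine mspan_le (fun f l hl => ?_) ha
    have h2 : V (mon l) ∈ (⊥ : Submodule ℝ (Form n ι γ κ)) := by
      refine hV.map_mon_mem par_gen_exists (by rw [← ofFun_one, hf]) l ?_
      rintro l₁ g l₂ rfl
      have hg := hl.1 g (by simp)
      have h3 : V (gen g) = 0 := by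
        rw [LinearMap.sub_apply, T.delta_gen, vecField_gen]
        rcases g with (_ | _ | ⟨i, K⟩ | ⟨Δ, K⟩) | (_ | ⟨α, K⟩)
        case inl.afField =>
          have hg' : (i, K) ∈ I := hg
          simp [koszulVec, hg', GaugeData.deltaGen]
        case inl.afRed => exact absurd hg (Finset.notMem_empty _)
        case inr.afGauge => exact absurd hg (Finset.notMem_empty _)
        all_goals simp [koszulVec, GaugeData.deltaGen]
      rw [h3, mul_zero, zero_mul]
      exact zero_mem _
    rw [LinearMap.mem_ker, hV, (Submodule.mem_bot ℝ).1 h2, hf, mul_zero, zero_mul, add_zero]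
  exact sub_eq_zero.1 h1

/-- Near a point where their differentials are independent, the functions `Y` are coordinates: there
are maps `Ψ` and `Φ` of jet space, inverse to each other near this point, such that `Ψ` pulls the
coordinates `c` back to `Y`. They are given by the homomorphisms `ψ` and `φ` of local functions, and
the cutoffs `χ` and `χ'` restrict to the neighbourhoods where the maps are inverse to each other. -/
theorem exists_coordinate_change {Y : I → LocFun n ι} {u : Coord n ι → ℝ}
    (hlin : LinearIndependent ℝ fun (e : I) (c : Coord n ι) => evalFun u (pder c (Y e))) :
    ∃ (c : I → Coord n ι) (φ ψ : LocFun n ι →ₐ[ℝ] LocFun n ι) (χ χ' : LocFun n ι), c.Injective ∧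
      (∀ e, ψ (coord (c e)) = Y e) ∧ (∀ e, χ * φ (Y e) = χ * coord (c e)) ∧
      (∀ f, χ' * ψ (φ f) = χ' * f) ∧ evalFun u (ψ χ) ≠ 0 ∧ evalFun u χ' ≠ 0 := by
  classical
  obtain ⟨c, hc, hcl⟩ := exists_coordinates hlin
  obtain ⟨S₀, hS₀⟩ := exists_dependsOn_family Finset.univ Y
  let S := S₀ ∪ Finset.univ.image c
  have hS : ∀ e, DependsOn (Y e) S := fun e =>
    (hS₀ e (Finset.mem_univ e)).mono Finset.subset_union_left
  have hcS : ∀ e, c e ∈ S := fun e =>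
    Finset.mem_union_right _ (Finset.mem_image_of_mem c (Finset.mem_univ e))
  choose y hy hyY using hS
  -- `Ψ` replaces the coordinates `c e` by the functions `Y e` and keeps all others
  let Ψ : (S → ℝ) → S → ℝ := fun v s => if h : ∃ e, c e = s.1 then y h.choose v else v s
  have hΨc : ∀ v e, Ψ v ⟨c e, hcS e⟩ = y e v := by
    intro v e
    have h : ∃ e', c e' = c e := ⟨e, rfl⟩
    have : Ψ v ⟨c e, hcS e⟩ = y h.choose v := dif_pos h
    rw [this, hc h.choose_spec]
  have hΨn : ∀ v (s : S), (¬ ∃ e, c e = s.1) → Ψ v s = v s := fun v s h => dif_neg h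
  have hΨ : ContDiff ℝ ∞ Ψ := by
    rw [contDiff_pi]
    intro s
    by_cases h : ∃ e, c e = s.1
    · obtain ⟨e, he⟩ := h
      obtain rfl : s = ⟨c e, hcS e⟩ := Subtype.ext he.symm
      simpa only [hΨc] using hy e
    · simp only [hΨn _ s h]
      exact contDiff_apply ℝ ℝ s
  let v₀ : S → ℝ := fun s => u s
  let L := fderiv ℝ Ψ v₀
  have hL : HasFDerivAt Ψ L v₀ := (hΨ.differentiable (by simp) _).hasFDerivAt
  have hLs : ∀ w s, L w s = fderiv ℝ (fun v => Ψ v s) v₀ w := fun w s => by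
    rw [(hasFDerivAt_pi'.1 hL s).fderiv]
    rfl
  -- a vector in the kernel of the derivative only has components along the `c e`, and these vanish
  -- because the corresponding minor of the Jacobian is invertible
  have hinj : Function.Injective L := by
    rw [injective_iff_map_eq_zero]
    intro w hw
    have hwn : ∀ s : S, (¬ ∃ e, c e = s.1) → w s = 0 := by
      intro s hs
      have h1 := hLs w s
      simp only [hΨn _ s hs] at h1
      have h2 : fderiv ℝ (fun v : S → ℝ => v s) v₀ = ContinuousLinearMap.proj s :=
        (ContinuousLinearMap.proj s : (S → ℝ) →L[ℝ] ℝ).fderiv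
      rw [hw, h2] at h1
      exact h1.symm
    have hwc : ∑ e, w ⟨c e, hcS e⟩ • (fun b => evalFun u (pder (c e) (Y b))) = 0 := by
      funext b
      have h1 := hLs w ⟨c b, hcS b⟩
      simp only [hΨc] at h1
      rw [hw, fderiv_eq_sum (Y b) (hy b) (hyY b) u] at h1
      rw [Finset.sum_apply, Pi.zero_apply]
      refine Eq.trans ?_ h1.symm
      rw [← Finset.sum_subset (Finset.subset_univ (Finset.univ.image fun e => (⟨c e, hcS e⟩ : S)))]
      · rw [Finset.sum_image fun e _ e' _ h => hc (congrArg Subtype.val h)]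
        rfl
      · intro s _ hs
        rw [hwn s, zero_mul]
        rintro ⟨e, he⟩
        exact hs (Finset.mem_image.2 ⟨e, Finset.mem_univ e, Subtype.ext he⟩)
    have hw0 := Fintype.linearIndependent_iff.1 hcl _ hwc
    funext s
    by_cases hs : ∃ e, c e = s.1
    · obtain ⟨e, he⟩ := hs
      obtain rfl : s = ⟨c e, hcS e⟩ := Subtype.ext he.symm
      exact hw0 e
    · exact hwn s hs
  let L' : (S → ℝ) ≃L[ℝ] (S → ℝ) :=
    (LinearEquiv.ofInjectiveEndo (L : (S → ℝ) →ₗ[ℝ] (S → ℝ)) hinj).toContinuousLinearEquiv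
  have hL' : HasFDerivAt Ψ (L' : (S → ℝ) →L[ℝ] (S → ℝ)) v₀ := by
    convert hL using 1
    ext w s
    rfl
  obtain ⟨Φ, hΦ, hΦΨ, hΨΦ⟩ := exists_contDiff_local_inverse hΨ hL'
  obtain ⟨χ, hχ0, hχ1⟩ := exists_cutoff S hΨΦ
  obtain ⟨χ', hχ'0, hχ'1⟩ := exists_cutoff S hΦΨ
  let ψ := pullback fun x => if h : x ∈ S then
    ofSmooth S (fun v => Ψ v ⟨x, h⟩) (contDiff_pi.1 hΨ _) else coord x
  let φ := pullback fun x => if h : x ∈ S then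
    ofSmooth S (fun v => Φ v ⟨x, h⟩) (contDiff_pi.1 hΦ _) else coord x
  have hψS : ∀ v (s : S), evalFun v (ψ (coord s.1)) = Ψ (fun s => v s) s := by
    intro v s
    rw [pullback_coord, dif_pos s.2, evalFun_ofSmooth]
  have hφS : ∀ v (s : S), evalFun v (φ (coord s.1)) = Φ (fun s => v s) s := by
    intro v s
    rw [pullback_coord, dif_pos s.2, evalFun_ofSmooth]
  refine ⟨c, φ, ψ, χ, χ', hc, fun e => ?_, fun e => ?_, fun f => ?_, ?_, ?_⟩
  · refine locFun_ext fun v => ?_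
    rw [hψS v ⟨c e, hcS e⟩, hΨc, hyY]
  · refine locFun_ext fun v => ?_
    rw [map_mul, map_mul, evalFun_coord]
    by_cases hv : Ψ (Φ fun s : S => v s) = fun s : S => v s
    · congr 1
      rw [evalFun_pullback, hyY, ← hΨc]
      have h1 : (fun s : S => (fun x => evalFun v (if h : x ∈ S then
          ofSmooth S (fun v => Φ v ⟨x, h⟩) (contDiff_pi.1 hΦ _) else coord x)) s.1) =
          Φ fun s : S => v s := funext fun s => hφS v s
      rw [h1, hv]
    · rw [hχ0 v hv, zero_mul, zero_mul]
  · refine locFun_ext fun v => ?_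
    rw [map_mul, map_mul]
    by_cases hv : Φ (Ψ fun s : S => v s) = fun s : S => v s
    · congr 1
      rw [evalFun_pullback, evalFun_pullback]
      congr 2
      funext x
      by_cases hx : x ∈ S
      · refine (hφS _ ⟨x, hx⟩).trans ?_
        have h1 : (fun s : S => (fun x => evalFun v (if h : x ∈ S then
            ofSmooth S (fun v => Ψ v ⟨x, h⟩) (contDiff_pi.1 hΨ _) else coord x)) s.1) =
            Ψ fun s : S => v s := funext fun s => hψS v s
        rw [h1, hv]
      · rw [dif_neg hx, evalFun_coord, dif_neg hx, evalFun_coord]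
    · rw [hχ'0 v hv, zero_mul, zero_mul]
  · rw [evalFun_pullback, hχ1]
    · exact one_ne_zero
    · exact funext fun s => hψS u s
  · rw [hχ'1 u rfl]
    exact one_ne_zero

/-- Near a point where the differentials of the equations in `I` are independent, the cycles that
involve no other antifields than those of these equations are boundaries. -/
theorem exists_koszul_eq (T : GaugeData n ι γ κ) {u : Coord n ι → ℝ}
    (hlin : LinearIndependent ℝ fun (e : I) (c : Coord n ι) => evalFun u (pder c (T.eqn e.1)))
    {F : Set (Gen n ι γ κ)} {p ℓ : ℤ} {k : ℕ} (hk : 0 < k) {a : Form n ι γ κ}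
    (ha : a ∈ levelForms F I ∅ ∅ p k ℓ) (hd : T.delta a = 0) :
    ∃ χ, evalFun u χ ≠ 0 ∧ ∃ z ∈ levelForms F I ∅ ∅ p (k + 1) ℓ, ofFun χ * a = T.delta z := by
  obtain ⟨c, φ, ψ, χ, χ', hc, hψ, hφ, hψφ, h1, h2⟩ := exists_coordinate_change hlin
  rw [delta_eq_koszul T ha] at hd
  -- in the new coordinates, `a` is a cycle of the Koszul complex of the coordinates near the point
  have hd' : koszul (fun e => coord (c e)) (ofFun χ * coeffOp φ.toLinearMap a) = 0 := by
    rw [vecField_ofFun_mul, vecField_congr_left (X' := koszulVec I fun e => φ (T.eqn e.1)),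
      ← coeffOp_koszul, hd, map_zero, mul_zero]
    intro g
    rcases koszulVec_eq (fun e => coord (c e)) g with ⟨e, rfl, h⟩ | h
    · rw [h, koszulVec_af, mul_neg, mul_neg, ← ofFun_mul, ← ofFun_mul, hφ]
    · rw [h, h]
  obtain ⟨z, hz, hza⟩ := exists_koszul_coord_eq hc hk (ofFun_mul_mem χ (coeffOp_mem _ ha)) hd'
  refine ⟨χ' * ψ χ, by rw [map_mul]; exact mul_ne_zero h2 h1,
    ofFun χ' * coeffOp ψ.toLinearMap z, ofFun_mul_mem _ (coeffOp_mem _ hz), ?_⟩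
  have h3 : koszul (fun e : I => T.eqn e.1) (coeffOp ψ.toLinearMap z) =
      coeffOp ψ.toLinearMap (koszul (fun e => coord (c e)) z) := by
    rw [coeffOp_koszul]
    simp only [hψ]
  rw [T.delta_ofFun_mul, delta_eq_koszul T (coeffOp_mem _ hz), h3, ← hza]
  have h4 : a ∈ LinearMap.ker (LinearMap.mulLeft ℝ (ofFun (χ' * ψ χ)) -
      LinearMap.mulLeft ℝ (ofFun χ') ∘ₗ coeffOp ψ.toLinearMap ∘ₗ LinearMap.mulLeft ℝ (ofFun χ) ∘ₗ
        coeffOp φ.toLinearMap) := by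
    refine mspan_le (fun f l hl => ?_) ha
    rw [LinearMap.mem_ker, LinearMap.sub_apply, sub_eq_zero]
    simp only [LinearMap.comp_apply, LinearMap.mulLeft_apply, coeffOp_mon, ← mul_assoc,
      ← ofFun_mul, AlgHom.toLinearMap_apply, map_mul]
    rw [mul_right_comm χ', mul_right_comm χ' (ψ χ), hψφ]
  exact sub_eq_zero.1 h4

end Koszul

/-! ### Gluing local solutions -/

section Gluing

variable {n : ℕ} {ι γ κ : Type*}

/-- The value of the coefficients of a local form at a point of jet space. -/
def coeffAt (u : Coord n ι → ℝ) : Form n ι γ κ →ₗ[ℝ] GenAlg n ι γ κ :=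
  ((TensorProduct.lid ℝ (GenAlg n ι γ κ)).toLinearMap.comp
    (LinearMap.rTensor (GenAlg n ι γ κ) (evalFun u).toLinearMap) :
      LocFun n ι ⊗[ℝ] GenAlg n ι γ κ →ₗ[ℝ] GenAlg n ι γ κ)

theorem coeffAt_tens (u : Coord n ι → ℝ) (f : LocFun n ι) (b : GenAlg n ι γ κ) :
    coeffAt u (tens f b) = evalFun u f • b :=
  (congrArg (TensorProduct.lid ℝ (GenAlg n ι γ κ)) (LinearMap.rTensor_tmul _ _ _ _)).trans
    (TensorProduct.lid_tmul _ _)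

theorem coeffAt_ofFun_mul (u : Coord n ι → ℝ) (f : LocFun n ι) (a : Form n ι γ κ) :
    coeffAt u (ofFun f * a) = evalFun u f • coeffAt u a := by
  induction a using tens_induction with
  | h0 => simp
  | ht f' b => rw [ofFun_mul_tens, coeffAt_tens, coeffAt_tens, map_mul, mul_smul]
  | hadd a b ha hb => rw [mul_add, map_add, map_add, ha, hb, smul_add]

/-- A local form vanishes if its coefficients vanish at every point. -/
theorem eq_zero_of_coeffAt {a : Form n ι γ κ} (h : ∀ u, coeffAt u a = 0) : a = 0 := by
  classical
  let b := Module.Basis.ofVectorSpace ℝ (GenAlg n ι γ κ)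
  let e : Form n ι γ κ ≃ₗ[ℝ] (_ →₀ LocFun n ι) :=
    TensorProduct.equivFinsuppOfBasisRight (M := LocFun n ι) b
  have key : ∀ (u : Coord n ι → ℝ) (a : Form n ι γ κ) i,
      b.repr (coeffAt u a) i = evalFun u (e a i) := by
    intro u a i
    induction a using tens_induction with
    | h0 => simp
    | ht f x =>
      have : e (tens f x) i = b.repr x i • f :=
        TensorProduct.equivFinsuppOfBasisRight_apply_tmul_apply b f x i
      rw [this, coeffAt_tens, map_smul, map_smul, Finsupp.smul_apply, smul_eq_mul, smul_eq_mul,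
        mul_comm]
    | hadd a b ha hb => simp only [map_add, Finsupp.add_apply, ha, hb]
  refine e.map_eq_zero_iff.1 (Finsupp.ext fun i => locFun_ext fun u => ?_)
  rw [← key, h]
  simp

theorem exists_coeffAt_eq (a : Form n ι γ κ) : ∃ S : Finset (Coord n ι),
    ∀ u u' : Coord n ι → ℝ, (∀ c ∈ S, u c = u' c) → coeffAt u a = coeffAt u' a := by
  classical
  induction a using tens_induction with
  | h0 => exact ⟨∅, fun u u' _ => by simp⟩
  | ht f b =>
    obtain ⟨S, g, -, hg⟩ := exists_dependsOn f
    refine ⟨S, fun u u' h => ?_⟩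
    rw [coeffAt_tens, coeffAt_tens, hg, hg]
    congr 2
    funext s
    exact h s s.2
  | hadd a b ha hb =>
    obtain ⟨S, hS⟩ := ha
    obtain ⟨S', hS'⟩ := hb
    refine ⟨S ∪ S', fun u u' h => ?_⟩
    rw [map_add, map_add, hS u u' fun c hc => h c (Finset.mem_union_left _ hc),
      hS' u u' fun c hc => h c (Finset.mem_union_right _ hc)]

open Classical in
/-- The extension of a point of a finite dimensional jet space by zero. -/
def extendZero (S : Finset (Coord n ι)) (v : S → ℝ) : Coord n ι → ℝ :=
  fun c => if h : c ∈ S then v ⟨c, h⟩ else 0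

theorem contDiff_evalFun_extendZero (S : Finset (Coord n ι)) (f : LocFun n ι) :
    ContDiff ℝ ∞ fun v => evalFun (extendZero S v) f := by
  obtain ⟨S', g, hg, hf⟩ := exists_dependsOn f
  simp only [hf]
  refine hg.comp (contDiff_pi.2 fun s => ?_)
  by_cases h : s.1 ∈ S
  · simp only [extendZero, h, dif_pos]
    exact contDiff_apply ℝ ℝ _
  · simp only [extendZero, h, dif_neg, not_false_eq_true]
    exact contDiff_const

theorem exists_eq_sum_of_mem_mspan {L : Finset (List (Gen n ι γ κ))} {a : Form n ι γ κ}
    (ha : a ∈ mspan fun l => l ∈ L) : ∃ f : L → LocFun n ι, a = ∑ l, ofFun (f l) * mon l.1 := by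
  classical
  induction ha using Submodule.span_induction with
  | mem x hx =>
    obtain ⟨f, l, hl, rfl⟩ := hx
    refine ⟨Pi.single ⟨l, hl⟩ f, ?_⟩
    rw [Finset.sum_eq_single_of_mem ⟨l, hl⟩ (Finset.mem_univ _)]
    · rw [Pi.single_eq_same]
    · intro l' _ hne
      rw [Pi.single_eq_of_ne hne, ofFun_zero, zero_mul]
  | zero => exact ⟨0, by simp [ofFun_zero]⟩
  | add x y _ _ hx hy =>
    obtain ⟨f, rfl⟩ := hx
    obtain ⟨f', rfl⟩ := hy
    exact ⟨f + f', by simp [ofFun_add, add_mul, Finset.sum_add_distrib]⟩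
  | smul r x _ hx =>
    obtain ⟨f, rfl⟩ := hx
    exact ⟨r • f, by simp [ofFun_smul, Finset.smul_sum]⟩

open Topology Manifold in
/-- An equation `V b = a`, linear over the local functions, that can be solved near every point by
combinations of finitely many monomials has such a solution: the solutions at a point form an affine
space, so that local solutions can be glued with a partition of unity. -/
theorem exists_eq_of_local {V : Form n ι γ κ →ₗ[ℝ] Form n ι γ κ}
    (hV : ∀ f b, V (ofFun f * b) = ofFun f * V b) {L : Finset (List (Gen n ι γ κ))}
    {a : Form n ι γ κ}
    (h : ∀ u, ∃ χ, evalFun u χ ≠ 0 ∧ ∃ b ∈ mspan fun l => l ∈ L, ofFun χ * a = V b) :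
    ∃ b ∈ mspan fun l => l ∈ L, a = V b := by
  classical
  obtain ⟨S₀, hS₀⟩ := exists_coeffAt_eq a
  choose S₁ hS₁ using fun l : List (Gen n ι γ κ) => exists_coeffAt_eq (V (mon l))
  let S := S₀ ∪ L.biUnion S₁
  let t : (S → ℝ) → Set (L → ℝ) := fun v => {w | ∑ l, w l • coeffAt (extendZero S v) (V (mon l.1)) =
    coeffAt (extendZero S v) a}
  have ht : ∀ v, Convex ℝ (t v) := by
    intro v w hw w' hw' r r' _ _ hr
    simp only [t, Set.mem_ofPred_eq] at hw hw' ⊢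
    simp only [Pi.add_apply, Pi.smul_apply, smul_eq_mul, add_smul, mul_smul, Finset.sum_add_distrib,
      ← Finset.smul_sum, hw, hw']
    rw [← add_smul, hr, one_smul]
  obtain ⟨g, hg⟩ := exists_contMDiffMap_forall_mem_convex_of_local 𝓘(ℝ, S → ℝ) (n := ⊤) ht (by
    intro v
    obtain ⟨χ, hχ, b, hb, e⟩ := h (extendZero S v)
    obtain ⟨f, rfl⟩ := exists_eq_sum_of_mem_mspan hb
    have hc := contDiff_evalFun_extendZero S χ
    refine ⟨{v | evalFun (extendZero S v) χ ≠ 0},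
      (isOpen_ne_fun hc.continuous continuous_const).mem_nhds hχ,
      fun v l => evalFun (extendZero S v) (f l) / evalFun (extendZero S v) χ, ?_, ?_⟩
    · rw [contMDiffOn_iff_contDiffOn, contDiffOn_pi]
      exact fun l => (contDiff_evalFun_extendZero S (f l)).contDiffOn.div hc.contDiffOn
        fun v hv => hv
    · intro v hv
      simp only [t, Set.mem_ofPred_eq]
      have h1 := congrArg (coeffAt (extendZero S v)) e
      rw [coeffAt_ofFun_mul, map_sum, map_sum] at h1
      simp only [hV, coeffAt_ofFun_mul] at h1
      simp only [div_eq_inv_mul, mul_smul]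
      rw [← Finset.smul_sum, ← h1, smul_smul, inv_mul_cancel₀ hv, one_smul])
  have hgs : ContDiff ℝ ∞ g := g.contMDiff.contDiff
  refine ⟨∑ l : L, ofFun (ofSmooth S (fun v => g v l) (contDiff_pi.1 hgs l)) * mon l.1,
    sum_mem fun l _ => ofFun_mul_mon_mem l.2 _, ?_⟩
  rw [← sub_eq_zero]
  refine eq_zero_of_coeffAt fun u => ?_
  have h1 := hg fun s => u s
  simp only [t, Set.mem_ofPred_eq] at h1
  have hext : ∀ c ∈ S, extendZero S (fun s => u s) c = u c := fun c hc => by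
    rw [extendZero, dif_pos hc]
  rw [hS₀ _ u fun c hc => hext c (Finset.mem_union_left _ hc)] at h1
  rw [map_sub, ← h1, map_sum, map_sum, ← Finset.sum_sub_distrib]
  refine Finset.sum_eq_zero fun l _ => ?_
  rw [hV, coeffAt_ofFun_mul, evalFun_ofSmooth, hS₁ l.1 _ u fun c hc => hext c
    (Finset.mem_union_right _ (Finset.mem_biUnion.2 ⟨l.1, l.2, hc⟩)), sub_self]

end Gluing

/-! ### Acyclicity of the Koszul-Tate differential -/

section Acyclicity

variable {n : ℕ} {ι γ κ : Type*}

theorem exists_mem_gspan_finset {p k : ℤ} {a : Form n ι γ κ} (ha : a ∈ forms n ι γ κ p k) :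
    ∃ (Γ : Finset (Gen n ι γ κ)) (ℓ : ℤ),
      a ∈ gspan (Γ : Set (Gen n ι γ κ)) levelWt (wtBox p k ℓ) := by
  classical
  rw [forms_eq_gspan] at ha
  induction ha using Submodule.span_induction with
  | mem x hx =>
    obtain ⟨f, l, hl, rfl⟩ := hx
    refine ⟨l.toFinset, (l.map levelWt).sum.2.2, ofFun_mul_mon_mem ⟨by simp, ?_, ?_, le_rfl⟩ _⟩
    · have h1 := congrArg Prod.fst hl.2
      refine Eq.trans ?_ h1
      clear h1 hl
      induction l with
      | nil => rfl
      | cons g l ih => simp [ih, levelWt, bideg]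
    · have h1 := congrArg Prod.snd hl.2
      refine Eq.trans ?_ h1
      clear h1 hl
      induction l with
      | nil => rfl
      | cons g l ih => simp [ih, levelWt, bideg]
  | zero => exact ⟨∅, 0, zero_mem _⟩
  | add x y _ _ hx hy =>
    obtain ⟨Γ, ℓ, hx⟩ := hx
    obtain ⟨Γ', ℓ', hy⟩ := hy
    refine ⟨Γ ∪ Γ', max ℓ ℓ', add_mem (gspan_mono (by simp) ?_ hx) (gspan_mono (by simp) ?_ hy)⟩
    · exact fun w hw => ⟨hw.1, hw.2.1, hw.2.2.trans (le_max_left _ _)⟩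
    · exact fun w hw => ⟨hw.1, hw.2.1, hw.2.2.trans (le_max_right _ _)⟩
  | smul r x _ hx =>
    obtain ⟨Γ, ℓ, hx⟩ := hx
    exact ⟨Γ, ℓ, Submodule.smul_mem _ r hx⟩

theorem levelForms_le_forms {F : Set (Gen n ι γ κ)} {E : Finset (ι × MI n)} {G : Finset (γ × MI n)}
    {P : Finset (κ × MI n)} {p k ℓ : ℤ} : levelForms F E G P p k ℓ ≤ forms n ι γ κ p k := by
  rw [forms_eq_gspan]
  refine mspan_mono fun l hl => ⟨fun _ _ => Set.mem_univ _, ?_⟩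
  rw [Set.mem_singleton_iff, ← hl.2.1, ← hl.2.2.1]
  clear hl
  induction l with
  | nil => rfl
  | cons g l ih => simp [ih, levelWt, bideg]

theorem levelGens_mono {F : Set (Gen n ι γ κ)} {E E' : Finset (ι × MI n)} {G G' : Finset (γ × MI n)}
    {P P' : Finset (κ × MI n)} (hE : E ⊆ E') (hG : G ⊆ G') (hP : P ⊆ P') :
    levelGens F E G P ⊆ levelGens F E' G' P' := by
  rintro ((_ | _ | _ | _) | (_ | _)) hg
  case inl.afField => exact hE hg
  case inl.afRed => exact hP hg
  case inr.afGauge => exact hG hg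
  all_goals exact hg

theorem levelGens_finite {F : Set (Gen n ι γ κ)} (hF : F.Finite) (E : Finset (ι × MI n))
    (G : Finset (γ × MI n)) (P : Finset (κ × MI n)) : (levelGens F E G P).Finite := by
  refine ((((Set.finite_range fun μ : Fin n => (Sum.inl (OddGen.dx μ) : Gen n ι γ κ)).union
    hF).union (E.finite_toSet.image fun e => Sum.inl (OddGen.afField e.1 e.2))).union
    ((G.finite_toSet.image fun g => Sum.inr (EvenGen.afGauge g.1 g.2)).union
    (P.finite_toSet.image fun r => Sum.inl (OddGen.afRed r.1 r.2)))).subset ?_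
  rintro ((μ | _ | ⟨i, I⟩ | ⟨Δ, I⟩) | (_ | ⟨α, I⟩)) hg
  · exact Or.inl (Or.inl (Or.inl ⟨μ, rfl⟩))
  · exact Or.inl (Or.inl (Or.inr hg))
  · exact Or.inl (Or.inr ⟨(i, I), hg, rfl⟩)
  · exact Or.inr (Or.inr ⟨(Δ, I), hg, rfl⟩)
  · exact Or.inl (Or.inl (Or.inr hg))
  · exact Or.inr (Or.inl ⟨(α, I), hg, rfl⟩)

theorem hasWeight_level_finite {Γ : Set (Gen n ι γ κ)} (hΓ : Γ.Finite) (p k ℓ : ℤ) :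
    {l | HasWeight Γ levelWt (wtBox p k ℓ) l}.Finite := by
  have := hΓ.to_subtype
  refine ((List.finite_length_le Γ (k + ℓ).toNat).image (List.map Subtype.val)).subset ?_
  intro l hl
  have hlen : (l.length : ℤ) ≤ (l.map levelWt).sum.2.1 + (l.map levelWt).sum.2.2 := by
    clear hl
    induction l with
    | nil => simp
    | cons g l ih =>
      have hg : 1 ≤ (levelWt g).2.1 + (levelWt g).2.2 := by
        rcases g with (_ | _ | _ | _) | (_ | _) <;> simp [levelWt, antigh]
      simp only [List.length_cons, List.map_cons, List.sum_cons, Prod.snd_add, Prod.fst_add]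
      push_cast
      linarith
  obtain ⟨-, h2, h3⟩ := hl.2
  refine ⟨l.attach.map fun x => ⟨x.1, hl.1 x.1 x.2⟩, ?_, ?_⟩
  · simp only [Set.mem_ofPred_eq, List.length_map, List.length_attach]
    omega
  · rw [List.map_map]
    exact List.attach_map_subtype_val l

/-- Away from the stationary surface, cycles are boundaries, since `δ (a φ*_e) = -𝓛_e a`. -/
theorem exists_eq_of_ne_zero (T : GaugeData n ι γ κ) {F : Set (Gen n ι γ κ)}
    {E : Finset (ι × MI n)} {G : Finset (γ × MI n)} {P : Finset (κ × MI n)} {e : ι × MI n}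
    (he : e ∈ E) {p k ℓ : ℤ} {a : Form n ι γ κ} (ha : a ∈ levelForms F E G P p k ℓ)
    (hd : T.delta a = 0) :
    ∃ b ∈ levelForms F E G P p (k + 1) ℓ, ofFun (T.eqn e) * a = T.delta b := by
  refine ⟨-(a * GaugeData.af e), neg_mem ?_, ?_⟩
  · refine map_mspan (V := LinearMap.mulRight ℝ (GaugeData.af e)) (fun f l hl => ?_) ha
    rw [LinearMap.mulRight_apply, mul_assoc, GaugeData.af, ← mon_singleton, ← mon_append]
    refine ofFun_mul_mon_mem ⟨fun g hg => ?_, ?_⟩ _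
    · rcases List.mem_append.1 hg with h | h
      · exact hl.1 g h
      · rw [List.mem_singleton.1 h]
        exact af_mem_level he
    · rw [List.map_append, List.sum_append]
      obtain ⟨h1, h2, h3⟩ := hl.2
      refine ⟨?_, ?_, ?_⟩ <;> simp [levelWt, formDeg, antigh, h1, h2, h3]
  · rw [map_neg, T.delta_isOddDer, hd, zero_mul, add_zero, GaugeData.af, T.delta_gen,
      GaugeData.deltaGen, mul_neg, neg_neg, ofFun_mul_comm]

/-- The Koszul-Tate differential is acyclic in positive antighost number. -/
theorem GaugeTheory.exists_eq_delta (T : GaugeTheory n ι γ κ) {p k : ℤ} (hk : 0 < k)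
    {a : Form n ι γ κ} (ha : a ∈ forms n ι γ κ p k) (hd : T.delta a = 0) :
    ∃ m ∈ forms n ι γ κ p (k + 1), a = T.delta m := by
  classical
  obtain ⟨k, rfl⟩ : ∃ m : ℕ, k = m := ⟨k.toNat, by omega⟩
  obtain ⟨Γ, ℓ, hΓ⟩ := exists_mem_gspan_finset ha
  obtain ⟨E, G, P, hE, hG, hP, hE', hG', hP', hreg⟩ := T.regular
  have hex : ∀ g : Gen n ι γ κ, ∃ m, g ∈ Γ →
      g ∈ levelGens (Γ : Set (Gen n ι γ κ)) (E m) (G m) (P m) := by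
    rintro ((_ | _ | ⟨i, I⟩ | ⟨Δ, I⟩) | (_ | ⟨α, I⟩))
    case inl.dx => exact ⟨0, fun _ => trivial⟩
    case inl.afField => exact (hE' (i, I)).imp fun m hm _ => hm
    case inl.afRed => exact (hP' (Δ, I)).imp fun m hm _ => hm
    case inr.afGauge => exact (hG' (α, I)).imp fun m hm _ => hm
    all_goals exact ⟨0, fun h => h⟩
  choose m hm using hex
  let M := Γ.sup m
  have haM : a ∈ levelForms (Γ : Set (Gen n ι γ κ)) (E M) (G M) (P M) p k ℓ := by
    refine gspan_mono (fun g hg => ?_) le_rfl hΓ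
    have hgM : m g ≤ M := Finset.le_sup hg
    exact levelGens_mono (hE hgM) (hG hgM) (hP hgM) (hm g hg)
  obtain ⟨hcl, hregM⟩ := hreg M
  have hfin := hasWeight_level_finite
    (levelGens_finite Γ.finite_toSet (E M) (G M) (P M)) p (k + 1) ℓ
  have hspan : mspan (fun l => l ∈ hfin.toFinset) =
      levelForms (Γ : Set (Gen n ι γ κ)) (E M) (G M) (P M) p (k + 1) ℓ := by
    congr 1
    ext l
    simp
  obtain ⟨b, hb, hab⟩ := exists_eq_of_local (V := T.delta) T.delta_ofFun_mul (L := hfin.toFinset)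
    (a := a) (by
    rw [hspan]
    intro u
    by_cases hu : ∀ e ∈ E M, evalFun u (T.eqn e) = 0
    · obtain ⟨I, hI, hlin, hred⟩ := exists_reduction T hcl (hregM u hu)
      obtain ⟨χ, hχ, z, hz, y, hy, hdy, e⟩ := hred _ p k ℓ a haM hd
      obtain ⟨χ', hχ', z', hz', e'⟩ := exists_koszul_eq T.toGaugeData hlin
        (by exact_mod_cast hk) hy hdy
      refine ⟨χ' * χ, by rw [map_mul]; exact mul_ne_zero hχ' hχ, z' + ofFun χ' * z,
        add_mem (gspan_mono (levelGens_mono hI (Finset.empty_subset _) (Finset.empty_subset _))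
          le_rfl hz') (ofFun_mul_mem _ hz), ?_⟩
      rw [map_add, T.delta_ofFun_mul, ← e', ofFun_mul, mul_assoc, e, mul_add]
    · push Not at hu
      obtain ⟨e, he, hne⟩ := hu
      exact ⟨T.eqn e, hne, exists_eq_of_ne_zero T.toGaugeData he haM hd⟩)
  rw [hspan] at hb
  exact ⟨b, levelForms_le_forms hb, hab⟩

end Acyclicity

/-! ### Descent -/

namespace GaugeTheory

variable {n : ℕ} {ι γ κ : Type*} (T : GaugeTheory n ι γ κ)

theorem _root_.LocalForms.evalAt_eq_zero {p k : ℤ} (hk : k ≠ 0) {a : Form n ι γ κ}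
    (ha : a ∈ forms n ι γ κ p k) (u : Coord n ι → ℝ) : evalAt u a = 0 := by
  induction ha using Submodule.span_induction with
  | mem x hx =>
    obtain ⟨f, l, -, hl, rfl⟩ := hx
    rcases l with _ | ⟨g, l⟩
    · exact absurd hl.symm hk
    · rw [map_mul, List.map_cons, List.prod_cons, map_mul, evalAt_gen, zero_mul, mul_zero]
  | zero => exact map_zero _
  | add x y _ _ hx hy => rw [map_add, hx, hy, add_zero]
  | smul r x _ hx => rw [map_smul, hx, smul_zero]

/-- The part of `δ b` without generators vanishes wherever the finitely many equations of motion
that occur in it hold. -/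
theorem exists_evalAt_delta_eq_zero (b : Form n ι γ κ) : ∃ E : Finset (ι × MI n),
    ∀ u, (∀ e ∈ E, evalFun u (T.eqn e) = 0) → evalAt u (T.delta b) = 0 := by
  classical
  have hgen : ∀ g : Gen n ι γ κ, ∃ E : Finset (ι × MI n),
      ∀ u, (∀ e ∈ E, evalFun u (T.eqn e) = 0) → evalAt u (T.deltaGen g) = 0 := by
    have hpos : ∀ g : Gen n ι γ κ, antigh g ≠ 1 → ∀ u, evalAt u (T.deltaGen g) = 0 := by
      intro g hg u
      rw [← T.delta_gen]
      refine evalAt_eq_zero (p := formDeg g) (k := antigh g - 1) (sub_ne_zero.2 hg)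
        (T.delta_mem (Submodule.subset_span ⟨1, [g], by simp, by simp, ?_⟩)) u
      rw [ofFun_one, one_mul, List.map_singleton, List.prod_singleton]
    rintro ((_ | _ | ⟨i, I⟩ | _) | (_ | _))
    case inl.afField =>
      refine ⟨{(i, I)}, fun u hu => ?_⟩
      rw [GaugeData.deltaGen, map_neg, evalAt_ofFun, hu _ (Finset.mem_singleton_self _), neg_zero]
    all_goals exact ⟨∅, fun u _ => hpos _ (by simp [antigh]) u⟩
  induction b using form_induction with
  | hfun f => exact ⟨∅, fun u _ => by rw [T.delta_ofFun, map_zero]⟩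
  | hadd a b ha hb =>
    obtain ⟨E, hE⟩ := ha
    obtain ⟨E', hE'⟩ := hb
    refine ⟨E ∪ E', fun u hu => ?_⟩
    rw [map_add, map_add, hE u fun e he => hu e (Finset.mem_union_left _ he),
      hE' u fun e he => hu e (Finset.mem_union_right _ he), add_zero]
  | hmul a g ha =>
    obtain ⟨E, hE⟩ := ha
    obtain ⟨E', hE'⟩ := hgen g
    refine ⟨E ∪ E', fun u hu => ?_⟩
    rw [T.delta_isOddDer, map_add, map_mul, map_mul, T.delta_gen,
      hE u fun e he => hu e (Finset.mem_union_left _ he),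
      hE' u fun e he => hu e (Finset.mem_union_right _ he), mul_zero, zero_mul, add_zero]

/-- A constant that vanishes weakly is zero, since the equations of motion are consistent. -/
theorem eq_zero_of_delta_eq_smul_one {b : Form n ι γ κ} {r : ℝ} (h : T.delta b = r • 1) :
    r = 0 := by
  obtain ⟨E, hE⟩ := T.exists_evalAt_delta_eq_zero b
  obtain ⟨u, hu⟩ := T.consistent E
  have h1 := hE u hu
  rwa [h, map_smul, map_one, smul_eq_mul, mul_one] at h1

variable {T} {p k : ℤ} {a b : Form n ι γ κ}

theorem mem_cycles_of_descent (hp1 : 1 ≤ p) (hp : p ≤ n) (hk : 1 < k)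
    (hb : b ∈ forms n ι γ κ (p - 1) (k - 1)) (h : T.delta a + extD b = 0) :
    b ∈ T.cycles (p - 1) (k - 1) := by
  refine ⟨hb, ?_⟩
  have hδb := T.delta_mem hb
  have hd : extD (T.delta b) = 0 := by
    rw [← neg_eq_zero, ← T.delta_extD, eq_neg_of_add_eq_zero_right h, map_neg, T.delta_delta,
      neg_zero]
  have key : ∃ c ∈ forms n ι γ κ (p - 1 - 1) (k - 1 - 1), T.delta b = extD c := by
    rcases (show k = 2 ∨ 2 < k by omega) with rfl | hk2
    · rcases hp1.eq_or_lt with rfl | hp1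
      · -- `δ b` is a closed function, hence a constant, which vanishes on the stationary surface.
        obtain ⟨r, hr⟩ := poincare_const (by omega) hδb hd
        refine ⟨0, zero_mem _, ?_⟩
        rw [map_zero, hr, T.eq_zero_of_delta_eq_smul_one hr, zero_smul]
      · exact poincare_zero (by omega) (by omega) hδb hd
    · exact poincare_of_pos (by omega) (by omega) hδb hd
  obtain ⟨c, hc, hbc⟩ := key
  exact ⟨-c, neg_mem hc, by rw [map_neg, hbc, add_neg_cancel]⟩

/-- Descent is well defined on classes, by the exactness of `d`. -/
theorem mem_boundaries_of_descent (hp : p ≤ n) (hk : 1 < k)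
    (hb : b ∈ forms n ι γ κ (p - 1) (k - 1)) (h : T.delta a + extD b = 0)
    (ha : a ∈ T.boundaries p k) : b ∈ T.boundaries (p - 1) (k - 1) := by
  obtain ⟨_, ⟨m, hm, rfl⟩, _, ⟨c, hc, rfl⟩, rfl⟩ := Submodule.mem_sup.1 ha
  have hc' := T.delta_mem hc
  obtain ⟨e, he, hbe⟩ := poincare_of_pos (by omega) (by omega) (sub_mem hb hc') (by
    rwa [map_add, T.delta_delta, zero_add, T.delta_extD, neg_add_eq_sub, ← map_sub] at h)
  rw [sub_eq_iff_eq_add'.1 hbe]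
  exact Submodule.add_mem_sup ⟨c, by rwa [sub_add_cancel], rfl⟩ ⟨e, he, rfl⟩

/-- Descent is injective, by the acyclicity of `δ`. -/
theorem mem_boundaries_of_mem_boundaries_descent (hk : 0 < k) (ha : a ∈ forms n ι γ κ p k)
    (h : T.delta a + extD b = 0) (hb : b ∈ T.boundaries (p - 1) (k - 1)) :
    a ∈ T.boundaries p k := by
  obtain ⟨_, ⟨m, hm, rfl⟩, _, ⟨c, hc, rfl⟩, rfl⟩ := Submodule.mem_sup.1 hb
  rw [sub_add_cancel] at hm
  have hm' : extD m ∈ forms n ι γ κ p k := by simpa using extD_mem hm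
  obtain ⟨e, he, hae⟩ := T.exists_eq_delta hk (sub_mem ha hm') (by
    rw [map_sub, T.delta_extD, sub_neg_eq_add]
    rwa [map_add, extD_extD, add_zero] at h)
  rw [sub_eq_iff_eq_add.1 hae]
  exact Submodule.add_mem_sup ⟨e, he, rfl⟩ ⟨m, hm, rfl⟩

/-- Descent is surjective, by the acyclicity of `δ`. -/
theorem exists_descent_eq (hk : 1 < k) (hb : b ∈ T.cycles (p - 1) (k - 1)) :
    ∃ a ∈ forms n ι γ κ p k, T.delta a + extD b = 0 := by
  obtain ⟨hb, c, hc, hbc⟩ := hb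
  have hb' : extD b ∈ forms n ι γ κ p (k - 1) := by simpa using extD_mem hb
  obtain ⟨m, hm, hbm⟩ := T.exists_eq_delta (by omega) hb' (by
    rw [T.delta_extD, eq_neg_of_add_eq_zero_left hbc, map_neg, extD_extD, neg_zero, neg_zero])
  rw [sub_add_cancel] at hm
  exact ⟨-m, neg_mem hm, by rw [map_neg, hbm, neg_add_cancel]⟩

theorem cls_eq_cls_iff {a a' : Form n ι γ κ} {ha : a ∈ T.cycles p k} {ha' : a' ∈ T.cycles p k} :
    T.cls a ha = T.cls a' ha' ↔ a - a' ∈ T.boundaries p k :=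
  Submodule.Quotient.eq _

variable (T) in
/-- The descent `[a] ↦ [b]`, where `δ a + d b = 0`, as a linear isomorphism. -/
theorem exists_descent_equiv (hp1 : 1 ≤ p) (hp : p ≤ n) (hk : 1 < k) :
    ∃ Φ : T.H p k ≃ₗ[ℝ] T.H (p - 1) (k - 1),
      ∀ (a b : Form n ι γ κ) (ha : a ∈ T.cycles p k),
        b ∈ forms n ι γ κ (p - 1) (k - 1) → T.delta a + extD b = 0 →
        ∃ hb : b ∈ T.cycles (p - 1) (k - 1), Φ (T.cls a ha) = T.cls b hb := by
  choose f hf hfd using fun x : T.cycles p k => x.2.2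
  have hfc := fun x => mem_cycles_of_descent hp1 hp hk (hf x) (hfd x)
  have huniq : ∀ (x : T.cycles p k) (b : Form n ι γ κ) (hb : b ∈ T.cycles (p - 1) (k - 1)),
      T.delta x + extD b = 0 → T.cls (f x) (hfc x) = T.cls b hb := by
    intro x b hb h
    refine cls_eq_cls_iff.2 (mem_boundaries_of_descent hp hk (a := 0) (sub_mem (hf x) hb.1) ?_
      (zero_mem _))
    rw [map_zero, zero_add, map_sub, sub_eq_zero]
    exact add_left_cancel ((hfd x).trans h.symm)
  let φ : T.cycles p k →ₗ[ℝ] T.H (p - 1) (k - 1) :=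
    { toFun x := T.cls (f x) (hfc x)
      map_add' x y := huniq (x + y) (f x + f y) (add_mem (hfc x) (hfc y)) (by
        rw [Submodule.coe_add, map_add, map_add, add_add_add_comm, hfd, hfd, add_zero])
      map_smul' r x := huniq (r • x) (r • f x) (Submodule.smul_mem _ r (hfc x)) (by
        rw [Submodule.coe_smul, map_smul, map_smul, ← smul_add, hfd, smul_zero]) }
  have hker : LinearMap.ker φ = (T.boundaries p k).submoduleOf (T.cycles p k) := by
    ext x
    have h : φ x = 0 ↔ f x ∈ T.boundaries (p - 1) (k - 1) :=
      (Submodule.Quotient.mk_eq_zero _).trans Iff.rfl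
    rw [LinearMap.mem_ker, h]
    exact ⟨mem_boundaries_of_mem_boundaries_descent (by omega) x.2.1 (hfd x),
      mem_boundaries_of_descent hp hk (hf x) (hfd x)⟩
  have hrange : Function.Surjective φ := by
    intro y
    obtain ⟨⟨b, hb⟩, rfl⟩ := Submodule.Quotient.mk_surjective _ y
    obtain ⟨a, ha, hab⟩ := exists_descent_eq hk hb
    exact ⟨⟨a, ha, b, hb.1, hab⟩, huniq _ b hb hab⟩
  refine ⟨(Submodule.quotEquivOfEq _ _ hker.symm).trans (φ.quotKerEquivOfSurjective hrange),
    fun a b ha hb h => ?_⟩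
  have hbc := mem_cycles_of_descent hp1 hp hk hb h
  exact ⟨hbc, huniq ⟨a, ha⟩ b hbc h⟩

theorem subsingleton_H (h : ∀ a ∈ T.cycles p k, a ∈ T.boundaries p k) : Subsingleton (T.H p k) :=
  Submodule.Quotient.subsingleton_iff.2 (eq_top_iff.2 fun x _ => h x.1 x.2)

theorem subsingleton_H_of_forms_eq_bot (h : forms n ι γ κ p k = ⊥) : Subsingleton (T.H p k) := by
  refine subsingleton_H fun a ha => ?_
  have := ha.1
  rw [h, Submodule.mem_bot] at this
  exact this ▸ zero_mem _

variable (T) in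
/-- Descending to form degree zero, where `H` vanishes by the acyclicity of `δ`. -/
theorem subsingleton_H_of_lt (hpk : p < k) : Subsingleton (T.H p k) := by
  rcases lt_or_ge p 0 with hp | hp
  · exact subsingleton_H_of_forms_eq_bot (forms_eq_bot_of_neg hp)
  obtain ⟨p, rfl⟩ := Int.eq_ofNat_of_zero_le hp
  clear hp
  induction p generalizing k with
  | zero =>
    refine subsingleton_H fun a ⟨ha, b, hb, h⟩ =>
      mem_boundaries_of_mem_boundaries_descent (b := b) (by exact_mod_cast hpk) ha h ?_
    rw [forms_eq_bot_of_neg (by simp), Submodule.mem_bot] at hb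
    exact hb ▸ zero_mem _
  | succ p ih =>
    rcases lt_or_ge (n : ℤ) (p + 1 : ℕ) with hn | hn
    · exact subsingleton_H_of_forms_eq_bot (forms_eq_bot_of_lt hn)
    obtain ⟨Φ, -⟩ := T.exists_descent_equiv (p := (p + 1 : ℕ)) (k := k) (by push_cast; omega) hn
      (by push_cast at hpk; omega)
    have h := ih (k := k - 1) (by push_cast at hpk; omega)
    rw [show ((p + 1 : ℕ) : ℤ) - 1 = p by push_cast; ring] at Φ
    exact Φ.toEquiv.subsingleton

end GaugeTheory

end LocalForms

end

theorem theorem8p1 {n : ℕ} {ι γ κ : Type*} [Finite ι] [Finite γ] [Finite κ]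
    (T : LocalForms.GaugeTheory n ι γ κ) :
    (∀ p k : ℤ, 1 ≤ p → p ≤ n → 1 < k →
      ∃ Φ : T.H p k ≃ₗ[ℝ] T.H (p - 1) (k - 1),
        ∀ (a b : LocalForms.Form n ι γ κ) (ha : a ∈ T.cycles p k),
          b ∈ LocalForms.forms n ι γ κ (p - 1) (k - 1) →
          T.delta a + LocalForms.extD b = 0 →
          ∃ hb : b ∈ T.cycles (p - 1) (k - 1), Φ (T.cls a ha) = T.cls b hb) ∧
    (∀ p k : ℤ, p < k → Subsingleton (T.H p k)) :=
  ⟨fun _ _ hp1 hp hk => T.exists_descent_equiv hp1 hp hk, fun _ _ h => T.subsingleton_H_of_lt h⟩
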